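/- Let $k$ be an algebraically closed field of characteristic zero and let $\Sigma$ be a finite group with an exact factorization $\Sigma=FG$ (that is, $F,G$ are subgroups and every element of $\Sigma$ is uniquely $xg$ with $x\in F$, $g\in G$). Write $\pi(xg)=x$ and $p(xg)=g$, and define $\triangleright:G\times F\to F$, $\triangleleft:G\times F\to G$ by $gx=(g\triangleright x)(g\triangleleft x)$. Let $\sigma_g(x,y)\in k^\times$ and $\tau_x(g,h)\in k^\times$ ($g,h\in G$, $x,y\in F$) satisfy, for all $x,y,z\in F$ and $g,h,l,s,t\in G$, $$\sigma_{g\triangleleft x}(y,z)\,\sigma_g(x,yz)=\sigma_g(xy,z)\,\sigma_g(x,y),\qquad \tau_x(gh,l)\,\tau_{l\triangleright x}(g,h)=\tau_x(h,l)\,\tau_x(g,hl),$$ $$\sigma_{ts}(x,y)\,\tau_{xy}(t,s)=\tau_x(t,s)\,\tau_y(t\triangleleft(s\triangleright x),s\triangleleft x)\,\sigma_t(s\triangleright x,(s\triangleleft x)\triangleright y)\,\sigma_s(x,y),$$ $$\sigma_g(x,1)=\sigma_g(1,x)=1,\quad \tau_x(g,1)=\tau_x(1,g)=1,\quad \sigma_1(x,y)=1,\quad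 \tau_1(g,h)=1 .$$ Let $\omega=\omega(\tau,\sigma)$ be the normalized 3-cocycle of $\Sigma$ $$\omega(a,b,c)=\tau_{\pi(c)}\bigl(p(a)\triangleleft\pi(b),p(b)\bigr)\,\sigma_{p(a)}\bigl(\pi(b),p(b)\triangleright\pi(c)\bigr).$$ Let $\mathrm{Vect}^\Sigma_\omega$ be the monoidal category of $\Sigma$-graded $k$-vector spaces (degree denoted $\|\cdot\|$) with associativity constraint $(u\otimes u')\otimes u''\mapsto\omega(\|u\|,\|u'\|,\|u''\|)\,u\otimes(u'\otimes u'')$. The group algebra $kF$, with $x\in F$ in degree $x$, is an algebra in it. Let ${}_F(\mathrm{Vect}^\Sigma_\omega)_F$ be the monoidal category of $kF$-bimodules in $\mathrm{Vect}^\Sigma_\omega$, with the tensor product $\otimes_F$ over $kF$ and actions written $x\rightharpoonup u$, $u\leftharpoonup x$. Let $\mathrm{Vect}^G_F(\sigma,\tau)$ (the description of $\mathrm{Rep}(k^G\,{}^\tau\#_\sigma kF)$ as graded spaces with a twisted action) be the monoidal category of $G$-graded vector spaces $V$ (degree denoted $|\cdot|$) with linear maps $v\mapsto v\triangleleft x$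 ($x\in F$) such that $v\triangleleft 1=v$, $(v\triangleleft x)\triangleleft y=\sigma_{|v|}(x,y)\,v\triangleleft xy$ and $|v\triangleleft x|=|v|\triangleleft x$ for homogeneous $v$; the tensor product is $V\otimes_k V'$ with $|v\otimes v'|=|v||v'|$ and $(v\otimes v')\triangleleft x=\tau_x(|v|,|v'|)\,(v\triangleleft(|v'|\triangleright x))\otimes(v'\triangleleft x)$, the associativity constraint is that of vector spaces, and the unit is $k$ in degree $1$ with trivial action. Let $\mathcal F:{}_F(\mathrm{Vect}^\Sigma_\omega)_F\to\mathrm{Vect}^G_F(\sigma,\tau)$ be the functor sending $U$ to the space ${}^FU=\{u: x\rightharpoonup u=u\ \forall x\in F\}$ with $G$-grading $|u|=p\|u\|$ and action $u\triangleleft x=u\leftharpoonup x$, and put $t=\frac1{|F|}\sum_{x\in F}x$. Then $\mathcal F$ is an equivalence of categories, and there are natural isomorphisms $\xi_{U,U'}:\mathcal F(U\otimes_F U')\to\mathcal F(U)\otimes\mathcal F(U')$ in $\mathrm{Vect}^G_F(\sigma,\tau)$, given by $$\xi\Bigl(\sum_i u_i\otimes u_i'\Bigr)=\sum_i\bigl(u_i\leftharpoonup\pi\|u_i'\|\bigr)\otimes\bigl(t\rightharpoonup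 u_i'\bigr)$$ for every representative $\sum_i u_i\otimes u'_i$, with homogeneous $u_i'$, of an $F$-invariant element of $U\otimes_FU'$, such that $(\mathcal F,\xi^{-1})$ (with a suitable unit isomorphism) is a monoidal equivalence. Moreover $\mathcal F(U)$ is finite-dimensional if and only if $U$ is, so that $(\mathcal F,\xi^{-1})$ restricts to a monoidal equivalence of the full subcategories of finite-dimensional objects. -/

import Mathlib

set_option linter.unusedSectionVars false

open CategoryTheory MonoidalCategory TensorProduct

universe u

noncomputable section

namespace KacBimodule

/-! ### Gradings of vector spaces by a finite set -/

/-- A grading of the vector space `V` by a finite set `Γ`, given by the projections onto the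
homogeneous components: a complete system of orthogonal idempotents. -/
structure Grading (k : Type u) [Field k] (Γ : Type u) [Fintype Γ] (V : Type u)
    [AddCommGroup V] [Module k V] where
  /-- `proj a` is the projection of `V` onto the component of degree `a`. -/
  proj : Γ → Module.End k V
  complete : CompleteOrthogonalIdempotents proj

namespace Grading

variable {k : Type u} [Field k] {Γ : Type u} [Fintype Γ]
variable {V : Type u} [AddCommGroup V] [Module k V]
variable {W : Type u} [AddCommGroup W] [Module k W]

/-- `v` is homogeneous of degree `a` (the zero vector is so for every `a`). -/
def Homog (gr : Grading k Γ V) (a : Γ) (v : V) : Prop := gr.proj a v = v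

theorem proj_self (gr : Grading k Γ V) (a : Γ) (v : V) : gr.proj a (gr.proj a v) = gr.proj a v :=
  LinearMap.congr_fun (gr.complete.idem a) v

theorem proj_ne (gr : Grading k Γ V) {a b : Γ} (h : a ≠ b) (v : V) :
    gr.proj a (gr.proj b v) = 0 :=
  LinearMap.congr_fun (gr.complete.ortho h) v

theorem homog_proj (gr : Grading k Γ V) (a : Γ) (v : V) : gr.Homog a (gr.proj a v) :=
  gr.proj_self a v

theorem sum_proj (gr : Grading k Γ V) (v : V) : ∑ a, gr.proj a v = v := by
  have := LinearMap.congr_fun gr.complete.complete v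
  simpa using this

open Classical in
theorem Homog.proj_eq {gr : Grading k Γ V} {a : Γ} {v : V} (h : gr.Homog a v) (b : Γ) :
    gr.proj b v = if b = a then v else 0 := by
  split_ifs with hb
  · subst hb; exact h
  · rw [← h]; exact gr.proj_ne hb v

theorem Homog.add {gr : Grading k Γ V} {a : Γ} {v w : V} (h : gr.Homog a v) (h' : gr.Homog a w) :
    gr.Homog a (v + w) := by
  unfold Homog at *; rw [map_add, h, h']

theorem Homog.smul {gr : Grading k Γ V} {a : Γ} {v : V} (c : k) (h : gr.Homog a v) :
    gr.Homog a (c • v) := by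
  unfold Homog at *; rw [map_smul, h]

theorem homog_iff {gr : Grading k Γ V} {a : Γ} {v : V} : gr.Homog a v ↔ gr.proj a v = v := Iff.rfl

/-- Two linear maps which agree on homogeneous vectors are equal. -/
theorem hom_ext (gr : Grading k Γ V) {f g : V →ₗ[k] W}
    (h : ∀ a v, gr.Homog a v → f v = g v) : f = g := by
  ext v
  rw [← gr.sum_proj v, map_sum, map_sum]
  exact Finset.sum_congr rfl fun a _ => h a _ (gr.homog_proj a v)

/-- A criterion for a linear map to preserve degrees. -/
theorem comm_of_homog (gr : Grading k Γ V) (gr' : Grading k Γ W) (f : V →ₗ[k] W)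
    (h : ∀ a v, gr.Homog a v → gr'.Homog a (f v)) (a : Γ) (v : V) :
    f (gr.proj a v) = gr'.proj a (f v) := by
  classical
  have : f ∘ₗ gr.proj a = gr'.proj a ∘ₗ f := by
    refine gr.hom_ext fun b v hv => ?_
    simp only [LinearMap.comp_apply, hv.proj_eq, (h b v hv).proj_eq]
    split_ifs <;> simp
  exact LinearMap.congr_fun this v

/-- A criterion for a family of endomorphisms to be a grading. -/
def ofSpan (proj : Γ → Module.End k V) (h1 : ∀ v, ∑ a, proj a v = v)
    (h2 : ∀ a b v, a ≠ b → proj a (proj b v) = 0) : Grading k Γ V where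
  proj := proj
  complete := CompleteOrthogonalIdempotents.iff_ortho_complete.2
    ⟨fun a b h => LinearMap.ext fun v => h2 a b v h, LinearMap.ext fun v => by
      simpa using h1 v⟩

variable {X : Type u} [AddCommGroup X] [Module k X]

theorem tensor_ext (gr : Grading k Γ V) (gr' : Grading k Γ W) {f g : V ⊗[k] W →ₗ[k] X}
    (h : ∀ a b v w, gr.Homog a v → gr'.Homog b w → f (v ⊗ₜ w) = g (v ⊗ₜ w)) : f = g := by
  refine TensorProduct.ext (gr.hom_ext fun a v hv => gr'.hom_ext fun b w hw => ?_)
  exact h a b v w hv hw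

variable [Group Γ]

/-- The tensor product grading: `V_a ⊗ W_b` has degree `a * b`. -/
def tensor (gr : Grading k Γ V) (gr' : Grading k Γ W) : Grading k Γ (V ⊗[k] W) :=
  ofSpan (fun c => ∑ a, TensorProduct.map (gr.proj a) (gr'.proj (a⁻¹ * c)))
    (by
      classical
      have : (∑ c, ∑ a, TensorProduct.map (gr.proj a) (gr'.proj (a⁻¹ * c))) = LinearMap.id := by
        refine TensorProduct.ext' fun v w => ?_
        simp only [LinearMap.sum_apply, TensorProduct.map_tmul, LinearMap.id_apply]
        rw [Finset.sum_comm]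
        have : ∀ a : Γ, ∑ c, gr.proj a v ⊗ₜ[k] gr'.proj (a⁻¹ * c) w = gr.proj a v ⊗ₜ[k] w := by
          intro a
          rw [← TensorProduct.tmul_sum]
          congr 1
          conv_rhs => rw [← gr'.sum_proj w]
          exact Fintype.sum_equiv (Equiv.mulLeft a⁻¹) _ _ (fun c => rfl)
        simp_rw [this]
        rw [← TensorProduct.sum_tmul, gr.sum_proj]
      intro z
      simpa only [LinearMap.sum_apply, LinearMap.id_apply] using LinearMap.congr_fun this z)
    (by
      classical
      intro c d z hcd
      have : (∑ a, TensorProduct.map (gr.proj a) (gr'.proj (a⁻¹ * c))) ∘ₗ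
          (∑ a, TensorProduct.map (gr.proj a) (gr'.proj (a⁻¹ * d))) = 0 := by
        refine TensorProduct.ext' fun v w => ?_
        simp only [LinearMap.sum_apply, TensorProduct.map_tmul, LinearMap.comp_apply,
          map_sum, LinearMap.zero_apply]
        refine Finset.sum_eq_zero fun a _ => Finset.sum_eq_zero fun b _ => ?_
        by_cases hab : b = a
        · subst hab
          rw [gr'.proj_ne (by simpa using hcd), TensorProduct.tmul_zero]
        · rw [gr.proj_ne hab, TensorProduct.zero_tmul]
      exact LinearMap.congr_fun this z)

theorem Homog.tmul {gr : Grading k Γ V} {gr' : Grading k Γ W} {a b : Γ} {v : V} {w : W}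
    (hv : gr.Homog a v) (hw : gr'.Homog b w) : (gr.tensor gr').Homog (a * b) (v ⊗ₜ[k] w) := by
  classical
  change (∑ c, TensorProduct.map (gr.proj c) (gr'.proj (c⁻¹ * (a * b)))) (v ⊗ₜ[k] w) = _
  simp only [LinearMap.sum_apply, TensorProduct.map_tmul]
  rw [Finset.sum_eq_single a]
  · rw [hv, hw.proj_eq, if_pos (by group)]
  · intro c _ hc
    rw [hv.proj_eq, if_neg hc, TensorProduct.zero_tmul]
  · simp

/-- The one-dimensional grading of `k`, concentrated in degree `1`. -/
def unit (k : Type u) [Field k] (Γ : Type u) [Fintype Γ] [Group Γ] : Grading k Γ k := by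
  classical
  exact ofSpan (fun a => if a = 1 then LinearMap.id else 0)
    (fun v => by
      rw [Finset.sum_eq_single 1] <;> simp +contextual)
    (fun a b v h => by
      by_cases ha : a = 1
      · subst ha; simp [Ne.symm h]
      · simp [ha])

theorem homog_unit (c : k) : (unit k Γ).Homog 1 c := by
  simp [Homog, unit, ofSpan]

theorem unit_eq_one {a : Γ} {c : k} (h : (unit k Γ).Homog a c) (hc : c ≠ 0) : a = 1 := by
  by_contra ha
  have := h
  simp [Homog, unit, ofSpan, ha] at this
  exact hc this.symm

end Grading

/-! ### The monoidal category of graded vector spaces twisted by a 3-cocycle -/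

/-- A normalized 3-cocycle of the group `Γ` with values in `kˣ` (trivial action). -/
structure Cocycle (k : Type u) [Field k] (Γ : Type u) [Group Γ] where
  toFun : Γ → Γ → Γ → kˣ
  cocycle : ∀ a b c d,
    toFun a b (c * d) * toFun (a * b) c d = toFun b c d * toFun a (b * c) d * toFun a b c
  one_left : ∀ b c, toFun 1 b c = 1
  one_mid : ∀ a c, toFun a 1 c = 1
  one_right : ∀ a b, toFun a b 1 = 1

namespace Cocycle

variable {k : Type u} [Field k] {Γ : Type u} [Group Γ] (ω : Cocycle k Γ)

/-- The values of `ω` as scalars. -/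
def val (a b c : Γ) : k := (ω.toFun a b c : k)

/-- The values of the inverse of `ω` as scalars. -/
def valInv (a b c : Γ) : k := ((ω.toFun a b c)⁻¹ : kˣ)

theorem val_mul_valInv (a b c : Γ) : ω.val a b c * ω.valInv a b c = 1 := Units.mul_inv _

theorem valInv_mul_val (a b c : Γ) : ω.valInv a b c * ω.val a b c = 1 := Units.inv_mul _

theorem val_cocycle (a b c d : Γ) : ω.val a b (c * d) * ω.val (a * b) c d =
    ω.val b c d * ω.val a (b * c) d * ω.val a b c := by
  have := congrArg Units.val (ω.cocycle a b c d)
  simp only [Units.val_mul] at this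
  exact this

theorem val_one_left (b c : Γ) : ω.val 1 b c = 1 := by simp [val, ω.one_left]

theorem val_one_mid (a c : Γ) : ω.val a 1 c = 1 := by simp [val, ω.one_mid]

theorem val_one_right (a b : Γ) : ω.val a b 1 = 1 := by simp [val, ω.one_right]

end Cocycle

/-! ### Linear maps between tensor products of graded spaces -/

namespace Grading

variable {k : Type u} [Field k] {Γ : Type u} [Group Γ] [Fintype Γ]
variable {U : Type u} [AddCommGroup U] [Module k U] (gU : Grading k Γ U)
variable {V : Type u} [AddCommGroup V] [Module k V] (gV : Grading k Γ V)
variable {W : Type u} [AddCommGroup W] [Module k W] (gW : Grading k Γ W)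
variable {T : Type u} [AddCommGroup T] [Module k T] (gT : Grading k Γ T)
variable {X : Type u} [AddCommGroup X] [Module k X]

/-- The linear map of `(U ⊗ V) ⊗ W` to `U ⊗ (V ⊗ W)` that is given on homogeneous vectors of
degrees `a`, `b`, `c` by `(u ⊗ v) ⊗ w ↦ f a b c • u ⊗ (v ⊗ w)`. -/
def assocLin (f : Γ → Γ → Γ → k) : (U ⊗[k] V) ⊗[k] W →ₗ[k] U ⊗[k] (V ⊗[k] W) :=
  ∑ a, ∑ b, ∑ c, f a b c • (TensorProduct.assoc k U V W).toLinearMap ∘ₗ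
    TensorProduct.map (TensorProduct.map (gU.proj a) (gV.proj b)) (gW.proj c)

/-- The linear map of `U ⊗ (V ⊗ W)` to `(U ⊗ V) ⊗ W` that is given on homogeneous vectors of
degrees `a`, `b`, `c` by `u ⊗ (v ⊗ w) ↦ f a b c • (u ⊗ v) ⊗ w`. -/
def assocInvLin (f : Γ → Γ → Γ → k) : U ⊗[k] (V ⊗[k] W) →ₗ[k] (U ⊗[k] V) ⊗[k] W :=
  ∑ a, ∑ b, ∑ c, f a b c • (TensorProduct.assoc k U V W).symm.toLinearMap ∘ₗ
    TensorProduct.map (gU.proj a) (TensorProduct.map (gV.proj b) (gW.proj c))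

variable {gU gV gW gT} in
theorem assocLin_tmul (f : Γ → Γ → Γ → k) {a b c : Γ} {x : U} {y : V} {z : W}
    (hx : gU.Homog a x) (hy : gV.Homog b y) (hz : gW.Homog c z) :
    assocLin gU gV gW f ((x ⊗ₜ y) ⊗ₜ z) = f a b c • (x ⊗ₜ (y ⊗ₜ z)) := by
  classical
  simp only [assocLin, LinearMap.sum_apply, LinearMap.smul_apply, LinearMap.comp_apply,
    TensorProduct.map_tmul, hx.proj_eq, hy.proj_eq, hz.proj_eq]
  rw [Finset.sum_eq_single a, Finset.sum_eq_single b, Finset.sum_eq_single c]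
  all_goals simp +contextual

variable {gU gV gW gT} in
theorem assocInvLin_tmul (f : Γ → Γ → Γ → k) {a b c : Γ} {x : U} {y : V} {z : W}
    (hx : gU.Homog a x) (hy : gV.Homog b y) (hz : gW.Homog c z) :
    assocInvLin gU gV gW f (x ⊗ₜ (y ⊗ₜ z)) = f a b c • ((x ⊗ₜ y) ⊗ₜ z) := by
  classical
  simp only [assocInvLin, LinearMap.sum_apply, LinearMap.smul_apply, LinearMap.comp_apply,
    TensorProduct.map_tmul, hx.proj_eq, hy.proj_eq, hz.proj_eq]
  rw [Finset.sum_eq_single a, Finset.sum_eq_single b, Finset.sum_eq_single c]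
  all_goals simp +contextual

theorem ext₃ {f g : (U ⊗[k] V) ⊗[k] W →ₗ[k] X}
    (h : ∀ a b c x y z, gU.Homog a x → gV.Homog b y → gW.Homog c z →
      f ((x ⊗ₜ y) ⊗ₜ z) = g ((x ⊗ₜ y) ⊗ₜ z)) : f = g := by
  refine TensorProduct.ext (gU.tensor_ext gV fun a b x y hx hy => gW.hom_ext fun c z hz => ?_)
  exact h a b c x y z hx hy hz

theorem ext₃' {f g : U ⊗[k] (V ⊗[k] W) →ₗ[k] X}
    (h : ∀ a b c x y z, gU.Homog a x → gV.Homog b y → gW.Homog c z →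
      f (x ⊗ₜ (y ⊗ₜ z)) = g (x ⊗ₜ (y ⊗ₜ z))) : f = g := by
  refine TensorProduct.ext (gU.hom_ext fun a x hx => gV.tensor_ext gW fun b c y z hy hz => ?_)
  exact h a b c x y z hx hy hz

theorem ext₄ {f g : ((U ⊗[k] V) ⊗[k] W) ⊗[k] T →ₗ[k] X}
    (h : ∀ a b c d x y z t, gU.Homog a x → gV.Homog b y → gW.Homog c z → gT.Homog d t →
      f (((x ⊗ₜ y) ⊗ₜ z) ⊗ₜ t) = g (((x ⊗ₜ y) ⊗ₜ z) ⊗ₜ t)) : f = g := by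
  refine TensorProduct.ext (gU.ext₃ gV gW fun a b c x y z hx hy hz => gT.hom_ext fun d t ht => ?_)
  exact h a b c d x y z t hx hy hz ht

/-- The linear equivalence underlying the associativity constraint
`(u ⊗ v) ⊗ w ↦ ω(‖u‖, ‖v‖, ‖w‖) u ⊗ (v ⊗ w)`. -/
def assocEquiv (ω : Cocycle k Γ) : (U ⊗[k] V) ⊗[k] W ≃ₗ[k] U ⊗[k] (V ⊗[k] W) :=
  LinearEquiv.ofLinearMap (assocLin gU gV gW ω.val) (assocInvLin gU gV gW ω.valInv)
    (gU.ext₃' gV gW fun a b c x y z hx hy hz => by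
      rw [LinearMap.comp_apply, assocInvLin_tmul _ hx hy hz, map_smul,
        assocLin_tmul _ hx hy hz, smul_smul, ω.valInv_mul_val, one_smul, LinearMap.id_apply])
    (gU.ext₃ gV gW fun a b c x y z hx hy hz => by
      rw [LinearMap.comp_apply, assocLin_tmul _ hx hy hz, map_smul,
        assocInvLin_tmul _ hx hy hz, smul_smul, ω.val_mul_valInv, one_smul, LinearMap.id_apply])

theorem assocEquiv_toLinearMap (ω : Cocycle k Γ) :
    (assocEquiv gU gV gW ω).toLinearMap = assocLin gU gV gW ω.val := rfl

variable {gU gV gW gT} in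
theorem assocEquiv_tmul (ω : Cocycle k Γ) {a b c : Γ} {x : U} {y : V} {z : W}
    (hx : gU.Homog a x) (hy : gV.Homog b y) (hz : gW.Homog c z) :
    assocEquiv gU gV gW ω ((x ⊗ₜ y) ⊗ₜ z) = ω.val a b c • (x ⊗ₜ (y ⊗ₜ z)) :=
  assocLin_tmul _ hx hy hz

theorem assocEquiv_proj (ω : Cocycle k Γ) (d : Γ) (t : (U ⊗[k] V) ⊗[k] W) :
    assocEquiv gU gV gW ω (((gU.tensor gV).tensor gW).proj d t) =
      (gU.tensor (gV.tensor gW)).proj d (assocEquiv gU gV gW ω t) := by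
  classical
  refine LinearMap.congr_fun (f := (assocEquiv gU gV gW ω).toLinearMap ∘ₗ
    ((gU.tensor gV).tensor gW).proj d) (g := (gU.tensor (gV.tensor gW)).proj d ∘ₗ
      (assocEquiv gU gV gW ω).toLinearMap) (gU.ext₃ gV gW fun a b c x y z hx hy hz => ?_) t
  rw [LinearMap.comp_apply, LinearMap.comp_apply, LinearEquiv.coe_coe,
    assocEquiv_tmul _ hx hy hz, map_smul,
    ((hx.tmul hy).tmul hz).proj_eq, (hx.tmul (hy.tmul hz)).proj_eq, mul_assoc]
  split_ifs
  · rw [assocEquiv_tmul _ hx hy hz]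
  · rw [map_zero, smul_zero]

theorem lid_proj (b : Γ) (t : k ⊗[k] U) :
    TensorProduct.lid k U (((unit k Γ).tensor gU).proj b t) =
      gU.proj b (TensorProduct.lid k U t) := by
  classical
  refine LinearMap.congr_fun (f := (TensorProduct.lid k U).toLinearMap ∘ₗ
    ((unit k Γ).tensor gU).proj b) (g := gU.proj b ∘ₗ (TensorProduct.lid k U).toLinearMap)
    ((unit k Γ).tensor_ext gU fun c d x y hx hy => ?_) t
  by_cases hx0 : x = 0
  · rw [hx0, TensorProduct.zero_tmul, map_zero, map_zero]
  obtain rfl := unit_eq_one hx hx0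
  rw [LinearMap.comp_apply, LinearMap.comp_apply, (hx.tmul hy).proj_eq, one_mul,
    LinearEquiv.coe_coe, TensorProduct.lid_tmul, map_smul, hy.proj_eq]
  split_ifs
  · rw [TensorProduct.lid_tmul]
  · rw [map_zero, smul_zero]

theorem rid_proj (b : Γ) (t : U ⊗[k] k) :
    TensorProduct.rid k U ((gU.tensor (unit k Γ)).proj b t) =
      gU.proj b (TensorProduct.rid k U t) := by
  classical
  refine LinearMap.congr_fun (f := (TensorProduct.rid k U).toLinearMap ∘ₗ
    (gU.tensor (unit k Γ)).proj b) (g := gU.proj b ∘ₗ (TensorProduct.rid k U).toLinearMap)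
    (gU.tensor_ext (unit k Γ) fun c d y x hy hx => ?_) t
  by_cases hx0 : x = 0
  · rw [hx0, TensorProduct.tmul_zero, map_zero, map_zero]
  obtain rfl := unit_eq_one hx hx0
  rw [LinearMap.comp_apply, LinearMap.comp_apply, (hy.tmul hx).proj_eq, mul_one,
    LinearEquiv.coe_coe, TensorProduct.rid_tmul, map_smul, hy.proj_eq]
  split_ifs
  · rw [TensorProduct.rid_tmul]
  · rw [map_zero, smul_zero]

theorem map_proj {gU : Grading k Γ U} {gV : Grading k Γ V} {gW : Grading k Γ W}
    {gT : Grading k Γ T} {f : U →ₗ[k] V} {g : W →ₗ[k] T}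
    (hf : ∀ a u, f (gU.proj a u) = gV.proj a (f u))
    (hg : ∀ a u, g (gW.proj a u) = gT.proj a (g u)) (b : Γ) (t : U ⊗[k] W) :
    TensorProduct.map f g ((gU.tensor gW).proj b t) =
      (gV.tensor gT).proj b (TensorProduct.map f g t) := by
  classical
  refine LinearMap.congr_fun (f := TensorProduct.map f g ∘ₗ (gU.tensor gW).proj b)
    (g := (gV.tensor gT).proj b ∘ₗ TensorProduct.map f g)
    (gU.tensor_ext gW fun a c x y hx hy => ?_) t
  have hfx : gV.Homog a (f x) := by rw [homog_iff, ← hf, hx]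
  have hgy : gT.Homog c (g y) := by rw [homog_iff, ← hg, hy]
  rw [LinearMap.comp_apply, LinearMap.comp_apply, (hx.tmul hy).proj_eq, TensorProduct.map_tmul,
    (hfx.tmul hgy).proj_eq]
  split_ifs
  · rw [TensorProduct.map_tmul]
  · rw [map_zero]

theorem pentagon (ω : Cocycle k Γ) :
    TensorProduct.map LinearMap.id (assocEquiv gV gW gT ω).toLinearMap ∘ₗ
      (assocEquiv gU (gV.tensor gW) gT ω).toLinearMap ∘ₗ
        TensorProduct.map (assocEquiv gU gV gW ω).toLinearMap LinearMap.id =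
    (assocEquiv gU gV (gW.tensor gT) ω).toLinearMap ∘ₗ
      (assocEquiv (gU.tensor gV) gW gT ω).toLinearMap := by
  refine gU.ext₄ gV gW gT fun a b c d x y z t hx hy hz ht => ?_
  simp only [LinearMap.comp_apply, TensorProduct.map_tmul, LinearEquiv.coe_coe,
    assocEquiv_tmul ω hx hy hz, LinearMap.id_apply]
  rw [assocEquiv_tmul ω (hx.tmul hy) hz ht, ← TensorProduct.smul_tmul', map_smul, map_smul,
    map_smul, assocEquiv_tmul ω hx (hy.tmul hz) ht, assocEquiv_tmul ω hx hy (hz.tmul ht),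
    map_smul, TensorProduct.map_tmul, LinearEquiv.coe_coe, assocEquiv_tmul ω hy hz ht,
    TensorProduct.tmul_smul, LinearMap.id_apply, smul_smul, smul_smul, smul_smul]
  congr 1
  linear_combination - ω.val_cocycle a b c d

theorem triangle (ω : Cocycle k Γ) :
    TensorProduct.map LinearMap.id (TensorProduct.lid k V).toLinearMap ∘ₗ
      (assocEquiv gU (unit k Γ) gV ω).toLinearMap =
    TensorProduct.map (TensorProduct.rid k U).toLinearMap LinearMap.id := by
  refine gU.ext₃ (unit k Γ) gV fun a b c x y z hx hy hz => ?_
  by_cases hy0 : y = 0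
  · rw [hy0, TensorProduct.tmul_zero, TensorProduct.zero_tmul, map_zero, map_zero]
  obtain rfl := unit_eq_one hy hy0
  rw [LinearMap.comp_apply, LinearEquiv.coe_coe, assocEquiv_tmul ω hx hy hz, ω.val_one_mid,
    one_smul, TensorProduct.map_tmul, TensorProduct.map_tmul, LinearEquiv.coe_coe,
    LinearEquiv.coe_coe, TensorProduct.lid_tmul, TensorProduct.rid_tmul, LinearMap.id_apply,
    LinearMap.id_apply, TensorProduct.smul_tmul]

end Grading

/-- An object of the category of `Γ`-graded vector spaces (the cocycle `ω` only enters in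
the associativity constraint). -/
structure GrVec {k : Type u} [Field k] {Γ : Type u} [Group Γ] [Fintype Γ] (ω : Cocycle k Γ) where
  carrier : Type u
  [addCommGroup : AddCommGroup carrier]
  [module : Module k carrier]
  gr : Grading k Γ carrier

attribute [instance] GrVec.addCommGroup GrVec.module

namespace GrVec

variable {k : Type u} [Field k] {Γ : Type u} [Group Γ] [Fintype Γ] {ω : Cocycle k Γ}

/-- Morphisms are the linear maps that preserve degrees. -/
@[ext]
structure Hom (U V : GrVec ω) where
  toLin : U.carrier →ₗ[k] V.carrier
  comm : ∀ a u, toLin (U.gr.proj a u) = V.gr.proj a (toLin u)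

instance : Category (GrVec ω) where
  Hom U V := Hom U V
  id U := ⟨LinearMap.id, fun _ _ => rfl⟩
  comp f g := ⟨g.toLin ∘ₗ f.toLin, fun a u => by
    rw [LinearMap.comp_apply, f.comm, g.comm, LinearMap.comp_apply]⟩

/-- The linear map underlying a morphism. -/
def lin {U V : GrVec ω} (f : U ⟶ V) : U.carrier →ₗ[k] V.carrier := Hom.toLin f

theorem lin_proj {U V : GrVec ω} (f : U ⟶ V) (a : Γ) (u : U.carrier) :
    lin f (U.gr.proj a u) = V.gr.proj a (lin f u) := Hom.comm f a u

theorem lin_homog {U V : GrVec ω} (f : U ⟶ V) {a : Γ} {u : U.carrier} (h : U.gr.Homog a u) :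
    V.gr.Homog a (lin f u) := by
  unfold Grading.Homog at *; rw [← lin_proj, h]

@[ext]
theorem hom_ext {U V : GrVec ω} {f g : U ⟶ V} (h : lin f = lin g) : f = g := Hom.ext h

@[simp] theorem lin_id (U : GrVec ω) : lin (𝟙 U) = LinearMap.id := rfl

@[simp] theorem lin_comp {U V W : GrVec ω} (f : U ⟶ V) (g : V ⟶ W) :
    lin (f ≫ g) = lin g ∘ₗ lin f := rfl

theorem congr_lin {U V : GrVec ω} {f g : U ⟶ V} (h : f = g) (u : U.carrier) :
    lin f u = lin g u := by rw [h]

/-- A morphism from a linear map which preserves degrees of homogeneous vectors. -/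
def mkHom {U V : GrVec ω} (f : U.carrier →ₗ[k] V.carrier)
    (h : ∀ a u, U.gr.Homog a u → V.gr.Homog a (f u)) : U ⟶ V :=
  Hom.mk f (U.gr.comm_of_homog V.gr f h)

@[simp] theorem lin_mkHom {U V : GrVec ω} (f : U.carrier →ₗ[k] V.carrier)
    (h : ∀ a u, U.gr.Homog a u → V.gr.Homog a (f u)) : lin (mkHom f h) = f := rfl

/-- A degree preserving linear equivalence is an isomorphism. -/
def mkIso {U V : GrVec ω} (e : U.carrier ≃ₗ[k] V.carrier)
    (h : ∀ a u, e (U.gr.proj a u) = V.gr.proj a (e u)) : U ≅ V where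
  hom := Hom.mk e.toLinearMap h
  inv := Hom.mk e.symm.toLinearMap fun a u => by
    rw [LinearEquiv.coe_coe, LinearEquiv.symm_apply_eq, h, LinearEquiv.apply_symm_apply]
  hom_inv_id := Hom.ext (LinearMap.ext fun u => e.symm_apply_apply u)
  inv_hom_id := Hom.ext (LinearMap.ext fun u => e.apply_symm_apply u)

@[simp] theorem lin_mkIso_hom {U V : GrVec ω} (e : U.carrier ≃ₗ[k] V.carrier)
    (h : ∀ a u, e (U.gr.proj a u) = V.gr.proj a (e u)) : lin (mkIso e h).hom = e.toLinearMap := rfl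

/-- The tensor product of graded vector spaces. -/
def tensor (U V : GrVec ω) : GrVec ω where
  carrier := U.carrier ⊗[k] V.carrier
  gr := U.gr.tensor V.gr

/-- The associativity constraint
`(u ⊗ u') ⊗ u'' ↦ ω(‖u‖, ‖u'‖, ‖u''‖) u ⊗ (u' ⊗ u'')`. -/
def assocIso (U V W : GrVec ω) : (U.tensor V).tensor W ≅ U.tensor (V.tensor W) :=
  mkIso (Grading.assocEquiv U.gr V.gr W.gr ω) (Grading.assocEquiv_proj U.gr V.gr W.gr ω)

/-- The unit object, `k` in degree `1`. -/
def unit (ω : Cocycle k Γ) : GrVec ω where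
  carrier := k
  gr := Grading.unit k Γ

/-- The left unit constraint `c ⊗ u ↦ c • u`. -/
def leftUnitIso (U : GrVec ω) : (unit ω).tensor U ≅ U :=
  mkIso (TensorProduct.lid k U.carrier) U.gr.lid_proj

/-- The right unit constraint `u ⊗ c ↦ c • u`. -/
def rightUnitIso (U : GrVec ω) : U.tensor (unit ω) ≅ U :=
  mkIso (TensorProduct.rid k U.carrier) U.gr.rid_proj

/-- The tensor product of two morphisms. -/
def tensorMap {U V U' V' : GrVec ω} (f : U ⟶ V) (g : U' ⟶ V') : U.tensor U' ⟶ V.tensor V' :=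
  Hom.mk (TensorProduct.map (lin f) (lin g)) (Grading.map_proj (lin_proj f) (lin_proj g))

instance : MonoidalCategoryStruct (GrVec ω) where
  tensorObj := tensor
  whiskerLeft U _ _ g := tensorMap (𝟙 U) g
  whiskerRight f U := tensorMap f (𝟙 U)
  tensorHom f g := tensorMap f g
  tensorUnit := unit ω
  associator := assocIso
  leftUnitor := leftUnitIso
  rightUnitor := rightUnitIso

theorem assoc_natural {X₁ X₂ X₃ Y₁ Y₂ Y₃ : GrVec ω} (f₁ : X₁ ⟶ Y₁) (f₂ : X₂ ⟶ Y₂)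
    (f₃ : X₃ ⟶ Y₃) : (Grading.assocEquiv Y₁.gr Y₂.gr Y₃.gr ω).toLinearMap ∘ₗ
      TensorProduct.map (TensorProduct.map (lin f₁) (lin f₂)) (lin f₃) =
    TensorProduct.map (lin f₁) (TensorProduct.map (lin f₂) (lin f₃)) ∘ₗ
      (Grading.assocEquiv X₁.gr X₂.gr X₃.gr ω).toLinearMap := by
  refine X₁.gr.ext₃ X₂.gr X₃.gr fun a b c x y z hx hy hz => ?_
  rw [LinearMap.comp_apply, LinearMap.comp_apply, LinearEquiv.coe_coe, LinearEquiv.coe_coe,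
    Grading.assocEquiv_tmul _ hx hy hz, map_smul,
    TensorProduct.map_tmul, TensorProduct.map_tmul, TensorProduct.map_tmul, TensorProduct.map_tmul,
    Grading.assocEquiv_tmul _ (lin_homog f₁ hx) (lin_homog f₂ hy) (lin_homog f₃ hz)]

instance : MonoidalCategory (GrVec ω) :=
  MonoidalCategory.ofTensorHom
    (id_tensorHom_id := fun _ _ => hom_ext TensorProduct.map_id)
    (id_tensorHom := fun _ _ _ _ => rfl)
    (tensorHom_id := fun _ _ => rfl)
    (tensorHom_comp_tensorHom := fun f₁ f₂ g₁ g₂ =>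
      hom_ext (TensorProduct.map_comp (lin g₁) (lin g₂) (lin f₁) (lin f₂)).symm)
    (associator_naturality := fun f₁ f₂ f₃ => hom_ext (assoc_natural f₁ f₂ f₃))
    (leftUnitor_naturality := fun {X Y} f => hom_ext <| by
      refine TensorProduct.ext' fun (c : k) x => ?_
      exact (map_smul (lin f) c x).symm)
    (rightUnitor_naturality := fun {X Y} f => hom_ext <| by
      refine TensorProduct.ext' fun x (c : k) => ?_
      exact (map_smul (lin f) c x).symm)
    (pentagon := fun W X Y Z => hom_ext (Grading.pentagon W.gr X.gr Y.gr Z.gr ω))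
    (triangle := fun X Y => hom_ext (Grading.triangle X.gr Y.gr ω))

theorem lin_whiskerLeft (U : GrVec ω) {V W : GrVec ω} (g : V ⟶ W) :
    lin (U ◁ g) = TensorProduct.map LinearMap.id (lin g) := rfl

theorem lin_whiskerRight {V W : GrVec ω} (g : V ⟶ W) (U : GrVec ω) :
    lin (g ▷ U) = TensorProduct.map (lin g) LinearMap.id := rfl

theorem lin_associator (U V W : GrVec ω) : 
    lin (α_ U V W).hom = (Grading.assocEquiv U.gr V.gr W.gr ω).toLinearMap := rfl

theorem lin_leftUnitor (U : GrVec ω) :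
    lin (λ_ U).hom = (TensorProduct.lid k U.carrier).toLinearMap := rfl

theorem lin_rightUnitor (U : GrVec ω) :
    lin (ρ_ U).hom = (TensorProduct.rid k U.carrier).toLinearMap := rfl

end GrVec

/-! ### Coequalizers, and tensoring preserves colimits -/

namespace Grading

variable {k : Type u} [Field k] {Γ : Type u} [Fintype Γ]
variable {U : Type u} [AddCommGroup U] [Module k U] (gU : Grading k Γ U)
variable {V : Type u} [AddCommGroup V] [Module k V] (gV : Grading k Γ V)
variable {W : Type u} [AddCommGroup W] [Module k W] (gW : Grading k Γ W)

/-- The grading of the quotient by a graded subspace. -/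
def quotient (N : Submodule k V) (h : ∀ a, N ≤ N.comap (gV.proj a)) : Grading k Γ (V ⧸ N) :=
  ofSpan (fun a => N.mapQ N (gV.proj a) (h a))
    (fun v => by
      obtain ⟨v, rfl⟩ := N.mkQ_surjective v
      simp only [Submodule.mkQ_apply, Submodule.mapQ_apply]
      conv_rhs => rw [← gV.sum_proj v]
      exact (map_sum N.mkQ (fun a => gV.proj a v) Finset.univ).symm)
    (fun a b v hab => by
      obtain ⟨v, rfl⟩ := N.mkQ_surjective v
      simp only [Submodule.mkQ_apply, Submodule.mapQ_apply]
      rw [gV.proj_ne hab, Submodule.Quotient.mk_zero])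

theorem quotient_proj_mk (N : Submodule k V) (h : ∀ a, N ≤ N.comap (gV.proj a)) (a : Γ) (v : V) :
    (gV.quotient N h).proj a (N.mkQ v) = N.mkQ (gV.proj a v) := rfl

/-- The grading of a space of linear maps attached to permutations `s` of the set of degrees: a map
of degree `c` sends degree `a` to degree `s c a`. -/
def hom (s : Γ → Γ → Γ) (hs : ∀ a, Function.Bijective fun c => s c a) :
    Grading k Γ (U →ₗ[k] W) :=
  ofSpan (fun c => ∑ a, (LinearMap.lcomp k W (gU.proj a)) ∘ₗ (LinearMap.compRight k (gW.proj (s c a))))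
    (fun f => by
      ext u
      simp only [LinearMap.sum_apply, LinearMap.comp_apply, LinearMap.lcomp_apply,
        LinearMap.compRight_apply]
      rw [Finset.sum_comm]
      have : ∀ a : Γ, ∑ c, gW.proj (s c a) (f (gU.proj a u)) = f (gU.proj a u) := by
        intro a
        conv_rhs => rw [← gW.sum_proj (f (gU.proj a u))]
        exact Fintype.sum_equiv (Equiv.ofBijective _ (hs a)) _ _ (fun c => rfl)
      simp_rw [this]
      rw [← map_sum, gU.sum_proj])
    (fun c d f hcd => by
      ext u
      simp only [LinearMap.sum_apply, LinearMap.comp_apply, LinearMap.lcomp_apply,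
        LinearMap.compRight_apply, map_sum, LinearMap.zero_apply]
      refine Finset.sum_eq_zero fun a _ => Finset.sum_eq_zero fun b _ => ?_
      by_cases hab : a = b
      · subst hab
        rw [gU.proj_self, gW.proj_ne fun h => hcd ((hs a).injective h)]
      · rw [gU.proj_ne hab, map_zero, map_zero, map_zero])

theorem hom_proj_apply (s : Γ → Γ → Γ) (hs : ∀ a, Function.Bijective fun c => s c a)
    (c : Γ) (f : U →ₗ[k] W) {a : Γ} {u : U} (hu : gU.Homog a u) :
    (gU.hom gW s hs).proj c f u = gW.proj (s c a) (f u) := by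
  classical
  change (∑ a, (LinearMap.lcomp k W (gU.proj a)) ∘ₗ (LinearMap.compRight k (gW.proj (s c a)))) f u = _
  simp only [LinearMap.sum_apply, LinearMap.comp_apply, LinearMap.lcomp_apply,
    LinearMap.compRight_apply]
  rw [Finset.sum_eq_single a]
  · rw [hu]
  · intro b _ hb
    rw [hu.proj_eq, if_neg hb, map_zero, map_zero]
  · simp

end Grading

namespace GrVec

variable {k : Type u} [Field k] {Γ : Type u} [Group Γ] [Fintype Γ] {ω : Cocycle k Γ}

section Coequalizer

variable {X Y : GrVec ω} (f g : X ⟶ Y)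

/-- The coequalizer of two morphisms is the quotient by the image of the difference. -/
def coeq : GrVec ω where
  carrier := Y.carrier ⧸ LinearMap.range (lin f - lin g)
  gr := Y.gr.quotient _ (by
    rintro a _ ⟨x, rfl⟩
    exact ⟨X.gr.proj a x, by
      rw [LinearMap.sub_apply, lin_proj, lin_proj, LinearMap.sub_apply, map_sub]⟩)

/-- The projection to the coequalizer. -/
def coeqπ : Y ⟶ coeq f g := Hom.mk (LinearMap.range (lin f - lin g)).mkQ fun _ _ => rfl

theorem coeq_condition : f ≫ coeqπ f g = g ≫ coeqπ f g := hom_ext <| LinearMap.ext fun x => by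
  change (LinearMap.range (lin f - lin g)).mkQ _ = (LinearMap.range (lin f - lin g)).mkQ _
  rw [← sub_eq_zero, ← map_sub, Submodule.mkQ_apply, Submodule.Quotient.mk_eq_zero]
  exact ⟨x, rfl⟩

/-- The universal property of the coequalizer. -/
def coeqDesc {Z : GrVec ω} (h : Y ⟶ Z) (w : f ≫ h = g ≫ h) : coeq f g ⟶ Z :=
  Hom.mk ((LinearMap.range (lin f - lin g)).liftQ (lin h) (by
    rintro _ ⟨x, rfl⟩
    have := congr_lin w x
    rw [LinearMap.mem_ker, LinearMap.sub_apply, map_sub, sub_eq_zero]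
    exact this)) (by
    intro a q
    obtain ⟨y, rfl⟩ := (LinearMap.range (lin f - lin g)).mkQ_surjective q
    exact lin_proj h a y)

/-- The quotient is the coequalizer. -/
def coeqIsColimit : Limits.IsColimit (Limits.Cofork.ofπ (coeqπ f g) (coeq_condition f g)) :=
  Limits.Cofork.IsColimit.mk _ (fun s => coeqDesc f g s.π s.condition)
    (fun s => rfl)
    (fun s m hm => hom_ext <| LinearMap.ext fun q => by
      obtain ⟨y, rfl⟩ := (LinearMap.range (lin f - lin g)).mkQ_surjective q
      exact congr_lin hm y)

end Coequalizer

instance : Limits.HasCoequalizers (GrVec ω) :=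
  have : ∀ {X Y : GrVec ω} {f g : X ⟶ Y}, Limits.HasColimit (Limits.parallelPair f g) :=
    fun {_ _ f g} => ⟨⟨⟨_, coeqIsColimit f g⟩⟩⟩
  Limits.hasCoequalizers_of_hasColimit_parallelPair _

/-- The internal hom that is right adjoint to `X ⊗ -`. -/
def ihomLeft (X Z : GrVec ω) : GrVec ω where
  carrier := X.carrier →ₗ[k] Z.carrier
  gr := X.gr.hom Z.gr (fun c a => a * c) fun a => Group.mulLeft_bijective a

/-- The internal hom that is right adjoint to `- ⊗ X`. -/
def ihomRight (X Z : GrVec ω) : GrVec ω where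
  carrier := X.carrier →ₗ[k] Z.carrier
  gr := X.gr.hom Z.gr (fun c a => c * a) fun a => Group.mulRight_bijective a

theorem ihom_aux {X Y Z : GrVec ω} (s : Γ → Γ → Γ) (hs : ∀ a, Function.Bijective fun c => s c a)
    (φ : Y.carrier →ₗ[k] X.carrier →ₗ[k] Z.carrier) :
    (∀ c y, φ (Y.gr.proj c y) = (X.gr.hom Z.gr s hs).proj c (φ y)) ↔
      ∀ a c x y, X.gr.Homog a x → Y.gr.Homog c y → Z.gr.Homog (s c a) (φ y x) := by
  constructor
  · intro h a c x y hx hy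
    rw [Grading.homog_iff, ← X.gr.hom_proj_apply Z.gr s hs c (φ y) hx, ← h, hy]
  · intro h
    refine Y.gr.comm_of_homog _ φ fun c y hy => ?_
    refine X.gr.hom_ext fun a x hx => ?_
    rw [X.gr.hom_proj_apply Z.gr s hs c (φ y) hx]
    exact h a c x y hx hy

theorem tensor_hom_aux {X Y Z : GrVec ω} (f : X.carrier ⊗[k] Y.carrier →ₗ[k] Z.carrier) :
    (∀ c t, f ((X.gr.tensor Y.gr).proj c t) = Z.gr.proj c (f t)) ↔
      ∀ a c x y, X.gr.Homog a x → Y.gr.Homog c y → Z.gr.Homog (a * c) (f (x ⊗ₜ y)) := by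
  classical
  constructor
  · intro h a c x y hx hy
    rw [Grading.homog_iff, ← h, hx.tmul hy]
  · intro h c t
    refine LinearMap.congr_fun (f := f ∘ₗ (X.gr.tensor Y.gr).proj c) (g := Z.gr.proj c ∘ₗ f)
      (X.gr.tensor_ext Y.gr fun a b x y hx hy => ?_) t
    rw [LinearMap.comp_apply, LinearMap.comp_apply, (hx.tmul hy).proj_eq,
      (h a b x y hx hy).proj_eq]
    split_ifs
    · rfl
    · rw [map_zero]

/-- Currying. -/
def ihomLeftEquiv (X Y Z : GrVec ω) : (X ⊗ Y ⟶ Z) ≃ (Y ⟶ ihomLeft X Z) where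
  toFun f := Hom.mk (TensorProduct.curry (lin f)).flip <|
    (ihom_aux _ (fun a => Group.mulLeft_bijective a) _).2 fun a c x y hx hy =>
      (tensor_hom_aux (lin f)).1 (lin_proj f) a c x y hx hy
  invFun φ := Hom.mk (TensorProduct.lift (LinearMap.flip (Hom.toLin φ))) <|
    (tensor_hom_aux _).2 fun a c x y hx hy =>
      (ihom_aux _ (fun a => Group.mulLeft_bijective a) _).1 (Hom.comm φ) a c x y hx hy
  left_inv _ := hom_ext <| TensorProduct.ext' fun _ _ => rfl
  right_inv _ := hom_ext <| LinearMap.ext fun _ => LinearMap.ext fun _ => rfl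

/-- Currying. -/
def ihomRightEquiv (X Y Z : GrVec ω) : (Y ⊗ X ⟶ Z) ≃ (Y ⟶ ihomRight X Z) where
  toFun f := Hom.mk (TensorProduct.curry (lin f)) <|
    (ihom_aux _ (fun a => Group.mulRight_bijective a) _).2 fun a c x y hx hy =>
      (tensor_hom_aux (lin f)).1 (lin_proj f) c a y x hy hx
  invFun φ := Hom.mk (TensorProduct.lift (Hom.toLin φ)) <|
    (tensor_hom_aux _).2 fun a c x y hx hy =>
      (ihom_aux _ (fun a => Group.mulRight_bijective a) _).1 (Hom.comm φ) c a y x hy hx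
  left_inv _ := hom_ext <| TensorProduct.ext' fun _ _ => rfl
  right_inv _ := hom_ext <| LinearMap.ext fun _ => LinearMap.ext fun _ => rfl

instance (X : GrVec ω) : Limits.PreservesColimitsOfSize.{0, 0} (tensorLeft X) :=
  (Adjunction.adjunctionOfEquivRight (F := tensorLeft X) (fun Y Z => ihomLeftEquiv X Y Z)
    (fun _ _ _ _ _ => rfl)).leftAdjoint_preservesColimits

instance (X : GrVec ω) : Limits.PreservesColimitsOfSize.{0, 0} (tensorRight X) :=
  (Adjunction.adjunctionOfEquivRight (F := tensorRight X) (fun Y Z => ihomRightEquiv X Y Z)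
    (fun _ _ _ _ _ => rfl)).leftAdjoint_preservesColimits

end GrVec

/-! ### The monoidal category of bimodules over an algebra in a monoidal category -/

section BimodMonoidal

universe v₁ u₁

variable {C : Type u₁} [Category.{v₁} C] [MonoidalCategory C] [Limits.HasCoequalizers C]
variable [∀ X : C, Limits.PreservesColimitsOfSize.{0, 0} (tensorLeft X)]
variable [∀ X : C, Limits.PreservesColimitsOfSize.{0, 0} (tensorRight X)]

instance bimodMonoidalStruct (A : Mon C) : MonoidalCategoryStruct (Bimod A A) where
  tensorObj M N := Bimod.tensorBimod M N
  whiskerLeft M _ _ f := Bimod.whiskerLeft M f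
  whiskerRight f N := Bimod.whiskerRight f N
  tensorUnit := Bimod.regular A
  associator M N P := Bimod.associatorBimod M N P
  leftUnitor M := Bimod.leftUnitorBimod M
  rightUnitor M := Bimod.rightUnitorBimod M

/-- The monoidal category of `A`-`A`-bimodules, with the tensor product over `A`. -/
instance bimodMonoidal (A : Mon C) : MonoidalCategory (Bimod A A) :=
  let M := @instMonoidalCategoryHom (Mon C) Bimod.monBicategory A
  { bimodMonoidalStruct A with
    tensorHom_def := M.tensorHom_def
    id_tensorHom_id := M.id_tensorHom_id
    tensorHom_comp_tensorHom := M.tensorHom_comp_tensorHom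
    whiskerLeft_id := M.whiskerLeft_id
    id_whiskerRight := M.id_whiskerRight
    associator_naturality := M.associator_naturality
    leftUnitor_naturality := M.leftUnitor_naturality
    rightUnitor_naturality := M.rightUnitor_naturality
    pentagon := M.pentagon
    triangle := M.triangle }

/-- The canonical map from `M ⊗ N` to the tensor product `M ⊗_A N` of two bimodules. -/
def tensorProj {A : Mon C} (M N : Bimod A A) : M.X ⊗ N.X ⟶ (M ⊗ N).X :=
  Limits.coequalizer.π (M.actRight ▷ N.X) ((α_ _ _ _).hom ≫ (M.X ◁ N.actLeft))

end BimodMonoidal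

/-! ### The group algebra of a subgroup as an algebra in the twisted category -/

section GroupAlgebra

variable {k : Type u} [Field k] {S : Type u} [Group S] [Fintype S]

/-- The grading of the vector space `kF` with basis `F`, in which `x` has degree `x`. -/
def grpGrading (k : Type u) [Field k] (F : Subgroup S) : Grading k S (F →₀ k) := by
  classical
  exact Grading.ofSpan
    (fun s => Finsupp.lsum k fun x : F => if (x : S) = s then Finsupp.lsingle x else 0)
    (fun v => by
      have : (∑ s : S, Finsupp.lsum k fun x : F =>
          if (x : S) = s then (Finsupp.lsingle x : k →ₗ[k] F →₀ k) else 0) = LinearMap.id := by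
        refine Finsupp.lhom_ext' fun x => LinearMap.ext fun r => ?_
        simp only [LinearMap.comp_apply, LinearMap.sum_apply, Finsupp.lsingle_apply,
          Finsupp.lsum_single]
        rw [Finset.sum_eq_single (x : S)]
        · simp
        · intro b _ hb; simp [Ne.symm hb]
        · simp
      simpa only [LinearMap.sum_apply, LinearMap.id_apply] using LinearMap.congr_fun this v)
    (fun s t v hst => by
      have : (Finsupp.lsum k fun x : F =>
          if (x : S) = s then (Finsupp.lsingle x : k →ₗ[k] F →₀ k) else 0) ∘ₗ
          (Finsupp.lsum k fun x : F =>
          if (x : S) = t then (Finsupp.lsingle x : k →ₗ[k] F →₀ k) else 0) = 0 := by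
        refine Finsupp.lhom_ext' fun x => LinearMap.ext fun r => ?_
        simp only [LinearMap.comp_apply, Finsupp.lsingle_apply, Finsupp.lsum_single,
          LinearMap.zero_apply]
        by_cases h : (x : S) = t
        · rw [if_pos h, Finsupp.lsingle_apply, Finsupp.lsum_single,
            if_neg fun h' => hst (h'.symm.trans h), LinearMap.zero_apply]
        · rw [if_neg h, LinearMap.zero_apply, map_zero]
      exact LinearMap.congr_fun this v)

theorem homog_single (F : Subgroup S) (x : F) (r : k) :
    (grpGrading k F).Homog (x : S) (Finsupp.single x r) := by
  classical
  change (Finsupp.lsum k fun y : F => if (y : S) = (x : S) then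
    (Finsupp.lsingle y : k →ₗ[k] F →₀ k) else 0) (Finsupp.single x r) = _
  rw [Finsupp.lsum_single, if_pos rfl, Finsupp.lsingle_apply]

/-- The multiplication `x ⊗ y ↦ x * y` of `kF`. -/
def grpMul (k : Type u) [Field k] (F : Subgroup S) : (F →₀ k) ⊗[k] (F →₀ k) →ₗ[k] (F →₀ k) :=
  Finsupp.lmapDomain k k (fun p : F × F => p.1 * p.2) ∘ₗ (finsuppTensorFinsupp' k F F).toLinearMap

theorem grpMul_single (F : Subgroup S) (x y : F) (r s : k) :
    grpMul k F (Finsupp.single x r ⊗ₜ Finsupp.single y s) = Finsupp.single (x * y) (r * s) := by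
  rw [grpMul, LinearMap.comp_apply, LinearEquiv.coe_coe, finsuppTensorFinsupp'_single_tmul_single]
  exact Finsupp.mapDomain_single

/-- The unit `1 ↦ 1` of `kF`. -/
def grpOne (k : Type u) [Field k] (F : Subgroup S) : k →ₗ[k] (F →₀ k) := Finsupp.lsingle 1

theorem grpOne_apply (F : Subgroup S) (r : k) : grpOne k F r = Finsupp.single 1 r := rfl

variable {V : Type u} [AddCommGroup V] [Module k V]

theorem grp_ext {F : Subgroup S} {f g : (F →₀ k) →ₗ[k] V}
    (h : ∀ x, f (Finsupp.single x 1) = g (Finsupp.single x 1)) : f = g :=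
  Finsupp.lhom_ext' fun x => LinearMap.ext_ring (h x)

theorem grpMul_proj (F : Subgroup S) (c : S) (t : (F →₀ k) ⊗[k] (F →₀ k)) :
    grpMul k F (((grpGrading k F).tensor (grpGrading k F)).proj c t) =
      (grpGrading k F).proj c (grpMul k F t) := by
  classical
  refine LinearMap.congr_fun (f := grpMul k F ∘ₗ ((grpGrading k F).tensor (grpGrading k F)).proj c)
    (g := (grpGrading k F).proj c ∘ₗ grpMul k F)
    (TensorProduct.ext (grp_ext fun x => grp_ext fun y => ?_)) t
  change grpMul k F (((grpGrading k F).tensor (grpGrading k F)).proj c (_ ⊗ₜ _)) =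
    (grpGrading k F).proj c (grpMul k F (_ ⊗ₜ _))
  have h := homog_single F (x * y) (1 * 1 : k)
  rw [((homog_single F x (1 : k)).tmul (homog_single F y (1 : k))).proj_eq, grpMul_single,
    h.proj_eq, Subgroup.coe_mul]
  split_ifs
  · rw [grpMul_single]
  · rw [map_zero]

theorem grpOne_proj (F : Subgroup S) (c : S) (r : k) :
    grpOne k F ((Grading.unit k S).proj c r) = (grpGrading k F).proj c (grpOne k F r) := by
  classical
  have h := homog_single F 1 r
  rw [(Grading.homog_unit r).proj_eq, grpOne_apply, grpOne_apply, h.proj_eq, Subgroup.coe_one]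
  split_ifs
  · rfl
  · rw [Finsupp.single_zero]

theorem grpMul_one_left (F : Subgroup S) :
    grpMul k F ∘ₗ TensorProduct.map (grpOne k F) LinearMap.id =
      (TensorProduct.lid k (F →₀ k)).toLinearMap := by
  refine TensorProduct.ext (LinearMap.ext_ring (grp_ext fun x => ?_))
  change grpMul k F (grpOne k F 1 ⊗ₜ Finsupp.single x 1) =
    TensorProduct.lid k (F →₀ k) (1 ⊗ₜ Finsupp.single x 1)
  rw [grpOne_apply, grpMul_single, TensorProduct.lid_tmul, one_mul, one_mul, one_smul]

theorem grpMul_one_right (F : Subgroup S) :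
    grpMul k F ∘ₗ TensorProduct.map LinearMap.id (grpOne k F) =
      (TensorProduct.rid k (F →₀ k)).toLinearMap := by
  refine TensorProduct.ext (grp_ext (V := k →ₗ[k] (F →₀ k)) fun x => LinearMap.ext_ring ?_)
  change grpMul k F (Finsupp.single x 1 ⊗ₜ grpOne k F 1) =
    TensorProduct.rid k (F →₀ k) (Finsupp.single x 1 ⊗ₜ 1)
  rw [grpOne_apply, grpMul_single, TensorProduct.rid_tmul, mul_one, mul_one, one_smul]

theorem grpMul_assoc (F : Subgroup S) (ω : Cocycle k S)
    (hω : ∀ x y z : F, ω.toFun x y z = 1) :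
    grpMul k F ∘ₗ TensorProduct.map (grpMul k F) LinearMap.id =
      grpMul k F ∘ₗ TensorProduct.map LinearMap.id (grpMul k F) ∘ₗ
        (Grading.assocEquiv (grpGrading k F) (grpGrading k F) (grpGrading k F) ω).toLinearMap := by
  refine TensorProduct.ext (TensorProduct.ext (grp_ext fun x => grp_ext fun y =>
    grp_ext fun z => ?_))
  change grpMul k F (grpMul k F (Finsupp.single x 1 ⊗ₜ Finsupp.single y 1) ⊗ₜ Finsupp.single z 1) =
    grpMul k F (TensorProduct.map LinearMap.id (grpMul k F)
      (Grading.assocEquiv (grpGrading k F) (grpGrading k F) (grpGrading k F) ω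
        ((Finsupp.single x 1 ⊗ₜ Finsupp.single y 1) ⊗ₜ Finsupp.single z 1)))
  have h : ω.val (x : S) y z = 1 := by rw [Cocycle.val, hω, Units.val_one]
  rw [Grading.assocEquiv_tmul ω (homog_single F x 1) (homog_single F y 1) (homog_single F z 1), h,
    one_smul, TensorProduct.map_tmul, grpMul_single, grpMul_single, grpMul_single,
    LinearMap.id_apply, grpMul_single, mul_assoc, mul_assoc]

/-- `kF` as an object of the category of graded vector spaces. -/
def grpObj (F : Subgroup S) (ω : Cocycle k S) : GrVec ω where
  carrier := F →₀ k
  gr := grpGrading k F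

/-- The unit of `kF` as a morphism. -/
def grpOneHom (F : Subgroup S) (ω : Cocycle k S) : 𝟙_ (GrVec ω) ⟶ grpObj F ω :=
  GrVec.Hom.mk (U := GrVec.unit ω) (V := grpObj F ω) (grpOne k F)
    (fun a r => grpOne_proj (k := k) F a r)

/-- The multiplication of `kF` as a morphism. -/
def grpMulHom (F : Subgroup S) (ω : Cocycle k S) : grpObj F ω ⊗ grpObj F ω ⟶ grpObj F ω :=
  GrVec.Hom.mk (U := (grpObj F ω).tensor (grpObj F ω)) (V := grpObj F ω) (grpMul k F)
    (grpMul_proj F)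

/-- The group algebra `kF` as an algebra in the category of `S`-graded vector spaces with
associativity constraint `ω`, where `ω` is trivial on `F`. -/
def grpAlg (F : Subgroup S) (ω : Cocycle k S) (hω : ∀ x y z : F, ω.toFun x y z = 1) :
    Mon (GrVec ω) where
  X := grpObj F ω
  mon :=
    { one := grpOneHom F ω
      mul := grpMulHom F ω
      one_mul := GrVec.hom_ext (grpMul_one_left F)
      mul_one := GrVec.hom_ext (grpMul_one_right F)
      mul_assoc := GrVec.hom_ext (grpMul_assoc F ω hω) }

end GroupAlgebra

/-! ### Exact factorizations and the Kac cocycle -/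

section Factorization

variable {S : Type u} [Group S] {F G : Subgroup S}

/-- `π(x g) = x` for `x ∈ F`, `g ∈ G`. -/
def piF (h : F.IsComplement' G) (a : S) : F := (h.equiv a).1

/-- `p(x g) = g` for `x ∈ F`, `g ∈ G`. -/
def pG (h : F.IsComplement' G) (a : S) : G := (h.equiv a).2

variable (h : F.IsComplement' G)

theorem piF_mul_pG (a : S) : (piF h a : S) * pG h a = a := h.equiv_fst_mul_equiv_snd a

theorem pair_eq (x : F) (g : G) : h.equiv ((x : S) * g) = (x, g) :=
  h.equiv.apply_symm_apply (x, g)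

theorem piF_mk (x : F) (g : G) : piF h ((x : S) * g) = x := congrArg Prod.fst (pair_eq h x g)

theorem pG_mk (x : F) (g : G) : pG h ((x : S) * g) = g := congrArg Prod.snd (pair_eq h x g)

/-- The left action `g ▷ x` of `G` on `F`, defined by `g x = (g ▷ x) (g ◁ x)`. -/
def lact (g : G) (x : F) : F := piF h ((g : S) * x)

/-- The right action `g ◁ x` of `F` on `G`, defined by `g x = (g ▷ x) (g ◁ x)`. -/
def ract (g : G) (x : F) : G := pG h ((g : S) * x)

theorem lact_mul_ract (g : G) (x : F) : (lact h g x : S) * ract h g x = g * x :=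
  piF_mul_pG h _

theorem eq_of_mul_eq (h : F.IsComplement' G) {x y : F} {g g' : G} (e : (x : S) * g = y * g') : x = y ∧ g = g' := by
  have h1 := piF_mk h x g
  have h2 := pG_mk h x g
  rw [e, piF_mk] at h1
  rw [e, pG_mk] at h2
  exact ⟨h1.symm, h2.symm⟩

theorem piF_mul (a b : S) : piF h (a * b) = piF h a * lact h (pG h a) (piF h b) ∧
    pG h (a * b) = ract h (pG h a) (piF h b) * pG h b := by
  apply eq_of_mul_eq h
  rw [piF_mul_pG, Subgroup.coe_mul, Subgroup.coe_mul, mul_assoc, ← mul_assoc (lact h _ _ : S),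
    lact_mul_ract, mul_assoc, piF_mul_pG, ← mul_assoc, piF_mul_pG]

theorem act_mul_right (g : G) (x y : F) :
    lact h g (x * y) = lact h g x * lact h (ract h g x) y ∧
      ract h g (x * y) = ract h (ract h g x) y := by
  apply eq_of_mul_eq h
  rw [lact_mul_ract, Subgroup.coe_mul, Subgroup.coe_mul, mul_assoc, lact_mul_ract, ← mul_assoc,
    ← mul_assoc, lact_mul_ract]

theorem act_mul_left (s t : G) (x : F) :
    lact h (s * t) x = lact h s (lact h t x) ∧
      ract h (s * t) x = ract h s (lact h t x) * ract h t x := by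
  apply eq_of_mul_eq h
  rw [lact_mul_ract, Subgroup.coe_mul, Subgroup.coe_mul, ← mul_assoc, lact_mul_ract, mul_assoc,
    mul_assoc, lact_mul_ract]

theorem act_one_right (g : G) : lact h g 1 = 1 ∧ ract h g 1 = g := by
  apply eq_of_mul_eq h
  rw [lact_mul_ract, Subgroup.coe_one, one_mul, mul_one]

theorem act_one_left (x : F) : lact h 1 x = x ∧ ract h 1 x = 1 := by
  apply eq_of_mul_eq h
  rw [lact_mul_ract, Subgroup.coe_one, one_mul, mul_one]

theorem proj_F (x : F) : piF h (x : S) = x ∧ pG h (x : S) = 1 := by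
  apply eq_of_mul_eq h
  rw [piF_mul_pG, Subgroup.coe_one, mul_one]

theorem proj_one : piF h (1 : S) = 1 ∧ pG h (1 : S) = 1 := proj_F h 1

/-- A pair `(τ, σ)` of normalized compatible 2-cocycles, the datum of an abelian extension
`1 → k^G → k^G ^τ#_σ kF → kF → 1` which gives rise to the actions `▷`, `◁`. -/
structure KacPair (k : Type u) [Field k] (h : F.IsComplement' G) where
  /-- `σ g x y` is `σ_g(x, y)`. -/
  σ : G → F → F → kˣ
  /-- `τ x g g'` is `τ_x(g, g')`. -/
  τ : F → G → G → kˣ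
  σ_cocycle : ∀ g x y z, σ (ract h g x) y z * σ g x (y * z) = σ g (x * y) z * σ g x y
  σ_one_right : ∀ g x, σ g x 1 = 1
  σ_one_left : ∀ g x, σ g 1 x = 1
  τ_cocycle : ∀ x g g' g'',
    τ x (g * g') g'' * τ (lact h g'' x) g g' = τ x g' g'' * τ x g (g' * g'')
  τ_one_right : ∀ x g, τ x g 1 = 1
  τ_one_left : ∀ x g, τ x 1 g = 1
  compat : ∀ t s x y, σ (t * s) x y * τ (x * y) t s =
    τ x t s * τ y (ract h t (lact h s x)) (ract h s x) *
      σ t (lact h s x) (lact h (ract h s x) y) * σ s x y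
  σ_one : ∀ x y, σ 1 x y = 1
  τ_one : ∀ g g', τ 1 g g' = 1

variable {h} {k : Type u} [Field k] (c : KacPair k h)

/-- The values of `σ` as scalars. -/
def KacPair.σval (g : G) (x y : F) : k := (c.σ g x y : k)

/-- The values of `τ` as scalars. -/
def KacPair.τval (x : F) (g g' : G) : k := (c.τ x g g' : k)

theorem kac_aux (g s t : G) (y z w : F) :
    c.τ (z * lact h t w) (ract h g y) s * c.σ g y (lact h s (z * lact h t w)) *
      (c.τ w (ract h (ract h g y * s) z) t * c.σ (ract h g y * s) z (lact h t w)) =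
    c.τ w (ract h s z) t * c.σ s z (lact h t w) *
      (c.τ w (ract h g (y * lact h s z)) (ract h s z * t) *
        c.σ g (y * lact h s z) (lact h (ract h s z * t) w)) *
      (c.τ z (ract h g y) s * c.σ g y (lact h s z)) := by
  have h1 := c.compat (ract h g y) s z (lact h t w)
  have h2 := c.τ_cocycle w (ract h (ract h g y) (lact h s z)) (ract h s z) t
  have h3 := c.σ_cocycle g y (lact h s z) (lact h (ract h s z) (lact h t w))
  rw [(act_mul_right h s z _).1, (act_mul_left h (ract h g y) s z).2,
    (act_mul_right h g y _).2, (act_mul_left h (ract h s z) t w).1]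
  apply Units.ext
  have h1' := congrArg Units.val h1
  have h2' := congrArg Units.val h2
  have h3' := congrArg Units.val h3
  simp only [Units.val_mul] at h1' h2' h3' ⊢
  linear_combination
    (((c.τ w (ract h (ract h g y) (lact h s z) * ract h s z) t : kˣ) : k) *
      ((c.σ g y (lact h s z * lact h (ract h s z) (lact h t w)) : kˣ) : k)) * h1' +
    (((c.τ z (ract h g y) s : kˣ) : k) *
      ((c.σ (ract h g y) (lact h s z) (lact h (ract h s z) (lact h t w)) : kˣ) : k) *
      ((c.σ s z (lact h t w) : kˣ) : k) *
      ((c.σ g y (lact h s z * lact h (ract h s z) (lact h t w)) : kˣ) : k)) * h2' +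
    (((c.τ z (ract h g y) s : kˣ) : k) * ((c.σ s z (lact h t w) : kˣ) : k) *
      ((c.τ w (ract h s z) t : kˣ) : k) *
      ((c.τ w (ract h (ract h g y) (lact h s z)) (ract h s z * t) : kˣ) : k)) * h3'

/-- The 3-cocycle `ω(τ, σ)(a, b, d) = τ_{π(d)}(p(a) ◁ π(b), p(b)) σ_{p(a)}(π(b), p(b) ▷ π(d))`. -/
def kacCocycle : Cocycle k S where
  toFun a b d := c.τ (piF h d) (ract h (pG h a) (piF h b)) (pG h b) *
    c.σ (pG h a) (piF h b) (lact h (pG h b) (piF h d))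
  cocycle a b d e := by
    rw [(piF_mul h d e).1, (piF_mul h a b).2, (piF_mul h b d).1, (piF_mul h b d).2]
    exact kac_aux c _ _ _ _ _ _
  one_left b d := by
    rw [(proj_one h).2, (act_one_left h _).2, c.τ_one_left, c.σ_one, one_mul]
  one_mid a d := by
    rw [(proj_one h).1, (proj_one h).2, c.τ_one_right, c.σ_one_left, one_mul]
  one_right a b := by
    rw [(proj_one h).1, c.τ_one, (act_one_right h _).1, c.σ_one_right, one_mul]

theorem kacCocycle_apply (a b d : S) : (kacCocycle c).toFun a b d =
    c.τ (piF h d) (ract h (pG h a) (piF h b)) (pG h b) *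
      c.σ (pG h a) (piF h b) (lact h (pG h b) (piF h d)) := rfl

theorem kacCocycle_F_left (x : F) (b d : S) : (kacCocycle c).toFun x b d = 1 := by
  rw [kacCocycle_apply, (proj_F h x).2, (act_one_left h _).2, c.τ_one_left, c.σ_one, one_mul]

theorem kacCocycle_F_mid (a : S) (x : F) (d : S) :
    (kacCocycle c).toFun a x d = c.σ (pG h a) x (piF h d) := by
  rw [kacCocycle_apply, (proj_F h x).2, (proj_F h x).1, c.τ_one_right, (act_one_left h _).1,
    one_mul]

/-- The group algebra `kF` in the category of graded vector spaces twisted by `ω(τ, σ)`. -/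
def kacAlg [Fintype S] : Mon (GrVec (kacCocycle c)) :=
  grpAlg F (kacCocycle c) fun x y z => kacCocycle_F_left c x y z

/-- The category of `F`-bimodules in the category of `S`-graded vector spaces with associativity
constraint `ω(τ, σ)`, that is, of `kF`-`kF`-bimodules there. -/
abbrev FBimod [Fintype S] := Bimod (kacAlg c) (kacAlg c)

end Factorization

/-! ### Graded vector spaces with a twisted action -/

section Twisted

variable {S : Type u} [Group S] {F G : Subgroup S} [Fintype G] {h : F.IsComplement' G}
variable {k : Type u} [Field k]

section Action

variable (c : KacPair k h)
variable {U : Type u} [AddCommGroup U] [Module k U] (gU : Grading k G U) (aU : F → Module.End k U)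
variable {V : Type u} [AddCommGroup V] [Module k V] (gV : Grading k G V) (aV : F → Module.End k V)
variable {W : Type u} [AddCommGroup W] [Module k W] (gW : Grading k G W) (aW : F → Module.End k W)

/-- The laws of a right twisted action `u ◁ x = aU x u` of `F` on a `G`-graded space. -/
structure IsTwisted : Prop where
  act_one : ∀ u, aU 1 u = u
  act_act : ∀ x y g u, gU.Homog g u → aU y (aU x u) = c.σval g x y • aU (x * y) u
  act_homog : ∀ x g u, gU.Homog g u → gU.Homog (ract h g x) (aU x u)

/-- The twisted action on the tensor product:
`(u ⊗ v) ◁ x = τ_x(|u|, |v|) (u ◁ (|v| ▷ x)) ⊗ (v ◁ x)` on homogeneous vectors. -/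
def tensorAct (x : F) : Module.End k (U ⊗[k] V) :=
  ∑ g, ∑ g', c.τval x g g' •
    TensorProduct.map (aU (lact h g' x) ∘ₗ gU.proj g) (aV x ∘ₗ gV.proj g')

variable {gU aU gV aV gW aW}

theorem tensorAct_tmul (x : F) {g g' : G} {u : U} {v : V} (hu : gU.Homog g u)
    (hv : gV.Homog g' v) : tensorAct c gU aU gV aV x (u ⊗ₜ v) =
      c.τval x g g' • (aU (lact h g' x) u ⊗ₜ aV x v) := by
  classical
  simp only [tensorAct, LinearMap.sum_apply, LinearMap.smul_apply, LinearMap.comp_apply,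
    TensorProduct.map_tmul, hu.proj_eq, hv.proj_eq]
  rw [Finset.sum_eq_single g, Finset.sum_eq_single g']
  all_goals simp +contextual

theorem IsTwisted.comm_proj (hU : IsTwisted c gU aU) (x : F) (g : G) (u : U) :
    aU x (gU.proj g u) = gU.proj (ract h g x) (aU x u) := by
  classical
  have inj : ∀ g g', ract h g x = ract h g' x → g = g' := by
    intro g g' e
    have e' := congrArg (fun z => ract h z x⁻¹) e
    simp only [← (act_mul_right h _ x x⁻¹).2, mul_inv_cancel, (act_one_right h _).2] at e'
    exact e'
  refine LinearMap.congr_fun (f := aU x ∘ₗ gU.proj g) (g := gU.proj (ract h g x) ∘ₗ aU x)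
    (gU.hom_ext fun a u hu => ?_) u
  rw [LinearMap.comp_apply, LinearMap.comp_apply, hu.proj_eq, (hU.act_homog x a u hu).proj_eq]
  by_cases hg : g = a
  · rw [if_pos hg, if_pos (by rw [hg])]
  · rw [if_neg hg, if_neg fun e => hg (inj _ _ e), map_zero]

variable {c} in
theorem IsTwisted.tensor (hU : IsTwisted c gU aU) (hV : IsTwisted c gV aV) :
    IsTwisted c (gU.tensor gV) (tensorAct c gU aU gV aV) where
  act_one t := by
    refine LinearMap.congr_fun (g := LinearMap.id)
      (gU.tensor_ext gV fun g g' u v hu hv => ?_) t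
    rw [tensorAct_tmul c 1 hu hv, (act_one_right h _).1, hU.act_one, hV.act_one, KacPair.τval,
      c.τ_one, Units.val_one, one_smul, LinearMap.id_apply]
  act_act x y a t ht := by
    classical
    have key : (tensorAct c gU aU gV aV y ∘ₗ tensorAct c gU aU gV aV x) ∘ₗ (gU.tensor gV).proj a =
        (c.σval a x y • tensorAct c gU aU gV aV (x * y)) ∘ₗ (gU.tensor gV).proj a := by
      refine gU.tensor_ext gV fun g g' u v hu hv => ?_
      simp only [LinearMap.comp_apply, LinearMap.smul_apply, (hu.tmul hv).proj_eq]
      split_ifs with e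
      · subst e
        rw [tensorAct_tmul c x hu hv, map_smul,
          tensorAct_tmul c y (hU.act_homog _ _ _ hu) (hV.act_homog _ _ _ hv),
          tensorAct_tmul c (x * y) hu hv, hU.act_act _ _ _ _ hu, hV.act_act _ _ _ _ hv,
          ← TensorProduct.smul_tmul', TensorProduct.tmul_smul, smul_smul, smul_smul, smul_smul,
          smul_smul, ← (act_mul_right h g' x y).1]
        congr 1
        have := congrArg Units.val (c.compat g g' x y)
        simp only [Units.val_mul] at this
        simp only [KacPair.σval, KacPair.τval]
        rw [this]
      · simp only [map_zero, smul_zero]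
    have := LinearMap.congr_fun key t
    simpa only [LinearMap.comp_apply, LinearMap.smul_apply, Grading.homog_iff.1 ht] using this
  act_homog x a t ht := by
    classical
    have key : ((gU.tensor gV).proj (ract h a x) ∘ₗ tensorAct c gU aU gV aV x) ∘ₗ
        (gU.tensor gV).proj a = tensorAct c gU aU gV aV x ∘ₗ (gU.tensor gV).proj a := by
      refine gU.tensor_ext gV fun g g' u v hu hv => ?_
      simp only [LinearMap.comp_apply, (hu.tmul hv).proj_eq]
      split_ifs with e
      · subst e
        rw [tensorAct_tmul c x hu hv, map_smul, (act_mul_left h g g' x).2,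
          (hU.act_homog _ _ _ hu).tmul (hV.act_homog _ _ _ hv)]
      · simp only [map_zero]
    have := LinearMap.congr_fun key t
    rw [Grading.homog_iff]
    simpa only [LinearMap.comp_apply, Grading.homog_iff.1 ht] using this

theorem isTwisted_unit : IsTwisted c (Grading.unit k G) (fun _ => LinearMap.id) where
  act_one _ := rfl
  act_act x y g r hr := by
    by_cases hr0 : r = 0
    · simp only [hr0, map_zero, smul_zero]
    obtain rfl := Grading.unit_eq_one hr hr0
    rw [KacPair.σval, c.σ_one, Units.val_one, one_smul]
    rfl
  act_homog x g r hr := by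
    by_cases hr0 : r = 0
    · rw [hr0, map_zero, Grading.homog_iff, map_zero]
    obtain rfl := Grading.unit_eq_one hr hr0
    rw [(act_one_left h x).2]
    exact hr

theorem assoc_gr (g : G) (t : (U ⊗[k] V) ⊗[k] W) :
    TensorProduct.assoc k U V W (((gU.tensor gV).tensor gW).proj g t) =
      (gU.tensor (gV.tensor gW)).proj g (TensorProduct.assoc k U V W t) := by
  classical
  refine LinearMap.congr_fun (f := (TensorProduct.assoc k U V W).toLinearMap ∘ₗ
    ((gU.tensor gV).tensor gW).proj g) (g := (gU.tensor (gV.tensor gW)).proj g ∘ₗ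
      (TensorProduct.assoc k U V W).toLinearMap)
      (gU.ext₃ gV gW fun a b d x y z hx hy hz => ?_) t
  rw [LinearMap.comp_apply, LinearMap.comp_apply, LinearEquiv.coe_coe, TensorProduct.assoc_tmul,
    ((hx.tmul hy).tmul hz).proj_eq, (hx.tmul (hy.tmul hz)).proj_eq, mul_assoc]
  split_ifs
  · rw [TensorProduct.assoc_tmul]
  · rw [map_zero]

theorem assoc_act (x : F)
    (t : (U ⊗[k] V) ⊗[k] W) :
    TensorProduct.assoc k U V W
        (tensorAct c (gU.tensor gV) (tensorAct c gU aU gV aV) gW aW x t) =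
      tensorAct c gU aU (gV.tensor gW) (tensorAct c gV aV gW aW) x
        (TensorProduct.assoc k U V W t) := by
  refine LinearMap.congr_fun (f := (TensorProduct.assoc k U V W).toLinearMap ∘ₗ
    tensorAct c (gU.tensor gV) (tensorAct c gU aU gV aV) gW aW x)
    (g := tensorAct c gU aU (gV.tensor gW) (tensorAct c gV aV gW aW) x ∘ₗ
      (TensorProduct.assoc k U V W).toLinearMap)
      (gU.ext₃ gV gW fun a b d u v w hu hv hw => ?_) t
  rw [LinearMap.comp_apply, LinearMap.comp_apply, LinearEquiv.coe_coe, TensorProduct.assoc_tmul,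
    tensorAct_tmul c x (hu.tmul hv) hw, tensorAct_tmul c x hu (hv.tmul hw),
    tensorAct_tmul c x hv hw, tensorAct_tmul c _ hu hv, map_smul, ← TensorProduct.smul_tmul',
    map_smul, TensorProduct.assoc_tmul, TensorProduct.tmul_smul, smul_smul, smul_smul,
    (act_mul_left h b d x).1]
  congr 1
  have := congrArg Units.val (c.τ_cocycle x a b d)
  simp only [Units.val_mul] at this
  simp only [KacPair.τval]
  rw [this, mul_comm]

theorem lid_act (x : F) (t : k ⊗[k] U) : TensorProduct.lid k U
      (tensorAct c (Grading.unit k G) (fun _ => LinearMap.id) gU aU x t) =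
    aU x (TensorProduct.lid k U t) := by
  refine LinearMap.congr_fun (f := (TensorProduct.lid k U).toLinearMap ∘ₗ
    tensorAct c (Grading.unit k G) (fun _ => LinearMap.id) gU aU x)
    (g := aU x ∘ₗ (TensorProduct.lid k U).toLinearMap)
    ((Grading.unit k G).tensor_ext gU fun a b r u hr hu => ?_) t
  by_cases hr0 : r = 0
  · rw [hr0, TensorProduct.zero_tmul, map_zero, map_zero]
  obtain rfl := Grading.unit_eq_one hr hr0
  rw [LinearMap.comp_apply, LinearMap.comp_apply, LinearEquiv.coe_coe, tensorAct_tmul c x hr hu,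
    TensorProduct.lid_tmul, KacPair.τval, c.τ_one_left, Units.val_one, one_smul,
    TensorProduct.lid_tmul, map_smul, LinearMap.id_apply]

theorem rid_act (x : F) (t : U ⊗[k] k) : TensorProduct.rid k U
      (tensorAct c gU aU (Grading.unit k G) (fun _ => LinearMap.id) x t) =
    aU x (TensorProduct.rid k U t) := by
  refine LinearMap.congr_fun (f := (TensorProduct.rid k U).toLinearMap ∘ₗ
    tensorAct c gU aU (Grading.unit k G) (fun _ => LinearMap.id) x)
    (g := aU x ∘ₗ (TensorProduct.rid k U).toLinearMap)
    (gU.tensor_ext (Grading.unit k G) fun a b u r hu hr => ?_) t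
  by_cases hr0 : r = 0
  · rw [hr0, TensorProduct.tmul_zero, map_zero, map_zero]
  obtain rfl := Grading.unit_eq_one hr hr0
  rw [LinearMap.comp_apply, LinearMap.comp_apply, LinearEquiv.coe_coe, tensorAct_tmul c x hu hr,
    TensorProduct.rid_tmul, KacPair.τval, c.τ_one_right, Units.val_one, one_smul,
    TensorProduct.rid_tmul, map_smul, LinearMap.id_apply, (act_one_left h x).1]

theorem map_act {U' : Type u} [AddCommGroup U'] [Module k U'] {gU' : Grading k G U'}
    {aU' : F → Module.End k U'} {V' : Type u} [AddCommGroup V'] [Module k V']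
    {gV' : Grading k G V'} {aV' : F → Module.End k V'} {f : U →ₗ[k] U'} {f' : V →ₗ[k] V'}
    (hf : ∀ g u, f (gU.proj g u) = gU'.proj g (f u)) (hf' : ∀ g u, f' (gV.proj g u) = gV'.proj g (f' u))
    (kf : ∀ x u, f (aU x u) = aU' x (f u)) (kf' : ∀ x u, f' (aV x u) = aV' x (f' u))
    (x : F) (t : U ⊗[k] V) :
    TensorProduct.map f f' (tensorAct c gU aU gV aV x t) =
      tensorAct c gU' aU' gV' aV' x (TensorProduct.map f f' t) := by
  refine LinearMap.congr_fun (f := TensorProduct.map f f' ∘ₗ tensorAct c gU aU gV aV x)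
    (g := tensorAct c gU' aU' gV' aV' x ∘ₗ TensorProduct.map f f')
    (gU.tensor_ext gV fun a b u v hu hv => ?_) t
  have hfu : gU'.Homog a (f u) := by rw [Grading.homog_iff, ← hf, hu]
  have hfv : gV'.Homog b (f' v) := by rw [Grading.homog_iff, ← hf', hv]
  rw [LinearMap.comp_apply, LinearMap.comp_apply, tensorAct_tmul c x hu hv, map_smul,
    TensorProduct.map_tmul, TensorProduct.map_tmul, tensorAct_tmul c x hfu hfv, kf, kf']

end Action

/-- An object of the category `Vect^G_F(σ, τ)`: a `G`-graded vector space with a right twisted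
action `v ◁ x = act x v` of `F`, such that `(v ◁ x) ◁ y = σ_{|v|}(x, y) v ◁ (x y)`, `v ◁ 1 = v`
and `|v ◁ x| = |v| ◁ x`. -/
structure TwVec (c : KacPair k h) where
  carrier : Type u
  [addCommGroup : AddCommGroup carrier]
  [module : Module k carrier]
  gr : Grading k G carrier
  act : F → Module.End k carrier
  twisted : IsTwisted c gr act

attribute [instance] TwVec.addCommGroup TwVec.module

namespace TwVec

variable {c : KacPair k h}

/-- Morphisms are the linear maps that preserve degrees and commute with the actions. -/
@[ext]
structure Hom (V W : TwVec c) where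
  toLin : V.carrier →ₗ[k] W.carrier
  comm : ∀ g v, toLin (V.gr.proj g v) = W.gr.proj g (toLin v)
  comm_act : ∀ x v, toLin (V.act x v) = W.act x (toLin v)

instance : Category (TwVec c) where
  Hom V W := Hom V W
  id V := ⟨LinearMap.id, fun _ _ => rfl, fun _ _ => rfl⟩
  comp f g := ⟨g.toLin ∘ₗ f.toLin,
    fun a u => by rw [LinearMap.comp_apply, f.comm, g.comm, LinearMap.comp_apply],
    fun a u => by rw [LinearMap.comp_apply, f.comm_act, g.comm_act, LinearMap.comp_apply]⟩

/-- The linear map underlying a morphism. -/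
def lin {U V : TwVec c} (f : U ⟶ V) : U.carrier →ₗ[k] V.carrier := Hom.toLin f

@[ext]
theorem hom_ext {U V : TwVec c} {f g : U ⟶ V} (h : lin f = lin g) : f = g := Hom.ext h

theorem lin_proj {U V : TwVec c} (f : U ⟶ V) (a : G) (u : U.carrier) :
    lin f (U.gr.proj a u) = V.gr.proj a (lin f u) := Hom.comm f a u

theorem lin_act {U V : TwVec c} (f : U ⟶ V) (x : F) (u : U.carrier) :
    lin f (U.act x u) = V.act x (lin f u) := Hom.comm_act f x u

@[simp] theorem lin_id (U : TwVec c) : lin (𝟙 U) = LinearMap.id := rfl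

@[simp] theorem lin_comp {U V W : TwVec c} (f : U ⟶ V) (g : V ⟶ W) :
    lin (f ≫ g) = lin g ∘ₗ lin f := rfl

/-- A linear equivalence compatible with the structures is an isomorphism. -/
def mkIso {U V : TwVec c} (e : U.carrier ≃ₗ[k] V.carrier)
    (h : ∀ a u, e (U.gr.proj a u) = V.gr.proj a (e u))
    (h' : ∀ x u, e (U.act x u) = V.act x (e u)) : U ≅ V where
  hom := Hom.mk e.toLinearMap h h'
  inv := Hom.mk e.symm.toLinearMap
    (fun a u => by
      rw [LinearEquiv.coe_coe, LinearEquiv.symm_apply_eq, h, LinearEquiv.apply_symm_apply])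
    (fun a u => by
      rw [LinearEquiv.coe_coe, LinearEquiv.symm_apply_eq, h', LinearEquiv.apply_symm_apply])
  hom_inv_id := Hom.ext (LinearMap.ext fun u => e.symm_apply_apply u)
  inv_hom_id := Hom.ext (LinearMap.ext fun u => e.apply_symm_apply u)

/-- The tensor product, with `|v ⊗ v'| = |v| |v'|` and
`(v ⊗ v') ◁ x = τ_x(|v|, |v'|) (v ◁ (|v'| ▷ x)) ⊗ (v' ◁ x)`. -/
def tensor (V W : TwVec c) : TwVec c where
  carrier := V.carrier ⊗[k] W.carrier
  gr := V.gr.tensor W.gr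
  act := tensorAct c V.gr V.act W.gr W.act
  twisted := V.twisted.tensor W.twisted

/-- The unit object: `k` in degree `1`, with the trivial action. -/
def unit (c : KacPair k h) : TwVec c where
  carrier := k
  gr := Grading.unit k G
  act _ := LinearMap.id
  twisted := isTwisted_unit c

/-- The tensor product of two morphisms. -/
def tensorMap {U V U' V' : TwVec c} (f : U ⟶ V) (g : U' ⟶ V') : U.tensor U' ⟶ V.tensor V' :=
  Hom.mk (TensorProduct.map (lin f) (lin g)) (Grading.map_proj (lin_proj f) (lin_proj g))
    (map_act c (lin_proj f) (lin_proj g) (lin_act f) (lin_act g))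

instance : MonoidalCategoryStruct (TwVec c) where
  tensorObj := tensor
  whiskerLeft U _ _ g := tensorMap (𝟙 U) g
  whiskerRight f U := tensorMap f (𝟙 U)
  tensorHom f g := tensorMap f g
  tensorUnit := unit c
  associator U V W := mkIso (U := (U.tensor V).tensor W) (V := U.tensor (V.tensor W))
    (TensorProduct.assoc k U.carrier V.carrier W.carrier)
    assoc_gr (assoc_act c)
  leftUnitor U := mkIso (TensorProduct.lid k U.carrier) U.gr.lid_proj (lid_act c)
  rightUnitor U := mkIso (TensorProduct.rid k U.carrier) U.gr.rid_proj (rid_act c)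

/-- The monoidal category `Vect^G_F(σ, τ)`; the associativity and unit constraints are those of
vector spaces. -/
instance : MonoidalCategory (TwVec c) :=
  MonoidalCategory.ofTensorHom
    (id_tensorHom_id := fun _ _ => hom_ext TensorProduct.map_id)
    (id_tensorHom := fun _ _ _ _ => rfl)
    (tensorHom_id := fun _ _ => rfl)
    (tensorHom_comp_tensorHom := fun f₁ f₂ g₁ g₂ =>
      hom_ext (TensorProduct.map_comp (lin g₁) (lin g₂) (lin f₁) (lin f₂)).symm)
    (associator_naturality := fun _ _ _ => hom_ext <|
      TensorProduct.ext_threefold fun _ _ _ => rfl)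
    (leftUnitor_naturality := fun f => hom_ext <| TensorProduct.ext' fun (r : k) x =>
      (map_smul (lin f) r x).symm)
    (rightUnitor_naturality := fun f => hom_ext <| TensorProduct.ext' fun x (r : k) =>
      (map_smul (lin f) r x).symm)
    (pentagon := fun _ _ _ _ => hom_ext <| TensorProduct.ext_fourfold fun _ _ _ _ => rfl)
    (triangle := fun _ _ => hom_ext <| TensorProduct.ext_threefold fun x (r : k) y =>
      (TensorProduct.smul_tmul r x y).symm)

end TwVec

end Twisted

/-! ### The functor of invariants -/

namespace Grading

variable {k : Type u} [Field k] {Γ Γ' : Type u} [Fintype Γ] [Fintype Γ']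
variable {V : Type u} [AddCommGroup V] [Module k V] (gV : Grading k Γ V)
variable {W : Type u} [AddCommGroup W] [Module k W]

open Classical in
/-- The grading by `Γ'` obtained from a grading by `Γ` and a map `f` of the degrees: the vectors
of degree `a` get the degree `f a`. -/
def push (f : Γ → Γ') : Grading k Γ' V :=
  ofSpan (fun b => ∑ a, if f a = b then gV.proj a else 0)
    (fun v => by
      simp only [LinearMap.sum_apply]
      rw [Finset.sum_comm]
      conv_rhs => rw [← gV.sum_proj v]
      refine Finset.sum_congr rfl fun a _ => ?_
      rw [Finset.sum_eq_single (f a)]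
      · rw [if_pos rfl]
      · intro b _ hb
        rw [if_neg (Ne.symm hb), LinearMap.zero_apply]
      · simp)
    (fun b b' v hb => by
      simp only [LinearMap.sum_apply, map_sum]
      refine Finset.sum_eq_zero fun a _ => Finset.sum_eq_zero fun a' _ => ?_
      split_ifs with h1 h2
      · exact gV.proj_ne (fun e => hb (h1.symm.trans ((congrArg f e).trans h2))) v
      all_goals simp)

open Classical in
theorem push_proj (f : Γ → Γ') (b : Γ') (v : V) :
    (gV.push f).proj b v = ∑ a, if f a = b then gV.proj a v else 0 := by
  change (∑ a, if f a = b then gV.proj a else 0) v = _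
  rw [LinearMap.sum_apply]
  refine Finset.sum_congr rfl fun a _ => ?_
  split_ifs <;> rfl

variable {gV} in
theorem Homog.push {a : Γ} {v : V} (hv : gV.Homog a v) (f : Γ → Γ') :
    (gV.push f).Homog (f a) v := by
  classical
  rw [homog_iff, push_proj, Finset.sum_eq_single a]
  · rw [if_pos rfl, hv]
  · intro b _ hb
    rw [hv.proj_eq, if_neg hb, ite_self]
  · simp

/-- Two linear maps which agree on the vectors of degree `a` for all `a` with `f a = b` agree on
the vectors which are of degree `b` for the grading induced by `f`. -/
theorem push_ext (f : Γ → Γ') (b : Γ') {L L' : V →ₗ[k] W}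
    (h : ∀ a v, f a = b → gV.Homog a v → L v = L' v) {v : V} (hv : (gV.push f).Homog b v) :
    L v = L' v := by
  classical
  rw [← homog_iff.1 hv, push_proj, map_sum, map_sum]
  refine Finset.sum_congr rfl fun a _ => ?_
  split_ifs with e
  · exact h a _ e (gV.homog_proj a v)
  · rw [map_zero, map_zero]

/-- The grading of a graded subspace. -/
def restrict (N : Submodule k V) (h : ∀ a, ∀ v ∈ N, gV.proj a v ∈ N) : Grading k Γ N :=
  ofSpan (fun a => (gV.proj a).restrict (h a))
    (fun v => Subtype.ext (by
      rw [← Submodule.subtype_apply, map_sum]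
      exact gV.sum_proj v.1))
    (fun a b v hab => Subtype.ext (gV.proj_ne hab v.1))

theorem restrict_homog (N : Submodule k V) (h : ∀ a, ∀ v ∈ N, gV.proj a v ∈ N) (a : Γ) (v : N) :
    (gV.restrict N h).Homog a v ↔ gV.Homog a v.1 := Subtype.ext_iff

end Grading

section Invariants

variable {S : Type u} [Group S] [Fintype S] {F G : Subgroup S} {h : F.IsComplement' G}
variable {k : Type u} [Field k] {c : KacPair k h}

namespace FBimod

/-- The left action of `x ∈ F` on a bimodule, `u ↦ x ⇀ u`. -/
def lAct (U : FBimod c) (x : F) : Module.End k U.X.carrier :=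
  (GrVec.lin U.actLeft : (F →₀ k) ⊗[k] U.X.carrier →ₗ[k] U.X.carrier) ∘ₗ
    TensorProduct.mk k (F →₀ k) U.X.carrier (Finsupp.single x 1)

/-- The right action of `x ∈ F` on a bimodule, `u ↦ u ↼ x`. -/
def rAct (U : FBimod c) (x : F) : Module.End k U.X.carrier :=
  (GrVec.lin U.actRight : U.X.carrier ⊗[k] (F →₀ k) →ₗ[k] U.X.carrier) ∘ₗ
    (TensorProduct.mk k U.X.carrier (F →₀ k)).flip (Finsupp.single x 1)

theorem lAct_one (U : FBimod c) (u : U.X.carrier) : U.lAct 1 u = u := by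
  have := GrVec.congr_lin U.one_actLeft ((1 : k) ⊗ₜ[k] u)
  exact this.trans (one_smul k u)

theorem rAct_one (U : FBimod c) (u : U.X.carrier) : U.rAct 1 u = u := by
  have := GrVec.congr_lin U.actRight_one (u ⊗ₜ[k] (1 : k))
  exact this.trans (one_smul k u)

theorem lAct_homog (U : FBimod c) (x : F) {a : S} {u : U.X.carrier} (hu : U.X.gr.Homog a u) :
    U.X.gr.Homog (x * a) (U.lAct x u) :=
  GrVec.lin_homog U.actLeft (Grading.Homog.tmul (homog_single F x 1) hu)

theorem rAct_homog (U : FBimod c) (x : F) {a : S} {u : U.X.carrier} (hu : U.X.gr.Homog a u) :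
    U.X.gr.Homog (a * x) (U.rAct x u) :=
  GrVec.lin_homog U.actRight (Grading.Homog.tmul hu (homog_single F x 1))

theorem val_F_left (x : F) (b d : S) : (kacCocycle c).val x b d = 1 := by
  rw [Cocycle.val, kacCocycle_F_left, Units.val_one]

theorem val_F_mid (a : S) (x y : F) : (kacCocycle c).val a x y = c.σval (pG h a) x y := by
  rw [Cocycle.val, kacCocycle_F_mid, (proj_F h y).1]
  rfl

theorem lAct_lAct (U : FBimod c) (x y : F) (u : U.X.carrier) :
    U.lAct x (U.lAct y u) = U.lAct (x * y) u := by
  refine LinearMap.congr_fun (f := U.lAct x ∘ₗ U.lAct y) (g := U.lAct (x * y))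
    (U.X.gr.hom_ext fun a u hu => ?_) u
  have h1 := GrVec.congr_lin U.left_assoc
    ((Finsupp.single x (1 : k) ⊗ₜ[k] Finsupp.single y (1 : k)) ⊗ₜ[k] u)
  have h2 := Grading.assocEquiv_tmul (kacCocycle c) (homog_single F x (1 : k))
    (homog_single F y (1 : k)) hu
  rw [val_F_left, one_smul] at h2
  have h3 := grpMul_single F x y (1 : k) 1
  rw [one_mul] at h3
  have h4 : GrVec.lin U.actLeft (grpMul k F (Finsupp.single x 1 ⊗ₜ[k] Finsupp.single y 1) ⊗ₜ[k] u) =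
      U.lAct (x * y) u := by rw [h3]; rfl
  have h5 : GrVec.lin U.actLeft (TensorProduct.map LinearMap.id (GrVec.lin U.actLeft)
      (Grading.assocEquiv (grpGrading k F) (grpGrading k F) U.X.gr (kacCocycle c)
        ((Finsupp.single x 1 ⊗ₜ[k] Finsupp.single y 1) ⊗ₜ[k] u))) = U.lAct x (U.lAct y u) := by
    rw [h2]; rfl
  exact h5.symm.trans (h1.symm.trans h4)

theorem rAct_rAct (U : FBimod c) (x y : F) {a : S} {u : U.X.carrier} (hu : U.X.gr.Homog a u) :
    U.rAct y (U.rAct x u) = c.σval (pG h a) x y • U.rAct (x * y) u := by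
  have h0 := U.right_assoc
  rw [← cancel_epi (α_ U.X (kacAlg c).X (kacAlg c).X).hom, Iso.hom_inv_id_assoc] at h0
  have h1 := GrVec.congr_lin h0
    ((u ⊗ₜ[k] Finsupp.single x (1 : k)) ⊗ₜ[k] Finsupp.single y (1 : k))
  have h2 := Grading.assocEquiv_tmul (kacCocycle c) hu (homog_single F x (1 : k))
    (homog_single F y (1 : k))
  rw [val_F_mid] at h2
  have h3 := grpMul_single F x y (1 : k) 1
  rw [one_mul] at h3
  have h4 : GrVec.lin U.actRight (TensorProduct.map LinearMap.id (grpMul k F)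
      (Grading.assocEquiv U.X.gr (grpGrading k F) (grpGrading k F) (kacCocycle c)
        ((u ⊗ₜ[k] Finsupp.single x 1) ⊗ₜ[k] Finsupp.single y 1))) =
      c.σval (pG h a) x y • U.rAct (x * y) u := by
    rw [h2, map_smul, TensorProduct.map_tmul, h3]
    exact map_smul (GrVec.lin U.actRight) _ _
  exact h1.symm.trans h4

theorem rAct_lAct (U : FBimod c) (x y : F) (u : U.X.carrier) :
    U.rAct y (U.lAct x u) = U.lAct x (U.rAct y u) := by
  refine LinearMap.congr_fun (f := U.rAct y ∘ₗ U.lAct x) (g := U.lAct x ∘ₗ U.rAct y)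
    (U.X.gr.hom_ext fun a u hu => ?_) u
  have h1 := GrVec.congr_lin U.middle_assoc
    ((Finsupp.single x (1 : k) ⊗ₜ[k] u) ⊗ₜ[k] Finsupp.single y (1 : k))
  have h2 := Grading.assocEquiv_tmul (kacCocycle c) (homog_single F x (1 : k)) hu
    (homog_single F y (1 : k))
  rw [val_F_left, one_smul] at h2
  have h5 : GrVec.lin U.actLeft (TensorProduct.map LinearMap.id (GrVec.lin U.actRight)
      (Grading.assocEquiv (grpGrading k F) U.X.gr (grpGrading k F) (kacCocycle c)
        ((Finsupp.single x 1 ⊗ₜ[k] u) ⊗ₜ[k] Finsupp.single y 1))) = U.lAct x (U.rAct y u) := by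
    rw [h2]; rfl
  exact h1.trans h5

theorem lin_lAct {U V : FBimod c} (f : U ⟶ V) (x : F) (u : U.X.carrier) :
    GrVec.lin f.hom (U.lAct x u) = V.lAct x (GrVec.lin f.hom u) :=
  GrVec.congr_lin f.left_act_hom (Finsupp.single x (1 : k) ⊗ₜ[k] u)

theorem lin_rAct {U V : FBimod c} (f : U ⟶ V) (x : F) (u : U.X.carrier) :
    GrVec.lin f.hom (U.rAct x u) = V.rAct x (GrVec.lin f.hom u) :=
  GrVec.congr_lin f.right_act_hom (u ⊗ₜ[k] Finsupp.single x (1 : k))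

/-- The space of the vectors that are invariant under the left action of `F`. -/
def inv (U : FBimod c) : Submodule k U.X.carrier where
  carrier := {u | ∀ x, U.lAct x u = u}
  add_mem' hu hv x := by rw [map_add, hu x, hv x]
  zero_mem' x := map_zero _
  smul_mem' r u hu x := by rw [map_smul, hu x]

theorem mem_inv {U : FBimod c} {u : U.X.carrier} : u ∈ U.inv ↔ ∀ x, U.lAct x u = u := Iff.rfl

variable [Fintype G]

/-- The `G`-grading `|u| = p‖u‖` of a bimodule. -/
def grG (U : FBimod c) : Grading k G U.X.carrier := U.X.gr.push (pG h)

theorem lAct_grG (U : FBimod c) (x : F) (g : G) (u : U.X.carrier) :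
    U.lAct x (U.grG.proj g u) = U.grG.proj g (U.lAct x u) := by
  refine U.grG.comm_of_homog U.grG (U.lAct x) (fun g u hu => ?_) g u
  refine (U.X.gr.push_ext (pG h) g (L := U.lAct x) (L' := U.grG.proj g ∘ₗ U.lAct x)
    (fun a v ha hv => ?_) hu).symm
  have := (U.lAct_homog x hv).push (pG h)
  rw [(piF_mul h _ _).2, (proj_F h x).2, (act_one_left h _).2, one_mul, ha] at this
  exact this.symm

theorem rAct_grG (U : FBimod c) (x : F) {g : G} {u : U.X.carrier} (hu : U.grG.Homog g u) :
    U.grG.Homog (ract h g x) (U.rAct x u) := by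
  refine (U.X.gr.push_ext (pG h) g (L := U.rAct x) (L' := U.grG.proj (ract h g x) ∘ₗ U.rAct x)
    (fun a v ha hv => ?_) hu).symm
  have := (U.rAct_homog x hv).push (pG h)
  rw [(piF_mul h _ _).2, (proj_F h x).2, (proj_F h x).1, mul_one, ha] at this
  exact this.symm

theorem rAct_rAct_grG (U : FBimod c) (x y : F) {g : G} {u : U.X.carrier} (hu : U.grG.Homog g u) :
    U.rAct y (U.rAct x u) = c.σval g x y • U.rAct (x * y) u :=
  U.X.gr.push_ext (pG h) g (L := U.rAct y ∘ₗ U.rAct x) (L' := c.σval g x y • U.rAct (x * y))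
    (fun a v ha hv => by
      rw [LinearMap.comp_apply, LinearMap.smul_apply, U.rAct_rAct x y hv, ha]) hu

/-- The functor `𝓕` on objects: the space of invariants with the grading `|u| = p‖u‖` and the
twisted action `u ◁ x = u ↼ x`. -/
def invObj (U : FBimod c) : TwVec c where
  carrier := U.inv
  gr := U.grG.restrict U.inv fun g u hu x => by rw [U.lAct_grG, hu x]
  act x := (U.rAct x).restrict fun u hu y => by rw [← U.rAct_lAct, hu y]
  twisted :=
    { act_one := fun u => Subtype.ext (U.rAct_one u.1)
      act_act := fun x y g u hu => Subtype.ext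
        (U.rAct_rAct_grG x y ((U.grG.restrict_homog _ _ g u).1 hu))
      act_homog := fun x g u hu => (U.grG.restrict_homog _ _ _ _).2
        (U.rAct_grG x ((U.grG.restrict_homog _ _ g u).1 hu)) }

theorem lin_grG {U V : FBimod c} (f : U ⟶ V) (g : G) (u : U.X.carrier) :
    GrVec.lin f.hom (U.grG.proj g u) = V.grG.proj g (GrVec.lin f.hom u) := by
  classical
  rw [grG, grG, Grading.push_proj, Grading.push_proj, map_sum]
  refine Finset.sum_congr rfl fun a _ => ?_
  split_ifs
  · rw [GrVec.lin_proj]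
  · rw [map_zero]

/-- The restriction of a morphism of bimodules to the invariants. -/
def invMap {U V : FBimod c} (f : U ⟶ V) : U.invObj ⟶ V.invObj where
  toLin := (GrVec.lin f.hom).restrict (p := U.inv) (q := V.inv)
    fun u hu x => by rw [← lin_lAct, hu x]
  comm g u := Subtype.ext (lin_grG f g u.1)
  comm_act x u := Subtype.ext (lin_rAct f x u.1)

/-- The functor `𝓕` of `F`-invariants. -/
def invFunctor (c : KacPair k h) : FBimod c ⥤ TwVec c where
  obj U := U.invObj
  map f := invMap f
  map_id _ := rfl
  map_comp _ _ := rfl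

/-- The action of the normalized integral `t = |F|⁻¹ ∑ x` of `kF`. -/
def tAct [Fintype F] (U : FBimod c) : Module.End k U.X.carrier :=
  (Fintype.card F : k)⁻¹ • ∑ x, U.lAct x

/-- The linear map `u ⊗ u' ↦ (u ↼ π‖u'‖) ⊗ (t ⇀ u')`, for `u'` homogeneous, on the tensor product
over `k`. -/
def xiLin [Fintype F] (U U' : FBimod c) :
    U.X.carrier ⊗[k] U'.X.carrier →ₗ[k] U.X.carrier ⊗[k] U'.X.carrier :=
  ∑ a : S, TensorProduct.map (U.rAct (piF h a)) (U'.tAct ∘ₗ U'.X.gr.proj a)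

/-- The condition that the morphism `f : 𝓕 (U ⊗_F U') ⟶ 𝓕 U ⊗ 𝓕 U'` is given by the formula
`ξ (∑ u_i ⊗ u_i') = ∑ (u_i ↼ π‖u_i'‖) ⊗ (t ⇀ u_i')`, for every representative `∑ u_i ⊗ u_i'` in
`U ⊗ U'`, with homogeneous `u_i'`, of an invariant element of `U ⊗_F U'`. -/
def IsXi [Fintype F] (U U' : FBimod c)
    (f : (invFunctor c).obj (U ⊗ U') ⟶ (invFunctor c).obj U ⊗ (invFunctor c).obj U') : Prop :=
  ∀ (w : FBimod.inv (U ⊗ U')) (z : U.X.carrier ⊗[k] U'.X.carrier),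
    GrVec.lin (tensorProj U U') z = w.1 →
      TensorProduct.map U.inv.subtype U'.inv.subtype (TwVec.lin f w) = xiLin U U' z

end FBimod

end Invariants

end KacBimodule

end

/-!
The functor of `F`-invariants is compared with the restriction of vectors to the degrees in `G`:
for `a = x g` the left action of `x` identifies the component of degree `g` of a bimodule `U` with
the one of degree `a`, so that `|F| • t` and the projections to the homogeneous components carry
`U` and its space of invariants into each other (`card_smul_proj_tAct`, `card_smul_tAct_proj`).

*Equivalence.* A morphism is recovered from its restriction to the invariants by
`f(u) = |F| (f(t ⇀ u))_a` for `u` of degree `a`, and the same formula extends every morphism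
`𝓕 U ⟶ 𝓕 V` (`extendHom`, `invMap_extendHom`). An object `V` of `Vect^G_F(σ, τ)` is the space of
invariants of the bimodule `kF ⊗ V` with `(x ⊗ v) ↼ y = x (|v| ▷ y) ⊗ (v ◁ y)` (`TwVec.ind`,
`TwVec.isIso_indUnit`). The formula for `f` also shows that `U` is a quotient of a finite power of
its space of invariants, which gives the statement on dimensions.

*Monoidal structure.* The map `u ⊗ v ↦ (u ↼ π‖v‖) ⊗ (t ⇀ v)` is balanced, because
`ω(a, x, b) = σ_{p(a)}(x, π(b))` for `x ∈ F`. It therefore descends to a map `xi` on all of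
`U ⊗_F V`, not only on the invariants. All the identities that are required (degrees, actions,
naturality, associativity, unitality) are checked for `xi` on classes of tensors of homogeneous
vectors, and then transported along the injection of `𝓕 U ⊗ 𝓕 V` into `U ⊗ V`. Compatibility with
the actions is exactly the formula for `ω`, and associativity (`xi_associator`) holds since
`ω(a, b, d)` depends on `d` only through `π(d)`. The inverse of `xi` on the invariants is
`u ⊗ v ↦ |F| u ⊗ v₁`, where `v₁` is the component of `v` with `π‖v₁‖ = 1` (`zeta`). The unit
isomorphism is the restriction of the counit of `kF` to the line of invariants.
-/

noncomputable section

namespace KacBimodule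

/-! ### Tensor products of bimodules -/

section BimodMonoidal

universe v₁ u₁

variable {C : Type u₁} [Category.{v₁} C] [MonoidalCategory C] [Limits.HasCoequalizers C]
variable [∀ X : C, Limits.PreservesColimitsOfSize.{0, 0} (tensorLeft X)]
variable [∀ X : C, Limits.PreservesColimitsOfSize.{0, 0} (tensorRight X)]
variable {A : Mon C}

theorem tensorProj_condition (M N : Bimod A A) :
    M.actRight ▷ N.X ≫ tensorProj M N =
      (α_ M.X A.X N.X).hom ≫ M.X ◁ N.actLeft ≫ tensorProj M N :=
  (Limits.coequalizer.condition _ _).trans (Category.assoc _ _ _)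

/-- The universal property of the tensor product over `A`. -/
def tensorProjIsColimit (M N : Bimod A A) :
    Limits.IsColimit (Limits.Cofork.ofπ (tensorProj M N)
      ((tensorProj_condition M N).trans (Category.assoc _ _ _).symm)) :=
  Limits.coequalizerIsCoequalizer _ _

theorem tensorProj_actLeft (M N : Bimod A A) :
    A.X ◁ tensorProj M N ≫ (M ⊗ N).actLeft =
      (α_ A.X M.X N.X).inv ≫ M.actLeft ▷ N.X ≫ tensorProj M N :=
  Bimod.TensorBimod.whiskerLeft_π_actLeft M N

theorem tensorProj_actRight (M N : Bimod A A) :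
    tensorProj M N ▷ A.X ≫ (M ⊗ N).actRight =
      (α_ M.X N.X A.X).hom ≫ M.X ◁ N.actRight ≫ tensorProj M N :=
  Bimod.TensorBimod.π_tensor_id_actRight M N

theorem tensorProj_whiskerRight {M M' : Bimod A A} (f : M ⟶ M') (N : Bimod A A) :
    tensorProj M N ≫ (f ▷ N).hom = f.hom ▷ N.X ≫ tensorProj M' N :=
  Limits.ι_colimMap _ _

theorem tensorProj_whiskerLeft (M : Bimod A A) {N N' : Bimod A A} (f : N ⟶ N') :
    tensorProj M N ≫ (M ◁ f).hom = M.X ◁ f.hom ≫ tensorProj M N' :=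
  Limits.ι_colimMap _ _

theorem tensorProj_associator (M N P : Bimod A A) :
    tensorProj M N ▷ P.X ≫ tensorProj (M ⊗ N) P ≫ (α_ M N P).hom.hom =
      (α_ M.X N.X P.X).hom ≫ M.X ◁ tensorProj N P ≫ tensorProj M (N ⊗ P) := by
  have h1 : tensorProj (M ⊗ N) P ≫ (α_ M N P).hom.hom = Bimod.AssociatorBimod.homAux M N P :=
    Limits.coequalizer.π_desc _ _
  rw [h1]
  exact π_tensor_id_preserves_coequalizer_inv_desc _ _ _ _

end BimodMonoidal

namespace GrVec

variable {k : Type u} [Field k] {Γ : Type u} [Group Γ] [Fintype Γ] {ω : Cocycle k Γ}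

/-- The linear map underlying a coequalizer of graded spaces is surjective, and every linear map
that equalizes the two given maps factors through it, whether or not it preserves degrees. -/
theorem exists_lin_desc {X Y Q : GrVec ω} {f g : X ⟶ Y} {q : Y ⟶ Q} (w : f ≫ q = g ≫ q)
    (hq : Limits.IsColimit (Limits.Cofork.ofπ q w)) :
    Function.Surjective (lin q) ∧ ∀ {W : Type u} [AddCommGroup W] [Module k W]
      (L : Y.carrier →ₗ[k] W), L ∘ₗ lin f = L ∘ₗ lin g → ∃ L' : Q.carrier →ₗ[k] W,
        ∀ y, L' (lin q y) = L y := by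
  let e : coeq f g ≅ Q := (coeqIsColimit f g).coconePointUniqueUpToIso hq
  have he : coeqπ f g ≫ e.hom = q :=
    (coeqIsColimit f g).comp_coconePointUniqueUpToIso_hom hq Limits.WalkingParallelPair.one
  have he' : q ≫ e.inv = coeqπ f g := by rw [← he, Category.assoc, e.hom_inv_id, Category.comp_id]
  refine ⟨fun z => ?_, fun L hL => ?_⟩
  · obtain ⟨y, hy⟩ := (LinearMap.range (lin f - lin g)).mkQ_surjective (lin e.inv z)
    refine ⟨y, ?_⟩
    rw [← he]
    change lin e.hom ((LinearMap.range (lin f - lin g)).mkQ y) = z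
    rw [hy]
    exact congr_lin e.inv_hom_id z
  · have hker : LinearMap.range (lin f - lin g) ≤ LinearMap.ker L := by
      rintro _ ⟨x, rfl⟩
      have := LinearMap.congr_fun hL x
      rw [LinearMap.mem_ker, LinearMap.sub_apply, map_sub, sub_eq_zero]
      exact this
    refine ⟨(LinearMap.range (lin f - lin g)).liftQ L hker ∘ₗ lin e.inv, fun y => ?_⟩
    exact congrArg ((LinearMap.range (lin f - lin g)).liftQ L hker) (congr_lin he' y)

end GrVec

section Invariants

variable {S : Type u} [Group S] [Fintype S] {F G : Subgroup S} {h : F.IsComplement' G}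
variable {k : Type u} [Field k] {c : KacPair k h}

namespace FBimod

/-- The canonical linear map from the tensor product over `k` to the one over `kF`. -/
def tmulF (U V : FBimod c) : U.X.carrier ⊗[k] V.X.carrier →ₗ[k] (U ⊗ V).X.carrier :=
  GrVec.lin (tensorProj U V)

theorem tmulF_surjective (U V : FBimod c) : Function.Surjective (tmulF U V) :=
  (GrVec.exists_lin_desc _ (tensorProjIsColimit U V)).1

theorem tmulF_homog {U V : FBimod c} {a b : S} {u : U.X.carrier} {v : V.X.carrier}
    (hu : U.X.gr.Homog a u) (hv : V.X.gr.Homog b v) :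
    (U ⊗ V).X.gr.Homog (a * b) (tmulF U V (u ⊗ₜ v)) :=
  GrVec.lin_homog (tensorProj U V) (Grading.Homog.tmul hu hv)

theorem kacCocycle_val_F_mid (a : S) (x : F) (b : S) :
    (kacCocycle c).val a x b = c.σval (pG h a) x (piF h b) := by
  rw [Cocycle.val, kacCocycle_F_mid]; rfl

/-- `(u ↼ x) ⊗ v = ω(‖u‖, x, ‖v‖) u ⊗ (x ⇀ v)` in the tensor product over `kF`. -/
theorem tmulF_rAct {U V : FBimod c} {a b : S} {u : U.X.carrier} {v : V.X.carrier}
    (hu : U.X.gr.Homog a u) (hv : V.X.gr.Homog b v) (x : F) :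
    tmulF U V (U.rAct x u ⊗ₜ v) =
      c.σval (pG h a) x (piF h b) • tmulF U V (u ⊗ₜ V.lAct x v) := by
  have h1 := GrVec.congr_lin (tensorProj_condition U V) ((u ⊗ₜ[k] Finsupp.single x (1 : k)) ⊗ₜ[k] v)
  have h2 := Grading.assocEquiv_tmul (kacCocycle c) hu (homog_single F x (1 : k)) hv
  rw [kacCocycle_val_F_mid] at h2
  -- `N` lives on the tensor product of the carriers, which is the carrier of the tensor product
  -- in `GrVec` only up to unfolding; the same device is used below.
  let N : U.X.carrier ⊗[k] ((F →₀ k) ⊗[k] V.X.carrier) →ₗ[k] (U ⊗ V).X.carrier :=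
    tmulF U V ∘ₗ TensorProduct.map LinearMap.id (GrVec.lin V.actLeft)
  exact h1.trans ((congrArg N h2).trans (map_smul N _ _))

/-- A linear map on `U ⊗ V` descends to the tensor product over `kF` as soon as it is balanced;
it need not preserve the `S`-degrees. -/
theorem exists_tmulF_desc {U V : FBimod c} {W : Type u} [AddCommGroup W] [Module k W]
    (L : U.X.carrier ⊗[k] V.X.carrier →ₗ[k] W)
    (hL : ∀ a b u v x, U.X.gr.Homog a u → V.X.gr.Homog b v →
      L (U.rAct x u ⊗ₜ v) = c.σval (pG h a) x (piF h b) • L (u ⊗ₜ V.lAct x v)) :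
    ∃ L' : (U ⊗ V).X.carrier →ₗ[k] W, ∀ z, L' (tmulF U V z) = L z := by
  refine (GrVec.exists_lin_desc _ (tensorProjIsColimit U V)).2 L ?_
  let L₁ : (U.X.carrier ⊗[k] (F →₀ k)) ⊗[k] V.X.carrier →ₗ[k] W :=
    L ∘ₗ TensorProduct.map (GrVec.lin U.actRight) LinearMap.id
  let N : U.X.carrier ⊗[k] ((F →₀ k) ⊗[k] V.X.carrier) →ₗ[k] W :=
    L ∘ₗ TensorProduct.map LinearMap.id (GrVec.lin V.actLeft)
  let L₂ : (U.X.carrier ⊗[k] (F →₀ k)) ⊗[k] V.X.carrier →ₗ[k] W :=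
    N ∘ₗ (Grading.assocEquiv U.X.gr (grpGrading k F) V.X.gr (kacCocycle c)).toLinearMap
  have key : L₁ = L₂ := by
    refine TensorProduct.ext (TensorProduct.ext (U.X.gr.hom_ext fun a u hu =>
      grp_ext fun x => V.X.gr.hom_ext fun b v hv => ?_))
    have h2 := Grading.assocEquiv_tmul (kacCocycle c) hu (homog_single F x (1 : k)) hv
    rw [kacCocycle_val_F_mid] at h2
    exact (hL a b u v x hu hv).trans ((congrArg N h2).trans (map_smul N _ _)).symm
  exact key

/-- No scalar appears here because `ω(x, a, b) = 1` for `x ∈ F`. -/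
theorem lAct_tmulF (U V : FBimod c) (x : F) (u : U.X.carrier) (v : V.X.carrier) :
    lAct (U ⊗ V) x (tmulF U V (u ⊗ₜ v)) = tmulF U V (U.lAct x u ⊗ₜ v) := by
  have h0 := tensorProj_actLeft U V
  rw [← cancel_epi (α_ (kacAlg c).X U.X V.X).hom, Iso.hom_inv_id_assoc] at h0
  let N : (F →₀ k) ⊗[k] (U.X.carrier ⊗[k] V.X.carrier) →ₗ[k] (U ⊗ V).X.carrier :=
    GrVec.lin (U ⊗ V).actLeft ∘ₗ TensorProduct.map LinearMap.id (tmulF U V)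
  let L₁ : U.X.carrier ⊗[k] V.X.carrier →ₗ[k] (U ⊗ V).X.carrier := lAct (U ⊗ V) x ∘ₗ tmulF U V
  let L₂ : U.X.carrier ⊗[k] V.X.carrier →ₗ[k] (U ⊗ V).X.carrier :=
    tmulF U V ∘ₗ TensorProduct.map (U.lAct x) LinearMap.id
  have key : L₁ = L₂ := by
    refine U.X.gr.tensor_ext V.X.gr fun a b u v hu hv => ?_
    have h1 := GrVec.congr_lin h0 ((Finsupp.single x (1 : k) ⊗ₜ[k] u) ⊗ₜ[k] v)
    have h2 := Grading.assocEquiv_tmul (kacCocycle c) (homog_single F x (1 : k)) hu hv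
    rw [val_F_left, one_smul] at h2
    exact (congrArg N h2).symm.trans h1
  exact LinearMap.congr_fun key (u ⊗ₜ v)

/-- `(u ⊗ v) ↼ x = ω(‖u‖, ‖v‖, x) u ⊗ (v ↼ x)` in the tensor product over `kF`. -/
theorem rAct_tmulF {U V : FBimod c} {a b : S} {u : U.X.carrier} {v : V.X.carrier}
    (hu : U.X.gr.Homog a u) (hv : V.X.gr.Homog b v) (x : F) :
    rAct (U ⊗ V) x (tmulF U V (u ⊗ₜ v)) =
      (kacCocycle c).val a b x • tmulF U V (u ⊗ₜ V.rAct x v) := by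
  have h1 := GrVec.congr_lin (tensorProj_actRight U V) ((u ⊗ₜ[k] v) ⊗ₜ[k] Finsupp.single x (1 : k))
  have h2 := Grading.assocEquiv_tmul (kacCocycle c) hu hv (homog_single F x (1 : k))
  let N : U.X.carrier ⊗[k] (V.X.carrier ⊗[k] (F →₀ k)) →ₗ[k] (U ⊗ V).X.carrier :=
    tmulF U V ∘ₗ TensorProduct.map LinearMap.id (GrVec.lin V.actRight)
  exact h1.trans ((congrArg N h2).trans (map_smul N _ _))

theorem whiskerRight_tmulF {U U' : FBimod c} (f : U ⟶ U') (V : FBimod c) (u : U.X.carrier)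
    (v : V.X.carrier) :
    GrVec.lin (f ▷ V).hom (tmulF U V (u ⊗ₜ v)) = tmulF U' V (GrVec.lin f.hom u ⊗ₜ v) :=
  GrVec.congr_lin (tensorProj_whiskerRight f V) (u ⊗ₜ[k] v)

theorem whiskerLeft_tmulF (U : FBimod c) {V V' : FBimod c} (f : V ⟶ V') (u : U.X.carrier)
    (v : V.X.carrier) :
    GrVec.lin (U ◁ f).hom (tmulF U V (u ⊗ₜ v)) = tmulF U V' (u ⊗ₜ GrVec.lin f.hom v) :=
  GrVec.congr_lin (tensorProj_whiskerLeft U f) (u ⊗ₜ[k] v)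

theorem associator_tmulF {U V W : FBimod c} {a b d : S} {u : U.X.carrier} {v : V.X.carrier}
    {w : W.X.carrier} (hu : U.X.gr.Homog a u) (hv : V.X.gr.Homog b v) (hw : W.X.gr.Homog d w) :
    GrVec.lin (α_ U V W).hom.hom (tmulF (U ⊗ V) W (tmulF U V (u ⊗ₜ v) ⊗ₜ w)) =
      (kacCocycle c).val a b d • tmulF U (V ⊗ W) (u ⊗ₜ tmulF V W (v ⊗ₜ w)) := by
  have h1 := GrVec.congr_lin (tensorProj_associator U V W) ((u ⊗ₜ[k] v) ⊗ₜ[k] w)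
  have h2 := Grading.assocEquiv_tmul (kacCocycle c) hu hv hw
  let N : U.X.carrier ⊗[k] (V.X.carrier ⊗[k] W.X.carrier) →ₗ[k] (U ⊗ (V ⊗ W)).X.carrier :=
    tmulF U (V ⊗ W) ∘ₗ TensorProduct.map LinearMap.id (tmulF V W)
  exact h1.trans ((congrArg N h2).trans (map_smul N _ _))

end FBimod

end Invariants

/-! ### The averaging operator -/

section Invariants

variable {S : Type u} [Group S] [Fintype S] {F G : Subgroup S} {h : F.IsComplement' G}
variable {k : Type u} [Field k] {c : KacPair k h}

namespace FBimod

/-- Linear maps on a tensor product over `kF` are determined by their values on the classes of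
tensors of homogeneous vectors. -/
theorem tmulF_ext {U V : FBimod c} {W : Type u} [AddCommGroup W] [Module k W]
    {L L' : (U ⊗ V).X.carrier →ₗ[k] W}
    (hL : ∀ a b u v, U.X.gr.Homog a u → V.X.gr.Homog b v →
      L (tmulF U V (u ⊗ₜ v)) = L' (tmulF U V (u ⊗ₜ v))) : L = L' := by
  have key : L ∘ₗ tmulF U V = L' ∘ₗ tmulF U V :=
    U.X.gr.tensor_ext V.X.gr fun a b u v hu hv => hL a b u v hu hv
  ext w
  obtain ⟨z, rfl⟩ := tmulF_surjective U V w
  exact LinearMap.congr_fun key z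

theorem tmulF_ext₃ {U V W : FBimod c} {X : Type u} [AddCommGroup X] [Module k X]
    {L L' : ((U ⊗ V) ⊗ W).X.carrier →ₗ[k] X}
    (hL : ∀ a b d u v w, U.X.gr.Homog a u → V.X.gr.Homog b v → W.X.gr.Homog d w →
      L (tmulF (U ⊗ V) W (tmulF U V (u ⊗ₜ v) ⊗ₜ w)) =
        L' (tmulF (U ⊗ V) W (tmulF U V (u ⊗ₜ v) ⊗ₜ w))) : L = L' := by
  have key : L ∘ₗ tmulF (U ⊗ V) W = L' ∘ₗ tmulF (U ⊗ V) W :=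
    TensorProduct.ext (tmulF_ext fun a b u v hu hv => W.X.gr.hom_ext fun d w hw =>
      hL a b d u v w hu hv hw)
  ext w
  obtain ⟨z, rfl⟩ := tmulF_surjective (U ⊗ V) W w
  exact LinearMap.congr_fun key z

variable [Fintype F]

section Average

variable (U V : FBimod c)

theorem tAct_apply (u : U.X.carrier) :
    U.tAct u = (Fintype.card F : k)⁻¹ • ∑ x, U.lAct x u := by
  rw [tAct, LinearMap.smul_apply, LinearMap.sum_apply]

theorem lAct_tAct (y : F) (u : U.X.carrier) : U.lAct y (U.tAct u) = U.tAct u := by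
  simp only [tAct_apply, map_smul, map_sum, lAct_lAct]
  congr 1
  exact Fintype.sum_equiv (Equiv.mulLeft y) _ _ fun x => rfl

theorem tAct_lAct (y : F) (u : U.X.carrier) : U.tAct (U.lAct y u) = U.tAct u := by
  simp only [tAct_apply, lAct_lAct]
  congr 1
  exact Fintype.sum_equiv (Equiv.mulRight y) _ _ fun x => rfl

theorem rAct_tAct (y : F) (u : U.X.carrier) : U.rAct y (U.tAct u) = U.tAct (U.rAct y u) := by
  simp only [tAct_apply, map_smul, map_sum, rAct_lAct]

theorem lin_tAct {U V : FBimod c} (f : U ⟶ V) (u : U.X.carrier) :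
    GrVec.lin f.hom (U.tAct u) = V.tAct (GrVec.lin f.hom u) := by
  simp only [tAct_apply, map_smul, map_sum, lin_lAct]

theorem tAct_tmulF (u : U.X.carrier) (v : V.X.carrier) :
    tAct (U ⊗ V) (tmulF U V (u ⊗ₜ v)) = tmulF U V (U.tAct u ⊗ₜ v) := by
  rw [tAct_apply, tAct_apply, ← TensorProduct.smul_tmul', map_smul, TensorProduct.sum_tmul, map_sum]
  exact congrArg _ (Finset.sum_congr rfl fun x _ => lAct_tmulF U V x u v)

/-- The `F`-grading `π‖u‖` of a bimodule. -/
def grF : Grading k F U.X.carrier := U.X.gr.push (piF h)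

theorem lAct_grF_homog (y : F) {x : F} {u : U.X.carrier} (hu : U.grF.Homog x u) :
    U.grF.Homog (y * x) (U.lAct y u) := by
  refine (U.X.gr.push_ext (piF h) x (L := U.lAct y) (L' := U.grF.proj (y * x) ∘ₗ U.lAct y)
    (fun a v ha hv => ?_) hu).symm
  have := (U.lAct_homog y hv).push (piF h)
  rw [(piF_mul h _ _).1, (proj_F h y).1, (proj_F h y).2, (act_one_left h _).1, ha] at this
  exact this.symm

theorem lAct_grF (y x : F) (u : U.X.carrier) :
    U.lAct y (U.grF.proj x u) = U.grF.proj (y * x) (U.lAct y u) := by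
  classical
  refine LinearMap.congr_fun (f := U.lAct y ∘ₗ U.grF.proj x) (g := U.grF.proj (y * x) ∘ₗ U.lAct y)
    (U.grF.hom_ext fun z v hv => ?_) u
  rw [LinearMap.comp_apply, LinearMap.comp_apply, hv.proj_eq, (U.lAct_grF_homog y hv).proj_eq]
  simp only [mul_right_inj]
  split_ifs <;> simp

variable [CharZero k]

theorem tAct_of_mem {u : U.X.carrier} (hu : u ∈ U.inv) : U.tAct u = u := by
  have hF : (Fintype.card F : k) ≠ 0 := Nat.cast_ne_zero.2 Fintype.card_ne_zero
  rw [tAct_apply, Finset.sum_congr rfl fun x _ => hu x, Finset.sum_const, Finset.card_univ,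
    ← Nat.cast_smul_eq_nsmul k, smul_smul, inv_mul_cancel₀ hF, one_smul]

theorem map_tAct_of_lAct {U : FBimod c} {W : Type u} [AddCommGroup W] [Module k W]
    (e : U.X.carrier →ₗ[k] W) (he : ∀ x u, e (U.lAct x u) = e u) (u : U.X.carrier) :
    e (U.tAct u) = e u := by
  have hF : (Fintype.card F : k) ≠ 0 := Nat.cast_ne_zero.2 Fintype.card_ne_zero
  rw [tAct_apply, map_smul, map_sum, Finset.sum_congr rfl fun x _ => he x u, Finset.sum_const,
    Finset.card_univ, ← Nat.cast_smul_eq_nsmul k, smul_smul, inv_mul_cancel₀ hF, one_smul]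

theorem tAct_tAct (u : U.X.carrier) : U.tAct (U.tAct u) = U.tAct u :=
  U.tAct_of_mem fun x => U.lAct_tAct x u

/-- An invariant vector is recovered from its component with `π‖u‖ = 1` by averaging. -/
theorem card_smul_tAct_grF {u : U.X.carrier} (hu : u ∈ U.inv) :
    (Fintype.card F : k) • U.tAct (U.grF.proj 1 u) = u := by
  have hF : (Fintype.card F : k) ≠ 0 := Nat.cast_ne_zero.2 Fintype.card_ne_zero
  rw [tAct_apply, smul_smul, mul_inv_cancel₀ hF, one_smul]
  conv_rhs => rw [← U.grF.sum_proj u]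
  exact Finset.sum_congr rfl fun x _ => by rw [lAct_grF, mul_one, hu x]

/-- Averaging spreads a vector over its `F`-orbit, of which exactly one member has `π‖u‖ = 1`. -/
theorem card_smul_grF_tAct {x : F} {u : U.X.carrier} (hu : U.grF.Homog x u) :
    (Fintype.card F : k) • U.grF.proj 1 (U.tAct u) = U.lAct x⁻¹ u := by
  classical
  have hF : (Fintype.card F : k) ≠ 0 := Nat.cast_ne_zero.2 Fintype.card_ne_zero
  rw [tAct_apply, map_smul, smul_smul, mul_inv_cancel₀ hF, one_smul, map_sum,
    Finset.sum_eq_single x⁻¹]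
  · rw [(U.lAct_grF_homog x⁻¹ hu).proj_eq, if_pos (inv_mul_cancel x).symm]
  · intro y _ hy
    rw [(U.lAct_grF_homog y hu).proj_eq, if_neg fun e => hy (eq_inv_of_mul_eq_one_left e.symm)]
  · simp

/-- The averaging operator as a projection onto the invariants. -/
def toInv : U.X.carrier →ₗ[k] U.inv := U.tAct.codRestrict U.inv fun u x => U.lAct_tAct x u

end Average

/-! ### The comparison map on the whole tensor product -/

variable {U V : FBimod c}

theorem xiLin_tmul (u : U.X.carrier) {b : S} {v : V.X.carrier} (hv : V.X.gr.Homog b v) :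
    xiLin U V (u ⊗ₜ v) = U.rAct (piF h b) u ⊗ₜ V.tAct v := by
  classical
  simp only [xiLin, LinearMap.sum_apply, TensorProduct.map_tmul, LinearMap.comp_apply]
  rw [Finset.sum_eq_single b]
  · rw [hv]
  · intro d _ hd
    rw [hv.proj_eq, if_neg hd, map_zero, TensorProduct.tmul_zero]
  · simp

/-- The map `xiLin` is balanced, hence descends to the tensor product over `kF`. -/
theorem exists_xi (U V : FBimod c) : ∃ L : (U ⊗ V).X.carrier →ₗ[k] U.X.carrier ⊗[k] V.X.carrier,
    ∀ z, L (tmulF U V z) = xiLin U V z := by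
  refine exists_tmulF_desc _ fun a b u v x hu hv => ?_
  rw [xiLin_tmul _ hv, xiLin_tmul _ (V.lAct_homog x hv), U.rAct_rAct _ _ hu, tAct_lAct,
    (piF_mul h _ _).1, (proj_F h x).1, (proj_F h x).2, (act_one_left h _).1,
    TensorProduct.smul_tmul']

/-- The linear map `U ⊗_F V → U ⊗ V` given by `u ⊗ v ↦ (u ↼ π‖v‖) ⊗ (t ⇀ v)`. -/
def xi (U V : FBimod c) : (U ⊗ V).X.carrier →ₗ[k] U.X.carrier ⊗[k] V.X.carrier :=
  (exists_xi U V).choose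

theorem xi_tmulF_eq (z : U.X.carrier ⊗[k] V.X.carrier) : xi U V (tmulF U V z) = xiLin U V z :=
  (exists_xi U V).choose_spec z

theorem xi_tmulF (u : U.X.carrier) {x : F} {v : V.X.carrier} (hv : V.grF.Homog x v) :
    xi U V (tmulF U V (u ⊗ₜ v)) = U.rAct x u ⊗ₜ V.tAct v := by
  rw [xi_tmulF_eq]
  exact V.X.gr.push_ext (piF h) x (L := xiLin U V ∘ₗ TensorProduct.mk k _ _ u)
    (L' := TensorProduct.mk k _ _ (U.rAct x u) ∘ₗ V.tAct)
    (fun b w hb hw => by subst hb; exact xiLin_tmul u hw) hv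

/-- The comparison map is compatible with the averaging in the first factor. -/
theorem xi_tAct (w : (U ⊗ V).X.carrier) :
    xi U V (tAct (U ⊗ V) w) = TensorProduct.map U.tAct LinearMap.id (xi U V w) := by
  refine LinearMap.congr_fun (f := xi U V ∘ₗ tAct (U ⊗ V))
    (g := TensorProduct.map U.tAct LinearMap.id ∘ₗ xi U V) (tmulF_ext fun a b u v hu hv => ?_) w
  rw [LinearMap.comp_apply, LinearMap.comp_apply, tAct_tmulF, xi_tmulF _ (hv.push _),
    xi_tmulF _ (hv.push _), TensorProduct.map_tmul, rAct_tAct, LinearMap.id_apply]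

variable [Fintype G]

theorem tAct_grG_homog (V : FBimod c) {g : G} {v : V.X.carrier} (hv : V.grG.Homog g v) :
    V.grG.Homog g (V.tAct v) := by
  simp only [Grading.homog_iff, tAct_apply, map_smul, map_sum, ← lAct_grG,
    Grading.homog_iff.1 hv]

/-- The comparison map preserves the `G`-degrees, as `p(a b) = (p(a) ◁ π(b)) p(b)`. -/
theorem xi_proj (g : G) (w : (U ⊗ V).X.carrier) :
    xi U V ((grG (U ⊗ V)).proj g w) = (U.grG.tensor V.grG).proj g (xi U V w) := by
  classical
  refine LinearMap.congr_fun (f := xi U V ∘ₗ (grG (U ⊗ V)).proj g)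
    (g := (U.grG.tensor V.grG).proj g ∘ₗ xi U V) (tmulF_ext fun a b u v hu hv => ?_) w
  have h1 : (grG (U ⊗ V)).Homog (pG h (a * b)) (tmulF U V (u ⊗ₜ v)) := (tmulF_homog hu hv).push _
  have h2 := V.tAct_grG_homog (hv.push (pG h))
  rw [LinearMap.comp_apply, LinearMap.comp_apply, xi_tmulF _ (hv.push _), h1.proj_eq,
    ((U.rAct_grG (piF h b) (hu.push _)).tmul h2).proj_eq, (piF_mul h a b).2]
  split_ifs
  · rw [xi_tmulF _ (hv.push _)]
  · rw [map_zero]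

/-- Compatibility with the right actions; both scalars that come up are factors of the 3-cocycle. -/
theorem xi_rAct (x : F) (w : (U ⊗ V).X.carrier) :
    xi U V (rAct (U ⊗ V) x w) = tensorAct c U.grG U.rAct V.grG V.rAct x (xi U V w) := by
  refine LinearMap.congr_fun (f := xi U V ∘ₗ rAct (U ⊗ V) x)
    (g := tensorAct c U.grG U.rAct V.grG V.rAct x ∘ₗ xi U V) (tmulF_ext fun a b u v hu hv => ?_) w
  have h2 := V.tAct_grG_homog (hv.push (pG h))
  rw [LinearMap.comp_apply, LinearMap.comp_apply, rAct_tmulF hu hv, map_smul,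
    xi_tmulF _ ((V.rAct_homog x hv).push _), xi_tmulF _ (hv.push _),
    tensorAct_tmul c x (U.rAct_grG (piF h b) (hu.push _)) h2, U.rAct_rAct _ _ hu, rAct_tAct,
    (piF_mul h b x).1, (proj_F h x).1, ← TensorProduct.smul_tmul', smul_smul]
  congr 1
  -- `ω(a, b, x) = τ_x(p(a) ◁ π(b), p(b)) σ_{p(a)}(π(b), p(b) ▷ x)`
  rw [Cocycle.val, kacCocycle_apply, (proj_F h x).1, Units.val_mul]
  rfl

end FBimod

end Invariants

/-! ### The comparison morphism on invariants -/

section Invariants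

variable {S : Type u} [Group S] [Fintype S] {F G : Subgroup S} {h : F.IsComplement' G}
variable {k : Type u} [Field k] {c : KacPair k h} [Fintype G]

/-- A morphism of twisted spaces which is bijective is an isomorphism. -/
theorem TwVec.isIso_of_bijective {V W : TwVec c} (f : V ⟶ W)
    (hf : Function.Bijective (TwVec.lin f)) : IsIso f :=
  (TwVec.mkIso (LinearEquiv.ofBijective (TwVec.lin f) hf) (TwVec.lin_proj f)
    (TwVec.lin_act f)).isIso_hom

namespace FBimod

/-- The inclusion of `𝓕 U ⊗ 𝓕 V` into `U ⊗ V`. -/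
def incl (U V : FBimod c) : U.inv ⊗[k] V.inv →ₗ[k] U.X.carrier ⊗[k] V.X.carrier :=
  TensorProduct.map U.inv.subtype V.inv.subtype

theorem incl_injective (U V : FBimod c) : Function.Injective (incl U V) :=
  TensorProduct.map_injective_of_flat_flat _ _ U.inv.subtype_injective V.inv.subtype_injective

/-- The grading of `𝓕 U`. -/
def invGr (U : FBimod c) : Grading k G U.inv := U.invObj.gr

/-- The action on `𝓕 U`. -/
def invAct (U : FBimod c) : F → Module.End k U.inv := U.invObj.act

theorem invGr_proj (U : FBimod c) (g : G) (u : U.inv) :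
    U.inv.subtype (U.invGr.proj g u) = U.grG.proj g (U.inv.subtype u) := rfl

theorem invAct_apply (U : FBimod c) (x : F) (u : U.inv) :
    U.inv.subtype (U.invAct x u) = U.rAct x (U.inv.subtype u) := rfl

theorem incl_proj (U V : FBimod c) (g : G) (z : U.inv ⊗[k] V.inv) :
    incl U V ((U.invGr.tensor V.invGr).proj g z) = (U.grG.tensor V.grG).proj g (incl U V z) :=
  Grading.map_proj U.invGr_proj V.invGr_proj g z

theorem incl_act (U V : FBimod c) (x : F) (z : U.inv ⊗[k] V.inv) :
    incl U V (tensorAct c U.invGr U.invAct V.invGr V.invAct x z) =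
      tensorAct c U.grG U.rAct V.grG V.rAct x (incl U V z) :=
  map_act c U.invGr_proj V.invGr_proj U.invAct_apply V.invAct_apply x z

variable [Fintype F] [CharZero k]

/-- The restriction of the comparison map to the invariants, as a linear map. -/
def deltaLin (U V : FBimod c) : FBimod.inv (U ⊗ V) →ₗ[k] U.inv ⊗[k] V.inv :=
  TensorProduct.map U.toInv V.toInv ∘ₗ xi U V ∘ₗ (FBimod.inv (U ⊗ V)).subtype

/-- The second tensor factor of a value of the comparison map is invariant. -/
theorem map_tAct_xi (U V : FBimod c) (w : (U ⊗ V).X.carrier) :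
    TensorProduct.map LinearMap.id V.tAct (xi U V w) = xi U V w := by
  refine LinearMap.congr_fun (f := TensorProduct.map LinearMap.id V.tAct ∘ₗ xi U V)
    (g := xi U V) (tmulF_ext fun a b u v hu hv => ?_) w
  rw [LinearMap.comp_apply, xi_tmulF _ (hv.push _), TensorProduct.map_tmul, tAct_tAct,
    LinearMap.id_apply]

/-- The comparison map sends invariants into the tensor product of the invariants. -/
theorem incl_deltaLin (U V : FBimod c) (w : FBimod.inv (U ⊗ V)) :
    incl U V (deltaLin U V w) = xi U V w := by
  have h1 : incl U V (deltaLin U V w) = TensorProduct.map U.tAct LinearMap.id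
      (TensorProduct.map LinearMap.id V.tAct (xi U V w)) := by
    rw [← LinearMap.comp_apply (TensorProduct.map U.tAct LinearMap.id), ← TensorProduct.map_comp,
      incl, deltaLin, LinearMap.comp_apply, ← LinearMap.comp_apply, ← TensorProduct.map_comp]
    rfl
  rw [h1, map_tAct_xi, ← xi_tAct, tAct_of_mem _ w.2]

/-- The comparison morphism `𝓕 (U ⊗_F V) ⟶ 𝓕 U ⊗ 𝓕 V`. -/
def delta (U V : FBimod c) :
    (invFunctor c).obj (U ⊗ V) ⟶ (invFunctor c).obj U ⊗ (invFunctor c).obj V :=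
  TwVec.Hom.mk (V := FBimod.invObj (U ⊗ V)) (W := U.invObj.tensor V.invObj) (deltaLin U V)
    (fun g w => incl_injective U V <| by
      refine (incl_deltaLin U V _).trans (Eq.trans ?_ (incl_proj U V g _).symm)
      exact (xi_proj g w.1).trans (congrArg _ (incl_deltaLin U V w).symm))
    (fun x w => incl_injective U V <| by
      refine (incl_deltaLin U V _).trans (Eq.trans ?_ (incl_act U V x _).symm)
      exact (xi_rAct x w.1).trans (congrArg _ (incl_deltaLin U V w).symm))

theorem isXi_delta (U V : FBimod c) : IsXi U V (delta U V) := fun w z hz => by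
  refine (incl_deltaLin U V w).trans ?_
  rw [← hz]
  exact xi_tmulF_eq z

/-! ### The comparison map is invertible -/

/-- The map `u ⊗ v ↦ |F| u ⊗ v₁` into the tensor product over `kF`, where `v₁` is the component of
`v` with `π‖v₁‖ = 1`. It inverts the comparison map. -/
def zeta (U V : FBimod c) : U.X.carrier ⊗[k] V.X.carrier →ₗ[k] (U ⊗ V).X.carrier :=
  (Fintype.card F : k) • tmulF U V ∘ₗ TensorProduct.map LinearMap.id (V.grF.proj 1)

theorem zeta_tmul {U V : FBimod c} (u : U.X.carrier) (v : V.X.carrier) :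
    zeta U V (u ⊗ₜ v) = (Fintype.card F : k) • tmulF U V (u ⊗ₜ V.grF.proj 1 v) := rfl

/-- Here `tmulF_rAct` moves `x = π‖v‖` back from the first factor to the second one; the scalar is
`σ_{p‖u‖}(x, 1) = 1`. -/
theorem zeta_xi (U V : FBimod c) (w : (U ⊗ V).X.carrier) : zeta U V (xi U V w) = w := by
  refine LinearMap.congr_fun (f := zeta U V ∘ₗ xi U V) (g := LinearMap.id)
    (tmulF_ext fun a b u v hu hv => ?_) w
  rw [LinearMap.comp_apply, xi_tmulF _ (hv.push _), zeta_tmul, ← map_smul,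
    ← TensorProduct.tmul_smul, card_smul_grF_tAct _ (hv.push _),
    tmulF_rAct hu (V.lAct_homog _ hv), lAct_lAct, mul_inv_cancel, lAct_one, (piF_mul h _ _).1,
    (proj_F h _).1, (proj_F h _).2, (act_one_left h _).1, inv_mul_cancel, KacPair.σval,
    c.σ_one_right, Units.val_one, one_smul, LinearMap.id_apply]

theorem xi_zeta_incl (U V : FBimod c) (z : U.inv ⊗[k] V.inv) :
    xi U V (zeta U V (incl U V z)) = incl U V z := by
  refine LinearMap.congr_fun (f := xi U V ∘ₗ zeta U V ∘ₗ incl U V) (g := incl U V)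
    (TensorProduct.ext' fun u v => ?_) z
  change xi U V (zeta U V (u.1 ⊗ₜ v.1)) = u.1 ⊗ₜ v.1
  rw [zeta_tmul, map_smul, xi_tmulF _ (V.grF.homog_proj 1 v.1), rAct_one,
    ← TensorProduct.tmul_smul, card_smul_tAct_grF _ v.2]

theorem zeta_incl_mem (U V : FBimod c) (z : U.inv ⊗[k] V.inv) :
    zeta U V (incl U V z) ∈ FBimod.inv (U ⊗ V) := fun x => by
  refine LinearMap.congr_fun (f := lAct (U ⊗ V) x ∘ₗ zeta U V ∘ₗ incl U V)
    (g := zeta U V ∘ₗ incl U V) (TensorProduct.ext' fun u v => ?_) z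
  change lAct (U ⊗ V) x (zeta U V (u.1 ⊗ₜ v.1)) = zeta U V (u.1 ⊗ₜ v.1)
  rw [zeta_tmul, map_smul, lAct_tmulF, u.2 x]

theorem isIso_delta (U V : FBimod c) : IsIso (delta U V) := by
  refine TwVec.isIso_of_bijective _ (show Function.Bijective (deltaLin U V) from ⟨?_, fun z => ?_⟩)
  · intro w w' e
    have e' := congrArg (incl U V) e
    rw [incl_deltaLin, incl_deltaLin] at e'
    exact Subtype.ext (by rw [← zeta_xi U V w.1, e', zeta_xi])
  · exact ⟨⟨zeta U V (incl U V z), zeta_incl_mem U V z⟩, incl_injective U V <| by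
      rw [incl_deltaLin, xi_zeta_incl]⟩

end FBimod

end Invariants

/-! ### Naturality, associativity and unitality -/

section Invariants

variable {S : Type u} [Group S] [Fintype S] {F G : Subgroup S} {h : F.IsComplement' G}
variable {k : Type u} [Field k] {c : KacPair k h} [Fintype G] [Fintype F] [CharZero k]

namespace FBimod

section Naturality

/-- The restriction of a morphism to the invariants, as a linear map. -/
def invLin {U V : FBimod c} (f : U ⟶ V) : U.inv →ₗ[k] V.inv := TwVec.lin (invMap f)

variable {U U' V V' : FBimod c}

theorem xi_whiskerRight (f : U ⟶ U') (V : FBimod c) (w : (U ⊗ V).X.carrier) :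
    xi U' V (GrVec.lin (f ▷ V).hom w) =
      TensorProduct.map (GrVec.lin f.hom) LinearMap.id (xi U V w) := by
  refine LinearMap.congr_fun (f := xi U' V ∘ₗ GrVec.lin (f ▷ V).hom)
    (g := TensorProduct.map (GrVec.lin f.hom) LinearMap.id ∘ₗ xi U V)
    (tmulF_ext fun a b u v hu hv => ?_) w
  rw [LinearMap.comp_apply, LinearMap.comp_apply, whiskerRight_tmulF, xi_tmulF _ (hv.push _),
    xi_tmulF _ (hv.push _), TensorProduct.map_tmul, lin_rAct, LinearMap.id_apply]

theorem xi_whiskerLeft (U : FBimod c) (f : V ⟶ V') (w : (U ⊗ V).X.carrier) :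
    xi U V' (GrVec.lin (U ◁ f).hom w) =
      TensorProduct.map LinearMap.id (GrVec.lin f.hom) (xi U V w) := by
  refine LinearMap.congr_fun (f := xi U V' ∘ₗ GrVec.lin (U ◁ f).hom)
    (g := TensorProduct.map LinearMap.id (GrVec.lin f.hom) ∘ₗ xi U V)
    (tmulF_ext fun a b u v hu hv => ?_) w
  rw [LinearMap.comp_apply, LinearMap.comp_apply, whiskerLeft_tmulF, xi_tmulF _ (hv.push _),
    xi_tmulF _ ((GrVec.lin_homog f.hom hv).push _), TensorProduct.map_tmul, lin_tAct,
    LinearMap.id_apply]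

theorem delta_natural_left (f : U ⟶ U') (V : FBimod c) :
    delta U V ≫ (invFunctor c).map f ▷ (invFunctor c).obj V =
      (invFunctor c).map (f ▷ V) ≫ delta U' V := by
  refine TwVec.hom_ext (LinearMap.ext fun (w : FBimod.inv (U ⊗ V)) => incl_injective U' V ?_)
  have h1 : ∀ z : U.inv ⊗[k] V.inv, incl U' V (TensorProduct.map (invLin f) LinearMap.id z) =
      TensorProduct.map (GrVec.lin f.hom) LinearMap.id (incl U V z) :=
    LinearMap.congr_fun (f := incl U' V ∘ₗ TensorProduct.map (invLin f) LinearMap.id)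
      (g := TensorProduct.map (GrVec.lin f.hom) LinearMap.id ∘ₗ incl U V) (TensorProduct.ext' fun _ _ => rfl)
  exact (h1 (deltaLin U V w)).trans (((congrArg _ (incl_deltaLin U V w)).trans
    (xi_whiskerRight f V _).symm).trans (incl_deltaLin U' V (invLin (f ▷ V) w)).symm)

theorem delta_natural_right (U : FBimod c) (f : V ⟶ V') :
    delta U V ≫ (invFunctor c).obj U ◁ (invFunctor c).map f =
      (invFunctor c).map (U ◁ f) ≫ delta U V' := by
  refine TwVec.hom_ext (LinearMap.ext fun (w : FBimod.inv (U ⊗ V)) => incl_injective U V' ?_)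
  have h1 : ∀ z : U.inv ⊗[k] V.inv, incl U V' (TensorProduct.map LinearMap.id (invLin f) z) =
      TensorProduct.map LinearMap.id (GrVec.lin f.hom) (incl U V z) :=
    LinearMap.congr_fun (f := incl U V' ∘ₗ TensorProduct.map LinearMap.id (invLin f))
      (g := TensorProduct.map LinearMap.id (GrVec.lin f.hom) ∘ₗ incl U V) (TensorProduct.ext' fun _ _ => rfl)
  exact (h1 (deltaLin U V w)).trans (((congrArg _ (incl_deltaLin U V w)).trans
    (xi_whiskerLeft U f _).symm).trans (incl_deltaLin U V' (invLin (U ◁ f) w)).symm)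

end Naturality

section Associativity

variable (U V W : FBimod c)

/-- The comparison maps intertwine the associator of bimodules with the one of vector spaces: the
scalar `ω(a, b, d)` of the former equals the scalar `ω(a, b, π(d))` that the right action on
`U ⊗_F V` produces. -/
theorem xi_associator (z : ((U ⊗ V) ⊗ W).X.carrier) :
    TensorProduct.assoc k _ _ _
        (TensorProduct.map (xi U V) LinearMap.id (xi (U ⊗ V) W z)) =
      TensorProduct.map LinearMap.id (xi V W)
        (xi U (V ⊗ W) (GrVec.lin (α_ U V W).hom.hom z)) := by
  refine LinearMap.congr_fun (f := (TensorProduct.assoc k _ _ _).toLinearMap ∘ₗ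
      TensorProduct.map (xi U V) LinearMap.id ∘ₗ xi (U ⊗ V) W)
    (g := TensorProduct.map LinearMap.id (xi V W) ∘ₗ xi U (V ⊗ W) ∘ₗ
      GrVec.lin (α_ U V W).hom.hom) (tmulF_ext₃ fun a b d u v w hu hv hw => ?_) z
  have h1 : (kacCocycle c).val a b (piF h d) = (kacCocycle c).val a b d := by
    rw [Cocycle.val, Cocycle.val, kacCocycle_apply, kacCocycle_apply, (proj_F h _).1]
  have h2 : piF h (b * piF h d) = piF h (b * d) := by
    rw [(piF_mul h _ _).1, (piF_mul h _ _).1, (proj_F h _).1]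
  simp only [LinearMap.comp_apply, LinearEquiv.coe_coe]
  rw [xi_tmulF _ (hw.push _), rAct_tmulF hu hv, TensorProduct.map_tmul, map_smul,
    xi_tmulF _ ((V.rAct_homog _ hv).push _), associator_tmulF hu hv hw, map_smul,
    xi_tmulF _ ((tmulF_homog hv hw).push _), map_smul, TensorProduct.map_tmul, tAct_tmulF,
    xi_tmulF _ (hw.push _), ← TensorProduct.smul_tmul', map_smul, TensorProduct.assoc_tmul,
    rAct_tAct, h1, h2, LinearMap.id_apply, LinearMap.id_apply]

/-- The inclusion of `𝓕 U ⊗ (𝓕 V ⊗ 𝓕 W)` into `U ⊗ (V ⊗ W)`. -/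
def incl₃ : U.inv ⊗[k] (V.inv ⊗[k] W.inv) →ₗ[k]
    U.X.carrier ⊗[k] (V.X.carrier ⊗[k] W.X.carrier) :=
  TensorProduct.map U.inv.subtype (incl V W)

theorem incl₃_injective : Function.Injective (incl₃ U V W) :=
  TensorProduct.map_injective_of_flat_flat _ _ U.inv.subtype_injective (incl_injective V W)

theorem incl₃_assoc (z : (U.inv ⊗[k] V.inv) ⊗[k] W.inv) :
    incl₃ U V W (TensorProduct.assoc k _ _ _ z) =
      TensorProduct.assoc k _ _ _ (TensorProduct.map (incl U V) W.inv.subtype z) := by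
  refine LinearMap.congr_fun (f := incl₃ U V W ∘ₗ (TensorProduct.assoc k _ _ _).toLinearMap)
    (g := (TensorProduct.assoc k _ _ _).toLinearMap ∘ₗ
      TensorProduct.map (incl U V) W.inv.subtype) ?_ z
  exact TensorProduct.ext_threefold fun _ _ _ => rfl

theorem delta_associativity :
    delta (U ⊗ V) W ≫ delta U V ▷ (invFunctor c).obj W ≫
        (α_ ((invFunctor c).obj U) ((invFunctor c).obj V) ((invFunctor c).obj W)).hom =
      (invFunctor c).map (α_ U V W).hom ≫ delta U (V ⊗ W) ≫
        (invFunctor c).obj U ◁ delta V W := by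
  refine TwVec.hom_ext (LinearMap.ext fun (w : FBimod.inv ((U ⊗ V) ⊗ W)) =>
    incl₃_injective U V W ?_)
  have h1 : ∀ y : FBimod.inv (U ⊗ V) ⊗[k] W.inv,
      TensorProduct.map (incl U V) W.inv.subtype
          (TensorProduct.map (deltaLin U V) LinearMap.id y) =
        TensorProduct.map (xi U V) LinearMap.id (incl (U ⊗ V) W y) := 
    LinearMap.congr_fun (f := TensorProduct.map (incl U V) W.inv.subtype ∘ₗ
        TensorProduct.map (deltaLin U V) LinearMap.id)
      (g := TensorProduct.map (xi U V) LinearMap.id ∘ₗ incl (U ⊗ V) W)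
      (TensorProduct.ext' fun p q => congrArg (· ⊗ₜ[k] q.1) (incl_deltaLin U V p))
  have h2 : ∀ y : U.inv ⊗[k] FBimod.inv (V ⊗ W),
      incl₃ U V W (TensorProduct.map LinearMap.id (deltaLin V W) y) =
        TensorProduct.map LinearMap.id (xi V W) (incl U (V ⊗ W) y) := 
    LinearMap.congr_fun (f := incl₃ U V W ∘ₗ TensorProduct.map LinearMap.id (deltaLin V W))
      (g := TensorProduct.map LinearMap.id (xi V W) ∘ₗ incl U (V ⊗ W))
      (TensorProduct.ext' fun p q => congrArg (p.1 ⊗ₜ[k] ·) (incl_deltaLin V W q))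
  refine (incl₃_assoc U V W
    (TensorProduct.map (deltaLin U V) LinearMap.id (deltaLin (U ⊗ V) W w))).trans ?_
  rw [h1, incl_deltaLin, xi_associator]
  exact ((h2 (deltaLin U (V ⊗ W) (invLin (α_ U V W).hom w))).trans
    (congrArg _ (incl_deltaLin U (V ⊗ W) (invLin (α_ U V W).hom w)))).symm

end Associativity

section Unit

/-- The counit `x ↦ 1` of `kF`. -/
def counit (k : Type u) [Field k] (F : Subgroup S) : (F →₀ k) →ₗ[k] k :=
  Finsupp.lsum k fun _ => LinearMap.id

theorem counit_single (x : F) (r : k) : counit k F (Finsupp.single x r) = r :=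
  Finsupp.lsum_single _ _ _ _

theorem lAct_unit_single (x y : F) :
    lAct (𝟙_ (FBimod c)) x (Finsupp.single y 1 : F →₀ k) = (Finsupp.single (x * y) 1 : F →₀ k) :=
  (grpMul_single F x y (1 : k) 1).trans (by rw [one_mul])

theorem rAct_unit_single (x y : F) :
    rAct (𝟙_ (FBimod c)) x (Finsupp.single y 1 : F →₀ k) = (Finsupp.single (y * x) 1 : F →₀ k) :=
  (grpMul_single F y x (1 : k) 1).trans (by rw [one_mul])

theorem counit_rAct (x : F) (u : F →₀ k) :
    counit k F (rAct (𝟙_ (FBimod c)) x u) = counit k F u := by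
  refine LinearMap.congr_fun (f := counit k F ∘ₗ rAct (𝟙_ (FBimod c)) x) (g := counit k F)
    (grp_ext fun y => ?_) u
  exact (congrArg (counit k F) (rAct_unit_single x y)).trans
    ((counit_single _ _).trans (counit_single _ _).symm)

theorem counit_lAct (x : F) (u : F →₀ k) :
    counit k F (lAct (𝟙_ (FBimod c)) x u) = counit k F u := by
  refine LinearMap.congr_fun (f := counit k F ∘ₗ lAct (𝟙_ (FBimod c)) x) (g := counit k F)
    (grp_ext fun y => ?_) u
  exact (congrArg (counit k F) (lAct_unit_single x y)).trans
    ((counit_single _ _).trans (counit_single _ _).symm)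

theorem counit_tAct (u : F →₀ k) :
    counit k F (tAct (𝟙_ (FBimod c)) u) = counit k F u :=
  map_tAct_of_lAct (U := 𝟙_ (FBimod c)) (counit k F) counit_lAct u

/-- On `kF` the averaging operator is `u ↦ ε(u) t`. -/
theorem tAct_unit (u : F →₀ k) : tAct (𝟙_ (FBimod c)) u =
    counit k F u • tAct (𝟙_ (FBimod c)) (Finsupp.single 1 1 : F →₀ k) := by
  refine LinearMap.congr_fun (f := tAct (𝟙_ (FBimod c)))
    (g := (counit k F).smulRight (tAct (𝟙_ (FBimod c)) (Finsupp.single 1 1 : F →₀ k)))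
    (grp_ext fun x => ?_) u
  have h1 := tAct_lAct (𝟙_ (FBimod c)) x (Finsupp.single 1 1 : F →₀ k)
  rw [lAct_unit_single, mul_one] at h1
  refine h1.trans ?_
  rw [LinearMap.smulRight_apply]
  exact (one_smul k _).symm.trans (congrArg (· • _) (counit_single x (1 : k)).symm)

theorem counit_grG (g : G) (u : F →₀ k) :
    counit k F ((grG (𝟙_ (FBimod c))).proj g u) = (Grading.unit k G).proj g (counit k F u) := by
  classical
  refine LinearMap.congr_fun (f := counit k F ∘ₗ (grG (𝟙_ (FBimod c))).proj g)
    (g := (Grading.unit k G).proj g ∘ₗ counit k F) (grp_ext fun x => ?_) u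
  have h1 : (grG (𝟙_ (FBimod c))).Homog (pG h x) (Finsupp.single x 1 : F →₀ k) :=
    Grading.Homog.push (homog_single F x (1 : k)) (pG h)
  rw [(proj_F h x).2] at h1
  have h2 := (Grading.homog_unit (Γ := G) (counit k F (Finsupp.single x 1))).proj_eq g
  by_cases hg : g = 1
  · rw [if_pos hg] at h2
    exact (congrArg (counit k F) ((h1.proj_eq g).trans (if_pos hg))).trans h2.symm
  · rw [if_neg hg] at h2
    exact ((congrArg (counit k F) ((h1.proj_eq g).trans (if_neg hg))).trans
      (map_zero _)).trans h2.symm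

variable (c) in
/-- The counit morphism `𝓕 (kF) ⟶ k`, the restriction of the counit of `kF`. -/
def etaHom : (invFunctor c).obj (𝟙_ (FBimod c)) ⟶ 𝟙_ (TwVec c) :=
  TwVec.Hom.mk (V := FBimod.invObj (𝟙_ (FBimod c))) (W := TwVec.unit c)
    (counit k F ∘ₗ (FBimod.inv (𝟙_ (FBimod c))).subtype)
    (fun g u => counit_grG g u.1) (fun x u => counit_rAct x u.1)

/-- The invariants of `kF` are the multiples of `t`, on which the counit takes the value `1`. -/
theorem isIso_etaHom : IsIso (etaHom c) := by
  refine TwVec.isIso_of_bijective _ ⟨?_, fun (r : k) => ?_⟩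
  · intro (u : FBimod.inv (𝟙_ (FBimod c))) (v : FBimod.inv (𝟙_ (FBimod c))) huv
    have h1 : counit k F u.1 = counit k F v.1 := huv
    have h2 := (tAct_unit (c := c) u.1).trans ((congrArg (· • _) h1).trans (tAct_unit v.1).symm)
    exact Subtype.ext ((tAct_of_mem _ u.2).symm.trans (h2.trans (tAct_of_mem _ v.2)))
  · refine ⟨toInv (𝟙_ (FBimod c)) (Finsupp.single 1 r : F →₀ k), ?_⟩
    exact (counit_tAct (k := k) _).trans (counit_single 1 r)

theorem delta_left_unitality (U : FBimod c) :
    (λ_ ((invFunctor c).obj U)).inv =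
      (invFunctor c).map (λ_ U).inv ≫ delta (𝟙_ (FBimod c)) U ≫
        etaHom c ▷ (invFunctor c).obj U := by
  refine TwVec.hom_ext (LinearMap.ext fun (u : U.inv) => ?_)
  have hinj : Function.Injective (TensorProduct.map (LinearMap.id : k →ₗ[k] k) U.inv.subtype) :=
    TensorProduct.map_injective_of_flat_flat _ _ Function.injective_id U.inv.subtype_injective
  have h1 : ∀ z : FBimod.inv (𝟙_ (FBimod c)) ⊗[k] U.inv,
      TensorProduct.map (LinearMap.id : k →ₗ[k] k) U.inv.subtype
        (TensorProduct.map (counit k F ∘ₗ (FBimod.inv (𝟙_ (FBimod c))).subtype) LinearMap.id z) =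
      TensorProduct.map (counit k F) LinearMap.id (incl (𝟙_ (FBimod c)) U z) := fun z => by
    refine LinearMap.congr_fun (f := TensorProduct.map (LinearMap.id : k →ₗ[k] k) U.inv.subtype ∘ₗ
      TensorProduct.map (counit k F ∘ₗ (FBimod.inv (𝟙_ (FBimod c))).subtype) LinearMap.id)
      (g := TensorProduct.map (counit k F) LinearMap.id ∘ₗ incl (𝟙_ (FBimod c)) U)
      (TensorProduct.ext' fun _ _ => rfl) z
  have h2 : ∀ v : U.X.carrier, TensorProduct.map (counit k F) LinearMap.id
      (xi (𝟙_ (FBimod c)) U (tmulF (𝟙_ (FBimod c)) U ((Finsupp.single 1 1 : F →₀ k) ⊗ₜ v))) =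
        (1 : k) ⊗ₜ[k] U.tAct v := fun v => by
    refine LinearMap.congr_fun (f := TensorProduct.map (counit k F) LinearMap.id ∘ₗ
      xi (𝟙_ (FBimod c)) U ∘ₗ tmulF (𝟙_ (FBimod c)) U ∘ₗ
        TensorProduct.mk k (𝟙_ (FBimod c)).X.carrier U.X.carrier (Finsupp.single 1 1 : F →₀ k))
      (g := TensorProduct.mk k k U.X.carrier 1 ∘ₗ U.tAct) (U.grF.hom_ext fun x v hv => ?_) v
    refine (congrArg (TensorProduct.map (counit k F) LinearMap.id)
      (xi_tmulF (U := 𝟙_ (FBimod c)) (Finsupp.single 1 1 : F →₀ k) hv)).trans ?_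
    refine (TensorProduct.map_tmul _ _ _ _).trans ?_
    exact congrArg (· ⊗ₜ[k] U.tAct v) ((counit_rAct x _).trans (counit_single 1 (1 : k)))
  refine hinj (Eq.symm ((h1 (deltaLin (𝟙_ (FBimod c)) U (invLin (λ_ U).inv u))).trans ?_))
  rw [incl_deltaLin]
  refine (h2 u.1).trans ?_
  rw [tAct_of_mem _ u.2]
  rfl

theorem delta_right_unitality (U : FBimod c) :
    (ρ_ ((invFunctor c).obj U)).inv =
      (invFunctor c).map (ρ_ U).inv ≫ delta U (𝟙_ (FBimod c)) ≫
        (invFunctor c).obj U ◁ etaHom c := by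
  refine TwVec.hom_ext (LinearMap.ext fun (u : U.inv) => ?_)
  have hinj : Function.Injective (TensorProduct.map U.inv.subtype (LinearMap.id : k →ₗ[k] k)) :=
    TensorProduct.map_injective_of_flat_flat _ _ U.inv.subtype_injective Function.injective_id
  have h1 : ∀ z : U.inv ⊗[k] FBimod.inv (𝟙_ (FBimod c)),
      TensorProduct.map U.inv.subtype (LinearMap.id : k →ₗ[k] k)
        (TensorProduct.map LinearMap.id (counit k F ∘ₗ (FBimod.inv (𝟙_ (FBimod c))).subtype) z) =
      TensorProduct.map LinearMap.id (counit k F) (incl U (𝟙_ (FBimod c)) z) := fun z => by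
    refine LinearMap.congr_fun (f := TensorProduct.map U.inv.subtype (LinearMap.id : k →ₗ[k] k) ∘ₗ
      TensorProduct.map LinearMap.id (counit k F ∘ₗ (FBimod.inv (𝟙_ (FBimod c))).subtype))
      (g := TensorProduct.map LinearMap.id (counit k F) ∘ₗ incl U (𝟙_ (FBimod c)))
      (TensorProduct.ext' fun _ _ => rfl) z
  have h2 : (grF (𝟙_ (FBimod c))).Homog 1 (Finsupp.single 1 1 : F →₀ k) := by
    have h3 : (grF (𝟙_ (FBimod c))).Homog (piF h (1 : F)) (Finsupp.single 1 1 : F →₀ k) :=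
      Grading.Homog.push (homog_single F 1 (1 : k)) (piF h)
    rwa [(proj_F h 1).1] at h3
  refine hinj (Eq.symm ((h1 (deltaLin U (𝟙_ (FBimod c)) (invLin (ρ_ U).inv u))).trans ?_))
  rw [incl_deltaLin]
  refine (congrArg (TensorProduct.map LinearMap.id (counit k F))
    (xi_tmulF (V := 𝟙_ (FBimod c)) u.1 h2)).trans ?_
  refine (TensorProduct.map_tmul _ _ _ _).trans ?_
  rw [rAct_one]
  exact congrArg (u.1 ⊗ₜ[k] ·) ((counit_tAct _).trans (counit_single 1 (1 : k)))

end Unit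

/-- The comparison morphisms make the functor of invariants oplax monoidal. -/
instance oplaxMonoidal (c : KacPair k h) : (invFunctor c).OplaxMonoidal where
  η := etaHom c
  δ := delta
  δ_natural_left f V := delta_natural_left f V
  δ_natural_right U f := delta_natural_right U f
  oplax_associativity := delta_associativity
  oplax_left_unitality := delta_left_unitality
  oplax_right_unitality := delta_right_unitality

/-- The functor of invariants is monoidal, and its cotensorator is the comparison morphism. -/
theorem exists_monoidal (c : KacPair k h) : ∃ M : (invFunctor c).Monoidal,
    ∀ U U' : FBimod c, IsXi U U' (M.toOplaxMonoidal.δ U U') := by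
  have h1 : IsIso (Functor.OplaxMonoidal.η (invFunctor c)) := isIso_etaHom
  have h2 : ∀ U V, IsIso (Functor.OplaxMonoidal.δ (invFunctor c) U V) := isIso_delta
  exact ⟨Functor.Monoidal.ofOplaxMonoidal (invFunctor c), isXi_delta⟩

end FBimod

end Invariants

/-! ### Bimodules from pairs of actions -/

section Equivalence

variable {S : Type u} [Group S] [Fintype S] {F G : Subgroup S} {h : F.IsComplement' G}
variable {k : Type u} [Field k] {c : KacPair k h}

namespace FBimod

/-- A morphism of bimodules from a linear map that preserves degrees and commutes with both
actions. -/
def homMk {U V : FBimod c} (f : U.X.carrier →ₗ[k] V.X.carrier)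
    (h₁ : ∀ a u, U.X.gr.Homog a u → V.X.gr.Homog a (f u))
    (h₂ : ∀ x u, f (U.lAct x u) = V.lAct x (f u)) (h₃ : ∀ x u, f (U.rAct x u) = V.rAct x (f u)) :
    U ⟶ V where
  hom := GrVec.mkHom f h₁
  left_act_hom := GrVec.hom_ext <|
    TensorProduct.ext (grp_ext fun x => LinearMap.ext fun u => h₂ x u)
  right_act_hom := GrVec.hom_ext <|
    TensorProduct.ext (LinearMap.ext fun u => grp_ext fun x => h₃ x u)

section OfActions

variable (X : GrVec (kacCocycle c)) (l r : F → Module.End k X.carrier)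

/-- The map `x ⊗ u ↦ l x u`. -/
def actLeftLin : (F →₀ k) ⊗[k] X.carrier →ₗ[k] X.carrier :=
  TensorProduct.lift (Finsupp.linearCombination k l)

/-- The map `u ⊗ x ↦ r x u`. -/
def actRightLin : X.carrier ⊗[k] (F →₀ k) →ₗ[k] X.carrier :=
  TensorProduct.lift (LinearMap.flip (Finsupp.linearCombination k r))

theorem actLeftLin_tmul (x : F) (u : X.carrier) :
    actLeftLin X l (Finsupp.single x 1 ⊗ₜ u) = l x u := by
  rw [actLeftLin, TensorProduct.lift.tmul, Finsupp.linearCombination_single, one_smul]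

theorem actRightLin_tmul (x : F) (u : X.carrier) :
    actRightLin X r (u ⊗ₜ Finsupp.single x 1) = r x u := by
  rw [actRightLin, TensorProduct.lift.tmul, LinearMap.flip_apply,
    Finsupp.linearCombination_single, one_smul]

variable {X l r}

theorem actLeftLin_proj (hl : ∀ (x : F) a u, X.gr.Homog a u → X.gr.Homog (x * a) (l x u)) (d : S)
    (z : (F →₀ k) ⊗[k] X.carrier) :
    actLeftLin X l (((grpGrading k F).tensor X.gr).proj d z) =
      X.gr.proj d (actLeftLin X l z) := by
  classical
  refine LinearMap.congr_fun (f := actLeftLin X l ∘ₗ ((grpGrading k F).tensor X.gr).proj d)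
    (g := X.gr.proj d ∘ₗ actLeftLin X l)
    (TensorProduct.ext (grp_ext fun x => X.gr.hom_ext fun a u hu => ?_)) z
  change actLeftLin X l (((grpGrading k F).tensor X.gr).proj d (_ ⊗ₜ _)) =
    X.gr.proj d (actLeftLin X l (_ ⊗ₜ _))
  rw [((homog_single F x (1 : k)).tmul hu).proj_eq, actLeftLin_tmul, (hl x a u hu).proj_eq]
  split_ifs
  · rw [actLeftLin_tmul]
  · rw [map_zero]

theorem actRightLin_proj (hr : ∀ (x : F) a u, X.gr.Homog a u → X.gr.Homog (a * x) (r x u)) (d : S)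
    (z : X.carrier ⊗[k] (F →₀ k)) :
    actRightLin X r ((X.gr.tensor (grpGrading k F)).proj d z) =
      X.gr.proj d (actRightLin X r z) := by
  classical
  refine LinearMap.congr_fun (f := actRightLin X r ∘ₗ (X.gr.tensor (grpGrading k F)).proj d)
    (g := X.gr.proj d ∘ₗ actRightLin X r)
    (TensorProduct.ext (X.gr.hom_ext fun a u hu => grp_ext fun x => ?_)) z
  change actRightLin X r ((X.gr.tensor (grpGrading k F)).proj d (_ ⊗ₜ _)) =
    X.gr.proj d (actRightLin X r (_ ⊗ₜ _))
  rw [(hu.tmul (homog_single F x (1 : k))).proj_eq, actRightLin_tmul, (hr x a u hu).proj_eq]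
  split_ifs
  · rw [actRightLin_tmul]
  · rw [map_zero]

variable (X l r)

/-- The bimodule given by a left action `l` and a twisted right action `r` of `F` on a graded
space. -/
def ofActions (hl : ∀ (x : F) a u, X.gr.Homog a u → X.gr.Homog (x * a) (l x u))
    (hr : ∀ (x : F) a u, X.gr.Homog a u → X.gr.Homog (a * x) (r x u))
    (l_one : ∀ u, l 1 u = u) (l_mul : ∀ x y u, l x (l y u) = l (x * y) u)
    (r_one : ∀ u, r 1 u = u)
    (r_mul : ∀ x y a u, X.gr.Homog a u → r y (r x u) = c.σval (pG h a) x y • r (x * y) u)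
    (r_l : ∀ x y u, r y (l x u) = l x (r y u)) : FBimod c where
  X := X
  actLeft := GrVec.Hom.mk (U := (kacAlg c).X ⊗ X) (actLeftLin X l) (actLeftLin_proj hl)
  actRight := GrVec.Hom.mk (U := X ⊗ (kacAlg c).X) (actRightLin X r) (actRightLin_proj hr)
  one_actLeft := GrVec.hom_ext <| TensorProduct.ext <| LinearMap.ext_ring <| LinearMap.ext
    fun u => (actLeftLin_tmul X l 1 u).trans ((l_one u).trans (one_smul k u).symm)
  actRight_one := GrVec.hom_ext <| TensorProduct.ext <| LinearMap.ext fun u =>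
    LinearMap.ext_ring <| (actRightLin_tmul X r 1 u).trans ((r_one u).trans (one_smul k u).symm)
  left_assoc := GrVec.hom_ext <| TensorProduct.ext <| TensorProduct.ext <| grp_ext fun x =>
    grp_ext fun y => X.gr.hom_ext fun a u hu => by
      have h2 := Grading.assocEquiv_tmul (kacCocycle c) (homog_single F x (1 : k))
        (homog_single F y (1 : k)) hu
      rw [val_F_left, one_smul] at h2
      have h3 := grpMul_single F x y (1 : k) 1
      rw [one_mul] at h3
      let N : (F →₀ k) ⊗[k] ((F →₀ k) ⊗[k] X.carrier) →ₗ[k] X.carrier :=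
        actLeftLin X l ∘ₗ TensorProduct.map LinearMap.id (actLeftLin X l)
      have h4 : N (Finsupp.single x 1 ⊗ₜ (Finsupp.single y 1 ⊗ₜ u)) = l (x * y) u := by
        simp only [N, LinearMap.comp_apply, TensorProduct.map_tmul, LinearMap.id_apply,
          actLeftLin_tmul, l_mul]
      refine Eq.trans ?_ ((congrArg N h2).trans h4).symm
      exact (congrArg (fun z => actLeftLin X l (z ⊗ₜ u)) h3).trans (actLeftLin_tmul X l _ u)
  right_assoc := by
    rw [← cancel_epi (α_ X (kacAlg c).X (kacAlg c).X).hom, Iso.hom_inv_id_assoc]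
    refine GrVec.hom_ext <| TensorProduct.ext <| TensorProduct.ext <| X.gr.hom_ext fun a u hu =>
      grp_ext fun x => grp_ext fun y => ?_
    have h2 := Grading.assocEquiv_tmul (kacCocycle c) hu (homog_single F x (1 : k))
      (homog_single F y (1 : k))
    rw [val_F_mid] at h2
    have h3 := grpMul_single F x y (1 : k) 1
    rw [one_mul] at h3
    let N : X.carrier ⊗[k] ((F →₀ k) ⊗[k] (F →₀ k)) →ₗ[k] X.carrier :=
      actRightLin X r ∘ₗ TensorProduct.map LinearMap.id (grpMul k F)
    have h4 : N (c.σval (pG h a) x y • u ⊗ₜ (Finsupp.single x 1 ⊗ₜ Finsupp.single y 1)) =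
        r y (r x u) := by
      simp only [N, map_smul, LinearMap.comp_apply, TensorProduct.map_tmul, LinearMap.id_apply,
        h3, actRightLin_tmul, r_mul x y a u hu]
    refine ((congrArg N h2).trans h4).trans ?_
    exact ((congrArg (fun z => actRightLin X r (z ⊗ₜ Finsupp.single y 1))
      (actRightLin_tmul X r x u)).trans (actRightLin_tmul X r y _)).symm
  middle_assoc := GrVec.hom_ext <| TensorProduct.ext <| TensorProduct.ext <| grp_ext fun x =>
    X.gr.hom_ext fun a u hu => grp_ext fun y => by
      have h2 := Grading.assocEquiv_tmul (kacCocycle c) (homog_single F x (1 : k)) hu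
        (homog_single F y (1 : k))
      rw [val_F_left, one_smul] at h2
      let N : (F →₀ k) ⊗[k] (X.carrier ⊗[k] (F →₀ k)) →ₗ[k] X.carrier :=
        actLeftLin X l ∘ₗ TensorProduct.map LinearMap.id (actRightLin X r)
      have h4 : N (Finsupp.single x 1 ⊗ₜ (u ⊗ₜ Finsupp.single y 1)) = r y (l x u) := by
        simp only [N, LinearMap.comp_apply, TensorProduct.map_tmul, LinearMap.id_apply,
          actLeftLin_tmul, actRightLin_tmul, r_l]
      refine Eq.trans ?_ ((congrArg N h2).trans h4).symm
      exact (congrArg (fun z => actRightLin X r (z ⊗ₜ Finsupp.single y 1))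
        (actLeftLin_tmul X l x u)).trans (actRightLin_tmul X r y _)

end OfActions

/-! ### The functor of invariants is fully faithful -/

section FullyFaithful

variable [Fintype F] [CharZero k]

/-- A vector of degree `a` is recovered as the component of degree `a` of its average. -/
theorem card_smul_proj_tAct (U : FBimod c) {a : S} {u : U.X.carrier} (hu : U.X.gr.Homog a u) :
    (Fintype.card F : k) • U.X.gr.proj a (U.tAct u) = u := by
  classical
  have hF : (Fintype.card F : k) ≠ 0 := Nat.cast_ne_zero.2 Fintype.card_ne_zero
  rw [tAct_apply, map_smul, smul_smul, mul_inv_cancel₀ hF, one_smul, map_sum,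
    Finset.sum_eq_single 1]
  · rw [lAct_one, hu]
  · intro x _ hx
    rw [(U.lAct_homog x hu).proj_eq, if_neg]
    intro e
    exact hx (Subtype.ext (mul_eq_right.1 e.symm))
  · simp

variable [Fintype G]

/-- An invariant vector of degree `p(a)` is recovered from its component of degree `a` by
averaging. -/
theorem card_smul_tAct_proj (U : FBimod c) {a : S} {u : U.X.carrier} (hu : u ∈ U.inv)
    (hu' : U.grG.Homog (pG h a) u) : (Fintype.card F : k) • U.tAct (U.X.gr.proj a u) = u := by
  classical
  have h1 : U.X.gr.proj a u = U.grF.proj (piF h a) u := by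
    refine U.X.gr.push_ext (pG h) (pG h a) (fun b v hb hv => ?_) hu'
    have hv' : U.grF.Homog (piF h b) v := hv.push _
    rw [hv.proj_eq, hv'.proj_eq]
    by_cases e : a = b
    · rw [if_pos e, if_pos (by rw [e])]
    · rw [if_neg e, if_neg fun e' => e (by rw [← piF_mul_pG h a, ← piF_mul_pG h b, e', hb])]
  have h2 := U.lAct_grF (piF h a) 1 u
  rw [hu, mul_one] at h2
  rw [h1, ← h2, tAct_lAct, card_smul_tAct_grF _ hu]

/-- The extension of a linear map `φ` on the invariants to a degree-preserving map, given by
`u ↦ |F| φ(t ⇀ u)_a` for `u` of degree `a`. -/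
def extend {U V : FBimod c} (φ : U.inv →ₗ[k] V.inv) : U.X.carrier →ₗ[k] V.X.carrier :=
  (Fintype.card F : k) •
    ∑ a, V.X.gr.proj a ∘ₗ V.inv.subtype ∘ₗ φ ∘ₗ U.toInv ∘ₗ U.X.gr.proj a

theorem extend_apply {U V : FBimod c} (φ : U.inv →ₗ[k] V.inv) (u : U.X.carrier) :
    extend φ u = (Fintype.card F : k) • ∑ a, V.X.gr.proj a (φ (U.toInv (U.X.gr.proj a u))) := by
  rw [extend, LinearMap.smul_apply, LinearMap.sum_apply]
  rfl

theorem extend_homog {U V : FBimod c} (φ : U.inv →ₗ[k] V.inv) {a : S} {u : U.X.carrier}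
    (hu : U.X.gr.Homog a u) :
    extend φ u = (Fintype.card F : k) • V.X.gr.proj a (φ (U.toInv u)) := by
  classical
  rw [extend_apply, Finset.sum_eq_single a]
  · rw [hu]
  · intro b _ hb
    rw [hu.proj_eq, if_neg hb]
    simp only [map_zero, ZeroMemClass.coe_zero]
  · simp

theorem lAct_proj (U : FBimod c) (x : F) (a : S) (u : U.X.carrier) :
    U.lAct x (U.X.gr.proj a u) = U.X.gr.proj (x * a) (U.lAct x u) := by
  classical
  refine LinearMap.congr_fun (f := U.lAct x ∘ₗ U.X.gr.proj a)
    (g := U.X.gr.proj (x * a) ∘ₗ U.lAct x) (U.X.gr.hom_ext fun b v hv => ?_) u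
  rw [LinearMap.comp_apply, LinearMap.comp_apply, hv.proj_eq, (U.lAct_homog x hv).proj_eq]
  simp only [mul_right_inj]
  split_ifs <;> simp

theorem rAct_proj (U : FBimod c) (x : F) (a : S) (u : U.X.carrier) :
    U.rAct x (U.X.gr.proj a u) = U.X.gr.proj (a * x) (U.rAct x u) := by
  classical
  refine LinearMap.congr_fun (f := U.rAct x ∘ₗ U.X.gr.proj a)
    (g := U.X.gr.proj (a * x) ∘ₗ U.rAct x) (U.X.gr.hom_ext fun b v hv => ?_) u
  rw [LinearMap.comp_apply, LinearMap.comp_apply, hv.proj_eq, (U.rAct_homog x hv).proj_eq]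
  simp only [mul_left_inj]
  split_ifs <;> simp

theorem extend_lAct {U V : FBimod c} (φ : U.inv →ₗ[k] V.inv) (x : F) (u : U.X.carrier) :
    extend φ (U.lAct x u) = V.lAct x (extend φ u) := by
  refine LinearMap.congr_fun (f := extend φ ∘ₗ U.lAct x) (g := V.lAct x ∘ₗ extend φ)
    (U.X.gr.hom_ext fun a u hu => ?_) u
  have h1 : U.toInv (U.lAct x u) = U.toInv u := Subtype.ext (U.tAct_lAct x u)
  rw [LinearMap.comp_apply, LinearMap.comp_apply, extend_homog _ hu,
    extend_homog _ (U.lAct_homog x hu), h1, map_smul, lAct_proj, (φ (U.toInv u)).2 x]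

theorem extend_rAct {U V : FBimod c} {φ : U.inv →ₗ[k] V.inv} {x : F}
    (hφ : ∀ u, φ (U.invAct x u) = V.invAct x (φ u)) (u : U.X.carrier) :
    extend φ (U.rAct x u) = V.rAct x (extend φ u) := by
  refine LinearMap.congr_fun (f := extend φ ∘ₗ U.rAct x) (g := V.rAct x ∘ₗ extend φ)
    (U.X.gr.hom_ext fun a u hu => ?_) u
  have h1 : U.toInv (U.rAct x u) = U.invAct x (U.toInv u) := Subtype.ext (U.rAct_tAct x u).symm
  have h2 : (φ (U.invAct x (U.toInv u)) : V.X.carrier) = V.rAct x (φ (U.toInv u)) :=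
    congrArg Subtype.val (hφ _)
  rw [LinearMap.comp_apply, LinearMap.comp_apply, extend_homog _ hu,
    extend_homog _ (U.rAct_homog x hu), h1, h2, map_smul, rAct_proj]

/-- The extension of a morphism between spaces of invariants to a morphism of bimodules. -/
def extendHom {U V : FBimod c} (φ : U.invObj ⟶ V.invObj) : U ⟶ V :=
  let ψ : U.inv →ₗ[k] V.inv := TwVec.lin φ
  homMk (extend ψ)
    (fun a u hu => by
      rw [extend_homog _ hu]
      exact (V.X.gr.homog_proj a _).smul _)
    (extend_lAct ψ) (fun x => extend_rAct (TwVec.lin_act φ x))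

theorem invMap_extendHom {U V : FBimod c} (φ : U.invObj ⟶ V.invObj) :
    invMap (extendHom φ) = φ := by
  classical
  refine TwVec.hom_ext (U.invGr.hom_ext fun g u hu => Subtype.ext ?_)
  have hu' : U.grG.Homog g u.1 := (U.grG.restrict_homog _ _ g u).1 hu
  let ψ : U.inv →ₗ[k] V.inv := TwVec.lin φ
  have h1 : V.grG.proj g (ψ u).1 = (ψ u).1 :=
    congrArg Subtype.val ((TwVec.lin_proj φ g u).symm.trans (congrArg ψ hu))
  change extend ψ u.1 = (ψ u).1
  rw [extend_apply, ← h1, grG, Grading.push_proj, Finset.smul_sum]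
  refine Finset.sum_congr rfl fun a _ => ?_
  split_ifs with ha
  · subst ha
    have h2 : (Fintype.card F : k) • U.toInv (U.X.gr.proj a u.1) = u :=
      Subtype.ext (U.card_smul_tAct_proj u.2 hu')
    rw [← map_smul, ← Submodule.coe_smul, ← map_smul, h2]
  · have h2 : U.X.gr.proj a u.1 = 0 := by
      refine U.X.gr.push_ext (pG h) g (L := U.X.gr.proj a) (L' := 0) (fun b v hb hv => ?_) hu'
      rw [hv.proj_eq, if_neg (by rintro rfl; exact ha hb), LinearMap.zero_apply]
    rw [h2]
    simp only [map_zero, ZeroMemClass.coe_zero, smul_zero]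

theorem invMap_injective {U V : FBimod c} {f f' : U ⟶ V} (e : invMap f = invMap f') : f = f' := by
  refine Bimod.hom_ext _ _ (GrVec.hom_ext (U.X.gr.hom_ext fun a u hu => ?_))
  have h1 : GrVec.lin f.hom (U.tAct u) = GrVec.lin f'.hom (U.tAct u) :=
    congrArg Subtype.val (LinearMap.congr_fun (congrArg TwVec.lin e) (U.toInv u))
  rw [← U.card_smul_proj_tAct hu, map_smul, map_smul, GrVec.lin_proj, GrVec.lin_proj, h1]

instance : (invFunctor c).Faithful := ⟨invMap_injective⟩

instance : (invFunctor c).Full := ⟨fun φ => ⟨extendHom φ, invMap_extendHom φ⟩⟩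

/-- A bimodule is the sum of the homogeneous components of its invariants, so that it is
finite-dimensional as soon as the space of invariants is. -/
theorem finite_inv_iff (U : FBimod c) : Module.Finite k U.inv ↔ Module.Finite k U.X.carrier := by
  refine ⟨fun _ => ?_, fun _ => inferInstance⟩
  let L : (S → U.inv) →ₗ[k] U.X.carrier :=
    ∑ a, U.X.gr.proj a ∘ₗ U.inv.subtype ∘ₗ LinearMap.proj a
  refine Module.Finite.of_surjective L fun u => ?_
  refine ⟨fun a => (Fintype.card F : k) • U.toInv (U.X.gr.proj a u), ?_⟩
  rw [LinearMap.sum_apply]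
  conv_rhs => rw [← U.X.gr.sum_proj u]
  refine Finset.sum_congr rfl fun a _ => ?_
  refine Eq.trans ?_ (U.card_smul_proj_tAct (U.X.gr.homog_proj a u))
  exact map_smul (U.X.gr.proj a) _ _

end FullyFaithful

end FBimod

end Equivalence

/-! ### The bimodule induced from a twisted space -/

section Induced

variable {S : Type u} [Group S] [Fintype S] {F G : Subgroup S} {h : F.IsComplement' G}
variable {k : Type u} [Field k] {c : KacPair k h} [Fintype G]

namespace TwVec

variable (V : TwVec c)

theorem finsupp_ext {W : Type u} [AddCommGroup W] [Module k W]
    {f f' : (F →₀ V.carrier) →ₗ[k] W}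
    (hf : ∀ x g v, V.gr.Homog g v → f (Finsupp.single x v) = f' (Finsupp.single x v)) : f = f' :=
  Finsupp.lhom_ext' fun x => V.gr.hom_ext fun g v hv => hf x g v hv

variable [Fintype F]

/-- The `S`-grading of `kF ⊗ V`, realized as the space of functions on `F` with values in `V`:
the degree of `x ⊗ v` is `x |v|`. -/
def indGr : Grading k S (F →₀ V.carrier) :=
  Grading.ofSpan
    (fun a => Finsupp.lsingle (piF h a) ∘ₗ V.gr.proj (pG h a) ∘ₗ Finsupp.lapply (piF h a))
    (fun u => by
      simp only [LinearMap.comp_apply, Finsupp.lapply_apply, Finsupp.lsingle_apply]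
      rw [← h.equiv.symm.sum_comp, Fintype.sum_prod_type]
      conv_rhs => rw [← Finsupp.univ_sum_single u]
      refine Finset.sum_congr rfl fun x _ => ?_
      have h1 : ∀ g : G, h.equiv.symm (x, g) = x * g := fun _ => rfl
      simp only [h1, piF_mk, pG_mk]
      exact (map_sum (Finsupp.lsingle x : V.carrier →ₗ[k] F →₀ V.carrier) _ _).symm.trans
        (congrArg _ (V.gr.sum_proj (u x))))
    (fun a b u hab => by
      simp only [LinearMap.comp_apply, Finsupp.lapply_apply, Finsupp.lsingle_apply]
      by_cases hF : piF h a = piF h b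
      · have hG : pG h a ≠ pG h b := fun hG => hab <| by
          rw [← piF_mul_pG h a, ← piF_mul_pG h b, hF, hG]
        rw [hF, Finsupp.single_eq_same, V.gr.proj_ne hG, Finsupp.single_zero]
      · rw [Finsupp.single_eq_of_ne hF, map_zero, Finsupp.single_zero])

theorem indGr_homog (x : F) {g : G} {v : V.carrier} (hv : V.gr.Homog g v) :
    V.indGr.Homog (x * g) (Finsupp.single x v) := by
  change Finsupp.single (piF h (x * g)) (V.gr.proj (pG h (x * g))
    (Finsupp.single x v (piF h (x * g)))) = _
  rw [piF_mk, pG_mk, Finsupp.single_eq_same, hv]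

/-- Two linear maps which agree on the vectors `x ⊗ v` with `v` homogeneous and `x |v| = a` agree
on the vectors of degree `a`. -/
theorem indGr_ext {W : Type u} [AddCommGroup W] [Module k W] {L L' : (F →₀ V.carrier) →ₗ[k] W}
    {a : S} (hL : ∀ v, V.gr.Homog (pG h a) v →
      L (Finsupp.single (piF h a) v) = L' (Finsupp.single (piF h a) v))
    {u : F →₀ V.carrier} (hu : V.indGr.Homog a u) : L u = L' u := by
  rw [← hu]
  exact hL _ (V.gr.homog_proj _ _)

/-- The left action `y ⇀ (x ⊗ v) = y x ⊗ v`. -/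
def indL (y : F) : Module.End k (F →₀ V.carrier) := Finsupp.lmapDomain V.carrier k (y * ·)

theorem indL_single (y x : F) (v : V.carrier) :
    V.indL y (Finsupp.single x v) = Finsupp.single (y * x) v := Finsupp.mapDomain_single

/-- The right action `(x ⊗ v) ↼ y = x (|v| ▷ y) ⊗ (v ◁ y)`. -/
def indR (y : F) : Module.End k (F →₀ V.carrier) :=
  Finsupp.lsum k fun x => ∑ g, Finsupp.lsingle (x * lact h g y) ∘ₗ V.act y ∘ₗ V.gr.proj g

theorem indR_single (y x : F) {g : G} {v : V.carrier} (hv : V.gr.Homog g v) :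
    V.indR y (Finsupp.single x v) = Finsupp.single (x * lact h g y) (V.act y v) := by
  classical
  rw [indR, Finsupp.lsum_single, LinearMap.sum_apply, Finset.sum_eq_single g]
  · rw [LinearMap.comp_apply, LinearMap.comp_apply, hv, Finsupp.lsingle_apply]
  · intro g' _ hg
    rw [LinearMap.comp_apply, LinearMap.comp_apply, hv.proj_eq, if_neg hg, map_zero, map_zero]
  · simp

/-- The graded space `kF ⊗ V`. -/
def indVec : GrVec (kacCocycle c) where
  carrier := F →₀ V.carrier
  gr := V.indGr

/-- The bimodule `kF ⊗ V`. -/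
def ind : FBimod c :=
  FBimod.ofActions V.indVec V.indL V.indR
    (fun x a u hu => by
      refine (V.indGr_ext (L := V.indL x) (L' := V.indGr.proj (x * a) ∘ₗ V.indL x)
        (fun v hv => ?_) hu).symm
      have h1 := V.indGr_homog (x * piF h a) hv
      rw [Subgroup.coe_mul, mul_assoc, piF_mul_pG] at h1
      rw [LinearMap.comp_apply, indL_single, h1])
    (fun x a u hu => by
      refine (V.indGr_ext (L := V.indR x) (L' := V.indGr.proj (a * x) ∘ₗ V.indR x)
        (fun v hv => ?_) hu).symm
      have h1 := V.indGr_homog (piF h a * lact h (pG h a) x) (V.twisted.act_homog x _ v hv)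
      rw [Subgroup.coe_mul, mul_assoc, lact_mul_ract, ← mul_assoc, piF_mul_pG] at h1
      rw [LinearMap.comp_apply, V.indR_single x _ hv, h1])
    (LinearMap.congr_fun (f := V.indL 1) (g := LinearMap.id) (V.finsupp_ext fun x g v _ => by
      rw [indL_single, one_mul, LinearMap.id_apply]))
    (fun x y => LinearMap.congr_fun (f := V.indL x ∘ₗ V.indL y) (g := V.indL (x * y))
      (V.finsupp_ext fun z g v _ => by
        rw [LinearMap.comp_apply, indL_single, indL_single, indL_single, mul_assoc]))
    (LinearMap.congr_fun (f := V.indR 1) (g := LinearMap.id) (V.finsupp_ext fun x g v hv => by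
      rw [V.indR_single 1 x hv, (act_one_right h g).1, mul_one, V.twisted.act_one,
        LinearMap.id_apply]))
    (fun x y a u hu => by
      refine V.indGr_ext (L := V.indR y ∘ₗ V.indR x) (L' := c.σval (pG h a) x y • V.indR (x * y))
        (fun v hv => ?_) hu
      rw [LinearMap.comp_apply, LinearMap.smul_apply, V.indR_single x _ hv,
        V.indR_single y _ (V.twisted.act_homog x _ v hv), V.indR_single (x * y) _ hv,
        V.twisted.act_act x y _ v hv, (act_mul_right h _ x y).1, mul_assoc,
        Finsupp.smul_single])
    (fun x y => LinearMap.congr_fun (f := V.indR y ∘ₗ V.indL x) (g := V.indL x ∘ₗ V.indR y)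
      (V.finsupp_ext fun z g v hv => by
        rw [LinearMap.comp_apply, LinearMap.comp_apply, indL_single, V.indR_single y _ hv,
          V.indR_single y _ hv, indL_single, mul_assoc]))

theorem lAct_ind (x : F) (u : F →₀ V.carrier) : V.ind.lAct x u = V.indL x u :=
  FBimod.actLeftLin_tmul V.indVec V.indL x u

theorem rAct_ind (x : F) (u : F →₀ V.carrier) : V.ind.rAct x u = V.indR x u :=
  FBimod.actRightLin_tmul V.indVec V.indR x u

/-- The invariant vector `∑ x ⊗ v`. -/
def indConst : V.carrier →ₗ[k] F →₀ V.carrier := ∑ x, Finsupp.lsingle x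

theorem indConst_eq (v : V.carrier) : V.indConst v = ∑ x, Finsupp.single x v := by
  rw [indConst, LinearMap.sum_apply]
  rfl

theorem indConst_apply (v : V.carrier) (x : F) : V.indConst v x = v := by
  classical
  simp [indConst_eq, Finsupp.finsetSum_apply, Finsupp.single_apply]

theorem indConst_mem (v : V.carrier) : V.indConst v ∈ V.ind.inv := fun y => by
  refine (V.lAct_ind y _).trans ?_
  rw [indConst_eq, map_sum]
  simp only [indL_single]
  exact Equiv.sum_comp (Equiv.mulLeft y) fun x => (Finsupp.single x v : F →₀ V.carrier)

theorem indConst_act (y : F) (v : V.carrier) :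
    V.indConst (V.act y v) = V.indR y (V.indConst v) := by
  refine LinearMap.congr_fun (f := V.indConst ∘ₗ V.act y) (g := V.indR y ∘ₗ V.indConst)
    (V.gr.hom_ext fun g v hv => ?_) v
  rw [LinearMap.comp_apply, LinearMap.comp_apply, indConst_eq, indConst_eq, map_sum]
  simp only [V.indR_single y _ hv]
  exact (Equiv.sum_comp (Equiv.mulRight (lact h g y)) fun x =>
    (Finsupp.single x (V.act y v) : F →₀ V.carrier)).symm

theorem indConst_homog {g : G} {v : V.carrier} (hv : V.gr.Homog g v) :
    V.ind.grG.Homog g (V.indConst v) := by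
  have h1 : ∀ x : F, (V.indGr.push (pG h)).proj g (Finsupp.single x v) = Finsupp.single x v :=
    fun x => by
      have := (V.indGr_homog x hv).push (pG h)
      rw [pG_mk] at this
      exact this
  change (V.indGr.push (pG h)).proj g (V.indConst v) = V.indConst v
  rw [indConst_eq, map_sum]
  exact Finset.sum_congr rfl fun x _ => h1 x

/-- The canonical map `v ↦ ∑ x ⊗ v` from `V` to `𝓕 (kF ⊗ V)`. -/
def indUnit : V ⟶ V.ind.invObj :=
  Hom.mk (W := V.ind.invObj) (V.indConst.codRestrict V.ind.inv V.indConst_mem)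
    (V.gr.comm_of_homog V.ind.invObj.gr _ fun g _ hv =>
      (V.ind.grG.restrict_homog _ _ g _).2 (V.indConst_homog hv))
    (fun y v => Subtype.ext ((V.indConst_act y v).trans (V.rAct_ind y _).symm))

theorem isIso_indUnit : IsIso V.indUnit := by
  refine isIso_of_bijective _ ⟨fun v w e => ?_, fun (u : V.ind.inv) => ?_⟩
  · have e' : V.indConst v = V.indConst w := congrArg Subtype.val e
    rw [← V.indConst_apply v 1, e', indConst_apply]
  · obtain ⟨u, hu⟩ := u
    let u' : F →₀ V.carrier := u
    refine ⟨u' 1, Subtype.ext (show V.indConst (u' 1) = u' from Finsupp.ext fun x => ?_)⟩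
    have h1 : V.indL x u' = u' := (V.lAct_ind x u').symm.trans (hu x)
    have h2 : V.indL x u' (x * 1) = u' 1 := Finsupp.mapDomain_apply (mul_right_injective x) u' 1
    rw [indConst_apply, ← h2, h1, mul_one]

end TwVec

instance [Fintype F] : (FBimod.invFunctor c).EssSurj where
  mem_essImage V :=
    have := V.isIso_indUnit
    ⟨V.ind, ⟨(asIso V.indUnit).symm⟩⟩

end Induced

end KacBimodule

end

theorem mainTheorem3 {k : Type u} [Field k] [IsAlgClosed k] [CharZero k]
    {S : Type u} [Group S] [Fintype S] (F G : Subgroup S) [Fintype F] [Fintype G]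
    (h : F.IsComplement' G) (c : KacBimodule.KacPair k h) :
    (KacBimodule.FBimod.invFunctor c).IsEquivalence ∧
    (∃ M : (KacBimodule.FBimod.invFunctor c).Monoidal,
      ∀ U U' : KacBimodule.FBimod c,
        KacBimodule.FBimod.IsXi U U' (M.toOplaxMonoidal.δ U U')) ∧
    (∀ U : KacBimodule.FBimod c,
      Module.Finite k ((KacBimodule.FBimod.invFunctor c).obj U).carrier ↔
        Module.Finite k U.X.carrier) := by
  refine ⟨{}, KacBimodule.FBimod.exists_monoidal c, fun U => ?_⟩
  exact KacBimodule.FBimod.finite_inv_iff U
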